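/- Work over $\mathbb C$. Write $\mathbb C_*((x_1,x_2))$ for the fraction field of $\mathbb C((x_1,x_2))=\mathbb C[[x_1,x_2]][x_1^{-1},x_2^{-1}]$, and use the same notation $U((x_1,x_2))$ for a vector space $U$. Fix a nonzero $p(x)\in\mathbb C((x))$, put $\phi(x,z)=e^{zp(x)\frac{d}{dx}}x\in\mathbb C((x))[[z]]$, and let substitution of $x_1=\phi(x_2,z)$ in $A\in U((x_1,x_2))$ mean $A(\phi(x_2,z),x_2)=\big(e^{zp(x_1)\partial_{x_1}}A(x_1,x_2)\big)|_{x_1=x_2}$. For $U=\mathbb C$ this is a ring embedding into the field $\mathbb C((x_2))((z))$, which extends to $\mathbb C_*((x_1,x_2))$. Let $\mathbb C_\phi((x_1,x_2))$ be the set of all $F\in\mathbb C_*((x_1,x_2))$ with $p(x_1)\partial_{x_1}F=-p(x_2)\partial_{x_2}F$; then $F(\phi(x,z),x)\in\mathbb C((z))$, and $F\mapsto F(\phi(x,z),x)$ is an injective map from $\mathbb C_\phi((x_1,x_2))$ to $\mathbb C((z))$. Let $\mathbb C_\phi((z))$ be its image, and for $f\in\mathbb C_\phi((z))$ let $\widehat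 f(x_1,x_2)\in\mathbb C_\phi((x_1,x_2))$ be its preimage. Let $\iota_{x_2,x_1}:\mathbb C_*((x_1,x_2))\to\mathbb C((x_2))((x_1))$ be the field embedding extending the inclusion of $\mathbb C((x_1,x_2))$. A *nonlocal vertex algebra* is a vector space $V$ with a vector ${\bf 1}$ and a linear map $v\mapsto Y(v,x)=\sum_{n\in\mathbb Z}v_nx^{-n-1}\in\mathrm{Hom}(V,V((x)))$ such that $Y({\bf 1},x)=1$, $Y(v,x){\bf 1}\in v+xV[[x]]$, and for all $u,v\in V$ there is $k\in\mathbb N$ with $(x_1-x_2)^kY(u,x_1)Y(v,x_2)\in\mathrm{Hom}(V,V((x_1,x_2)))$ and $\big((x_1-x_2)^kY(u,x_1)Y(v,x_2)\big)|_{x_1=x_2+x_0}=x_0^kY(Y(u,x_0)v,x_2)$. Let $G$ be a group and $\chi,\chi_\phi:G\to\mathbb C^\times$ linear characters with $\phi(x,\chi(g)z)=\chi_\phi(g)\,\phi(\chi_\phi(g)^{-1}x,z)$ for all $g\in G$. Let $V$ be a *$(G,\chi)$-module nonlocal vertex algebra*: a nonlocal vertex algebra with a representation $R$ of $G$ on $V$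 such that $R(g){\bf 1}={\bf 1}$ and $R(g)Y(v,x)R(g)^{-1}=Y(R(g)v,\chi(g)x)$. Let $(W,Y_W)$ be a *$(G,\chi_\phi)$-equivariant $\phi$-coordinated quasi $V$-module*: a vector space $W$ with a linear map $v\mapsto Y_W(v,x)\in\mathrm{Hom}(W,W((x)))$ such that * $Y_W({\bf 1},x)=1_W$; * for all $u,v\in V$ there is a nonzero $f\in\mathbb C((x_1,x_2))$ with $f(x_1,x_2)Y_W(u,x_1)Y_W(v,x_2)\in\mathrm{Hom}(W,W((x_1,x_2)))$ and $\big(f(x_1,x_2)Y_W(u,x_1)Y_W(v,x_2)\big)|_{x_1=\phi(x_2,z)}=f(\phi(x_2,z),x_2)Y_W(Y(u,z)v,x_2)$; * $Y_W(R(g)v,x)=Y_W(v,\chi_\phi(g)^{-1}x)$ for $g\in G$, $v\in V$; * for all $u,v\in V$ there is a finite product $q(x)$ of polynomials $x-\chi_\phi(g)$, $g\in G$, with $q(x_1/x_2)Y_W(u,x_1)Y_W(v,x_2)\in\mathrm{Hom}(W,W((x_1,x_2)))$. **Proposition.** Let $G^0$ be a complete set of coset representatives of $\ker\chi_\phi$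 in $G$. Let $u,v,u^{(i)},v^{(i)}\in V$ and $f_i(x)\in\mathbb C_\phi((x))$ $(1\le i\le r)$ be such that for some $k\in\mathbb N$ $$(x_1-x_2)^kY(u,x_1)Y(v,x_2)=(x_1-x_2)^k\sum_{i=1}^rf_i(-x_2+x_1)Y(v^{(i)},x_2)Y(u^{(i)},x_1),$$ where $f_i(-x_2+x_1)$ is expanded in nonnegative powers of $x_1$. Then $Y_W((R(g)u)_jv,x)\neq0$ for only finitely many pairs $(g,j)\in G^0\times\mathbb N$, and on $W$ $$Y_W(u,x_1)Y_W(v,x_2)-\sum_{i=1}^r\iota_{x_2,x_1}\big(\widehat{f_i}(x_1,x_2)\big)Y_W(v^{(i)},x_2)Y_W(u^{(i)},x_1)$$ $$=\sum_{g\in G^0}\sum_{j\ge0}\chi(g)^{-1}\,Y_W\big((R(g)u)_jv,x_2\big)\frac1{j!}\big(p(x_2)\partial_{x_2}\big)^jp(x_1)x_1^{-1}\delta\Big(\chi_\phi(g)^{-1}\frac{x_2}{x_1}\Big),$$ where $\delta(x)=\sum_{n\in\mathbb Z}x^n$. -/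

import Mathlib

/-! Formal calculus, nonlocal vertex algebras and `φ`-coordinated quasi modules over `ℂ`. -/

noncomputable section

namespace PhiCoord

/-! ### Formal distributions in two variables -/

/-- `U[[y₁^{±1}, y₂^{±1}]]`: the value `A m n` is the coefficient of `y₁ ^ m * y₂ ^ n`. -/
abbrev FDist (U : Type*) := ℤ → ℤ → U

theorem exists_term_ne_zero {ι M : Type*} [AddCommMonoid M] {f : ι → M} (h : ∑ᶠ i, f i ≠ 0) :
    ∃ i, f i ≠ 0 := by
  by_contra! h0
  exact h (by simp [h0])

section Distributions

variable {U : Type*} [AddCommGroup U] [Module ℂ U]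

/-- The Cauchy product of a scalar distribution with a vector valued one. It is only used where each
coefficient of the product is a sum with finitely many nonzero terms. -/
def distMul (c : FDist ℂ) (A : FDist U) : FDist U := fun m n =>
  ∑ᶠ ab : ℤ × ℤ, c ab.1 ab.2 • A (m - ab.1) (n - ab.2)

/-- A one-variable series, in the first variable. -/
def inFst {S : Type*} [Zero S] (f : ℤ → S) : FDist S := fun m n => if n = 0 then f m else 0

/-- A one-variable series, in the second variable. -/
def inSnd {S : Type*} [Zero S] (f : ℤ → S) : FDist S := fun m n => if m = 0 then f n else 0

/-- `∂/∂y₁`. -/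
def distD₁ (A : FDist U) : FDist U := fun m n => ((m + 1 : ℤ) : ℂ) • A (m + 1) n

/-- `∂/∂y₂`. -/
def distD₂ (A : FDist U) : FDist U := fun m n => ((n + 1 : ℤ) : ℂ) • A m (n + 1)

/-- `p(y₁) ∂/∂y₁`. -/
def distPD₁ (p : LaurentSeries ℂ) (A : FDist U) : FDist U := distMul (inFst p.coeff) (distD₁ A)

/-- `p(y₂) ∂/∂y₂`. -/
def distPD₂ (p : LaurentSeries ℂ) (A : FDist U) : FDist U := distMul (inSnd p.coeff) (distD₂ A)

/-- `A(x, x)`, the restriction to the diagonal `y₁ = y₂ = x`. -/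
def distDiag (A : FDist U) : ℤ → U := fun l => ∑ᶠ m : ℤ, A m (l - m)

/-- The substitution `A(φ(x, z), x)` for `A ∈ U((x₁, x₂))` and `φ(x, z) = exp(z p(x) d/dx) x`, that is
`(exp(z p(x₁) ∂/∂x₁) A(x₁, x₂))` restricted to `x₁ = x₂ = x`. The result is a distribution in `(z, x)`
(in this order). -/
def substPhi (p : LaurentSeries ℂ) (A : FDist U) : FDist U := fun k l =>
  if 0 ≤ k then ((k.toNat.factorial : ℂ))⁻¹ • distDiag ((distPD₁ p)^[k.toNat] A) l else 0

/-- Membership in `U((x₁, x₂)) = U[[x₁, x₂]][x₁⁻¹, x₂⁻¹]`. -/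
def IsLaurent₂ (A : FDist U) : Prop := ∃ N : ℤ, ∀ m n, A m n ≠ 0 → N ≤ m ∧ N ≤ n

theorem IsLaurent₂.distD₁ {A : FDist U} (h : IsLaurent₂ A) : IsLaurent₂ (distD₁ A) := by
  obtain ⟨N, hN⟩ := h
  refine ⟨N - 1, fun m n hmn => ?_⟩
  have := hN (m + 1) n (fun h0 => hmn (by simp [PhiCoord.distD₁, h0]))
  omega

theorem IsLaurent₂.distD₂ {A : FDist U} (h : IsLaurent₂ A) : IsLaurent₂ (distD₂ A) := by
  obtain ⟨N, hN⟩ := h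
  refine ⟨N - 1, fun m n hmn => ?_⟩
  have := hN m (n + 1) (fun h0 => hmn (by simp [PhiCoord.distD₂, h0]))
  omega

theorem IsLaurent₂.distMul {c : FDist ℂ} {A : FDist U} (hc : IsLaurent₂ c) (hA : IsLaurent₂ A) :
    IsLaurent₂ (distMul c A) := by
  obtain ⟨N, hN⟩ := hc
  obtain ⟨M, hM⟩ := hA
  refine ⟨N + M, fun m n hmn => ?_⟩
  obtain ⟨ab, hab⟩ := exists_term_ne_zero hmn
  have h1 := hN ab.1 ab.2 (left_ne_zero_of_smul hab)
  have h2 := hM _ _ (right_ne_zero_of_smul hab)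
  omega

theorem exists_lower_bound {S : Type*} [Zero S] (f : HahnSeries ℤ S) :
    ∃ N : ℤ, ∀ m, f.coeff m ≠ 0 → N ≤ m := by
  refine ⟨f.order, fun m hm => ?_⟩
  exact HahnSeries.order_le_of_coeff_ne_zero hm

theorem isLaurent₂_inFst (f : LaurentSeries ℂ) : IsLaurent₂ (inFst f.coeff) := by
  obtain ⟨N, hN⟩ := exists_lower_bound f
  refine ⟨min N 0, fun m n hmn => ?_⟩
  by_cases hn : n = 0
  · have := hN m (by simpa [inFst, hn] using hmn)
    omega
  · simp [inFst, hn] at hmn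

theorem isLaurent₂_inSnd (f : LaurentSeries ℂ) : IsLaurent₂ (inSnd f.coeff) := by
  obtain ⟨N, hN⟩ := exists_lower_bound f
  refine ⟨min N 0, fun m n hmn => ?_⟩
  by_cases hm : m = 0
  · have := hN n (by simpa [inSnd, hm] using hmn)
    omega
  · simp [inSnd, hm] at hmn

theorem IsLaurent₂.iterate_distPD₁ (p : LaurentSeries ℂ) {A : FDist U} (h : IsLaurent₂ A) (k : ℕ) :
    IsLaurent₂ ((distPD₁ p)^[k] A) := by
  induction k with
  | zero => exact h
  | succ k ih =>
    rw [Function.iterate_succ_apply']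
    exact (isLaurent₂_inFst p).distMul ih.distD₁

theorem bddBelow_distDiag {A : FDist U} (h : IsLaurent₂ A) :
    BddBelow (Function.support (distDiag A)) := by
  obtain ⟨N, hN⟩ := h
  refine ⟨N + N, fun l hl => ?_⟩
  obtain ⟨m, hm⟩ := exists_term_ne_zero hl
  have := hN _ _ hm
  omega

theorem bddBelow_substPhi (p : LaurentSeries ℂ) {A : FDist U} (h : IsLaurent₂ A) (k : ℤ) :
    BddBelow (Function.support (substPhi p A k)) := by
  refine (bddBelow_distDiag (h.iterate_distPD₁ p k.toNat)).mono fun l hl => ?_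
  simp only [Function.mem_support, substPhi] at hl ⊢
  intro h0
  exact hl (by simp [h0])

end Distributions

/-! ### The ring `ℂ((x₁, x₂))`, its fraction field and `ℂ_φ((x₁, x₂))` -/

/-- The ring `ℂ((x₁, x₂))`. For the product order on `ℤ × ℤ` a set of exponents is partially
well-ordered exactly when both of its coordinates are bounded below. -/
abbrev Laurent₂ := HahnSeries (ℤ × ℤ) ℂ

/-- The coefficients of an element of `ℂ((x₁, x₂))`. -/
def toDist (a : Laurent₂) : FDist ℂ := fun m n => a.coeff (m, n)

theorem isLaurent₂_toDist (a : Laurent₂) : IsLaurent₂ (toDist a) := by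
  have h1 : (Prod.fst '' a.support).IsWF :=
    (a.isPWO_support.image_of_monotone monotone_fst).isWF
  have h2 : (Prod.snd '' a.support).IsWF :=
    (a.isPWO_support.image_of_monotone monotone_snd).isWF
  by_cases hne : a.support.Nonempty
  · refine ⟨min (h1.min (hne.image _)) (h2.min (hne.image _)), fun m n hmn => ?_⟩
    have hm : m ∈ Prod.fst '' a.support := ⟨(m, n), hmn, rfl⟩
    have hn : n ∈ Prod.snd '' a.support := ⟨(m, n), hmn, rfl⟩
    exact ⟨(min_le_left _ _).trans (h1.min_le _ hm), (min_le_right _ _).trans (h2.min_le _ hn)⟩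
  · exact ⟨0, fun m n hmn => absurd ⟨(m, n), hmn⟩ hne⟩

/-- The element of `ℂ((x₁, x₂))` with given coefficients. -/
def ofDist (A : FDist ℂ) (h : IsLaurent₂ A) : Laurent₂ where
  coeff mn := A mn.1 mn.2
  isPWO_support' := by
    obtain ⟨N, hN⟩ := h
    have hI : (Set.Ici N).IsPWO := (BddBelow.isWF bddBelow_Ici).isPWO
    exact (hI.prod hI).mono fun mn hmn => hN _ _ hmn

/-- `∂/∂x₁` on `ℂ((x₁, x₂))`. -/
def pd₁ (a : Laurent₂) : Laurent₂ := ofDist (distD₁ (toDist a)) (isLaurent₂_toDist a).distD₁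

/-- `∂/∂x₂` on `ℂ((x₁, x₂))`. -/
def pd₂ (a : Laurent₂) : Laurent₂ := ofDist (distD₂ (toDist a)) (isLaurent₂_toDist a).distD₂

/-- `f(x₁)` as an element of `ℂ((x₁, x₂))`. -/
def embFst (f : LaurentSeries ℂ) : Laurent₂ := ofDist (inFst f.coeff) (isLaurent₂_inFst f)

/-- `f(x₂)` as an element of `ℂ((x₁, x₂))`. -/
def embSnd (f : LaurentSeries ℂ) : Laurent₂ := ofDist (inSnd f.coeff) (isLaurent₂_inSnd f)

/-- `(x₁ - x₂) ^ k`. -/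
def subPow (k : ℕ) : Laurent₂ :=
  (HahnSeries.single ((1, 0) : ℤ × ℤ) (1 : ℂ) - HahnSeries.single ((0, 1) : ℤ × ℤ) (1 : ℂ)) ^ k

/-- `ℂ_*((x₁, x₂))`, the fraction field of `ℂ((x₁, x₂))`. -/
abbrev Frac₂ := FractionRing Laurent₂

/-- A numerator of `F`. -/
def fnum (F : Frac₂) : Laurent₂ := (IsLocalization.sec (nonZeroDivisors Laurent₂) F).1

/-- The denominator of `F` belonging to `fnum F`, so that `F = fnum F / fden F`. -/
def fden (F : Frac₂) : nonZeroDivisors Laurent₂ :=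
  (IsLocalization.sec (nonZeroDivisors Laurent₂) F).2

/-- The extension of a derivation `δ` of `ℂ((x₁, x₂))` to the fraction field by the quotient rule. -/
def fracDeriv (δ : Laurent₂ → Laurent₂) (F : Frac₂) : Frac₂ :=
  IsLocalization.mk' Frac₂ (δ (fnum F) * (fden F : Laurent₂) - fnum F * δ (fden F : Laurent₂))
    (fden F * fden F)

/-- `ℂ_φ((x₁, x₂))`: the `F ∈ ℂ_*((x₁, x₂))` with `p(x₁) ∂F/∂x₁ = - p(x₂) ∂F/∂x₂`. -/
def CPhi₂ (p : LaurentSeries ℂ) : Set Frac₂ :=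
  {F | algebraMap Laurent₂ Frac₂ (embFst p) * fracDeriv pd₁ F =
    -(algebraMap Laurent₂ Frac₂ (embSnd p) * fracDeriv pd₂ F)}

/-- The coefficients of an element of `ℂ((y₂))((y₁))` (outer variable `y₁`). -/
def iterDist (E : LaurentSeries (LaurentSeries ℂ)) : FDist ℂ := fun m n => (E.coeff m).coeff n

/-- The element of `ℂ((y₂))((y₁))` with given coefficients. -/
def ofIter (A : FDist ℂ) (h1 : ∃ N : ℤ, ∀ m n, A m n ≠ 0 → N ≤ m)
    (h2 : ∀ m, BddBelow (Function.support (A m))) : LaurentSeries (LaurentSeries ℂ) :=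
  HahnSeries.ofSuppBddBelow (fun m => HahnSeries.ofSuppBddBelow (A m) (h2 m)) <| by
    obtain ⟨N, hN⟩ := h1
    refine ⟨N, fun m hm => ?_⟩
    by_contra hlt
    refine hm (HahnSeries.ext (funext fun n => ?_))
    by_contra hne
    exact hlt (hN m n (by simpa using hne))

/-- For `a ∈ ℂ((x₁, x₂))`, the series `a(φ(x, z), x) ∈ ℂ((x))[[z]]`, as an element of the field
`ℂ((x))((z))`. -/
def phiSubst (p : LaurentSeries ℂ) (a : Laurent₂) : LaurentSeries (LaurentSeries ℂ) :=
  ofIter (substPhi p (toDist a))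
    ⟨0, fun m n h => by
      by_contra hlt
      exact h (by simp [substPhi, hlt])⟩
    (bddBelow_substPhi p (isLaurent₂_toDist a))

/-- For `F ∈ ℂ_*((x₁, x₂))`, the series `F(φ(x, z), x) ∈ ℂ((x))((z))`, by extension of the ring
embedding `a ↦ a(φ(x, z), x)` to the fraction field. -/
def phiEval (p : LaurentSeries ℂ) (F : Frac₂) : LaurentSeries (LaurentSeries ℂ) :=
  phiSubst p (fnum F) / phiSubst p (fden F : Laurent₂)

/-- `f(z) ∈ ℂ((z))` as an element of `ℂ((x))((z))`. -/
def constInX (f : LaurentSeries ℂ) : LaurentSeries (LaurentSeries ℂ) :=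
  f.map (HahnSeries.C : ℂ →+* LaurentSeries ℂ)

/-- `ℂ_φ((z))`: the `f ∈ ℂ((z))` of the form `f(z) = F(φ(x, z), x)` with `F ∈ ℂ_φ((x₁, x₂))`. -/
def CPhi (p : LaurentSeries ℂ) : Set (LaurentSeries ℂ) :=
  {f | ∃ F ∈ CPhi₂ p, phiEval p F = constInX f}

/-- For `f ∈ ℂ_φ((z))`, the (unique) `f̂ ∈ ℂ_φ((x₁, x₂))` with `f̂(φ(x, z), x) = f(z)`. -/
def hat (p : LaurentSeries ℂ) (f : LaurentSeries ℂ) : Frac₂ :=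
  Function.invFunOn (phiEval p) (CPhi₂ p) (constInX f)

/-- The embedding of `ℂ((x₁, x₂))` into the field `ℂ((x₂))((x₁))`. -/
def iota₂₁ (a : Laurent₂) : LaurentSeries (LaurentSeries ℂ) :=
  ofIter (toDist a)
    (by
      obtain ⟨N, hN⟩ := isLaurent₂_toDist a
      exact ⟨N, fun m n h => (hN m n h).1⟩)
    (fun m => by
      obtain ⟨N, hN⟩ := isLaurent₂_toDist a
      exact ⟨N, fun n h => (hN m n h).2⟩)

/-- `ι_{x₂,x₁} : ℂ_*((x₁, x₂)) → ℂ((x₂))((x₁))`, the extension of `iota₂₁` to the fraction field. -/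
def fracIota₂₁ (F : Frac₂) : LaurentSeries (LaurentSeries ℂ) :=
  iota₂₁ (fnum F) / iota₂₁ (fden F : Laurent₂)

/-- `f(-x₂ + x₁)`, expanded in nonnegative powers of `x₁`:
`(-x₂ + x₁) ^ n = ∑_{a ≥ 0} (n choose a) (-x₂) ^ (n - a) x₁ ^ a`. -/
def expandNeg (f : LaurentSeries ℂ) : FDist ℂ := fun a b =>
  if 0 ≤ a then f.coeff (a + b) * ((Ring.choose (a + b) a.toNat : ℤ) : ℂ) * (-1 : ℂ) ^ b else 0

/-- `q(x₁ / x₂)` for a polynomial `q`. -/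
def polyRatio (q : Polynomial ℂ) : FDist ℂ := fun a b =>
  if 0 ≤ a ∧ a + b = 0 then q.coeff a.toNat else 0

/-- `x₁⁻¹ δ(c x₂ / x₁) = ∑_n c ^ n x₂ ^ n x₁ ^ (- n - 1)`. -/
def deltaDist (c : ℂ) : FDist ℂ := fun m n => if m + n + 1 = 0 then c ^ n else 0

/-! ### Products of vertex operators -/

section Products

variable {V W : Type*} [AddCommGroup V] [Module ℂ V] [AddCommGroup W] [Module ℂ W]

/-- `a(x₁) b(x₂) w`. -/
def prod₁₂ (a b : VertexOperator ℂ W) (w : W) : FDist W := fun m n =>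
  HVertexOperator.coeff a m (HVertexOperator.coeff b n w)

/-- `b(x₂) a(x₁) w`. -/
def prod₂₁ (b a : VertexOperator ℂ W) (w : W) : FDist W := fun m n =>
  HVertexOperator.coeff b n (HVertexOperator.coeff a m w)

/-- `Y_W(Y(u, z)v, x) w` in the variables `(z, x)`, where `a = Y(u, z)`. -/
def iterate (Y_W : V →ₗ[ℂ] VertexOperator ℂ W) (a : VertexOperator ℂ V) (v : V) (w : W) :
    FDist W := fun k l => HVertexOperator.coeff (Y_W (HVertexOperator.coeff a k v)) l w

end Products

/-! ### Nonlocal vertex algebras and their `φ`-coordinated quasi modules -/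

/-- A nonlocal vertex algebra structure on `V`. That `Y(u, x)v ∈ V((x))` is part of the type
`VertexOperator`; `u_n` is `VertexOperator.ncoeff (Y u) n`. -/
structure NonlocalVertexAlgebra (V : Type*) [AddCommGroup V] [Module ℂ V] where
  /-- the vertex operator map -/
  Y : V →ₗ[ℂ] VertexOperator ℂ V
  /-- the vacuum vector -/
  one : V
  /-- `Y(1, x)v = v` -/
  one_left : ∀ (v : V) (n : ℤ), HVertexOperator.coeff (Y one) n v = if n = 0 then v else 0
  /-- `Y(v, x)1 ∈ V[[x]]` -/
  creation : ∀ (v : V) (n : ℤ), n < 0 → HVertexOperator.coeff (Y v) n one = 0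
  /-- the value of `Y(v, x)1` at `x = 0` is `v` -/
  creation_zero : ∀ v : V, HVertexOperator.coeff (Y v) 0 one = v
  /-- compatibility and associativity: `(x₁ - x₂)^k Y(u, x₁)Y(v, x₂) ∈ Hom(V, V((x₁, x₂)))`, and the
  substitution `x₁ = x₂ + x₀` turns it into `x₀^k Y(Y(u, x₀)v, x₂)` -/
  assoc : ∀ u v : V, ∃ k : ℕ, ∀ w : V,
    IsLaurent₂ (distMul (toDist (subPow k)) (prod₁₂ (Y u) (Y v) w)) ∧
    substPhi 1 (distMul (toDist (subPow k)) (prod₁₂ (Y u) (Y v) w)) =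
      fun n l => iterate Y (Y u) v w (n - k) l

/-- `(V, R)` is a `(G, χ)`-module nonlocal vertex algebra. -/
structure IsGModule {G V : Type*} [Group G] [AddCommGroup V] [Module ℂ V]
    (𝒱 : NonlocalVertexAlgebra V) (χ : G →* ℂˣ) (R : Representation ℂ G V) : Prop where
  map_one : ∀ g : G, R g 𝒱.one = 𝒱.one
  /-- `R(g) Y(v, x) R(g)⁻¹ = Y(R(g)v, χ(g)x)` -/
  conj : ∀ (g : G) (v w : V) (n : ℤ),
    R g (HVertexOperator.coeff (𝒱.Y v) n (R g⁻¹ w)) =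
      ((χ g : ℂ) ^ n) • HVertexOperator.coeff (𝒱.Y (R g v)) n w

/-- The coefficient of `z ^ n` in `φ(x, z) = exp(z p(x) d/dx) x`, which is
`(p(x) d/dx) ^ n x / n!`. -/
def phiCoeff (p : LaurentSeries ℂ) (n : ℕ) : LaurentSeries ℂ :=
  ((n.factorial : ℂ))⁻¹ •
    (fun h : LaurentSeries ℂ => p * LaurentSeries.derivative ℂ h)^[n] (HahnSeries.single 1 1)

/-- `φ(x, χ(g)z) = χ_φ(g) φ(χ_φ(g)⁻¹ x, z)` for all `g`. -/
def PhiCompatible {G : Type*} [Group G] (p : LaurentSeries ℂ) (χ χφ : G →* ℂˣ) : Prop :=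
  ∀ (g : G) (n : ℕ) (k : ℤ), (χ g : ℂ) ^ n * (phiCoeff p n).coeff k =
    (χφ g : ℂ) * (((χφ g : ℂ)⁻¹) ^ k * (phiCoeff p n).coeff k)

/-- A `φ`-coordinated quasi module structure on `W` for the nonlocal vertex algebra `𝒱`, where
`φ(x, z) = exp(z p(x) d/dx) x`. That `Y_W(u, x)w ∈ W((x))` is part of the type `VertexOperator`. -/
structure PhiQuasiModule {V : Type*} [AddCommGroup V] [Module ℂ V] (p : LaurentSeries ℂ)
    (𝒱 : NonlocalVertexAlgebra V) (W : Type*) [AddCommGroup W] [Module ℂ W] where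
  /-- the vertex operator map -/
  Y : V →ₗ[ℂ] VertexOperator ℂ W
  /-- `Y_W(1, x) = 1` -/
  one_left : ∀ (w : W) (n : ℤ), HVertexOperator.coeff (Y 𝒱.one) n w = if n = 0 then w else 0
  /-- `f(x₁, x₂)Y_W(u, x₁)Y_W(v, x₂) ∈ Hom(W, W((x₁, x₂)))`, and the substitution `x₁ = φ(x₂, z)`
  turns it into `f(φ(x₂, z), x₂)Y_W(Y(u, z)v, x₂)` -/
  assoc : ∀ u v : V, ∃ f : Laurent₂, f ≠ 0 ∧ ∀ w : W,
    IsLaurent₂ (distMul (toDist f) (prod₁₂ (Y u) (Y v) w)) ∧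
    substPhi p (distMul (toDist f) (prod₁₂ (Y u) (Y v) w)) =
      distMul (substPhi p (toDist f)) (iterate Y (𝒱.Y u) v w)

/-- The `φ`-coordinated quasi module `𝒲` is `(G, χ_φ)`-equivariant. -/
structure IsEquivariant {G V W : Type*} [Group G] [AddCommGroup V] [Module ℂ V] [AddCommGroup W]
    [Module ℂ W] {p : LaurentSeries ℂ} {𝒱 : NonlocalVertexAlgebra V}
    (𝒲 : PhiQuasiModule p 𝒱 W) (χφ : G →* ℂˣ) (R : Representation ℂ G V) : Prop where
  /-- `Y_W(R(g)v, x) = Y_W(v, χ_φ(g)⁻¹ x)` -/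
  equivariant : ∀ (g : G) (v : V) (w : W) (n : ℤ),
    HVertexOperator.coeff (𝒲.Y (R g v)) n w =
      (((χφ g : ℂ)⁻¹) ^ n) • HVertexOperator.coeff (𝒲.Y v) n w
  /-- `q(x₁ / x₂)Y_W(u, x₁)Y_W(v, x₂) ∈ Hom(W, W((x₁, x₂)))` for a product `q(x)` of polynomials
  `x - χ_φ(g)` -/
  quasi_local : ∀ u v : V, ∃ q ∈ Submonoid.closure
      (Set.range fun g : G => (Polynomial.X - Polynomial.C (χφ g : ℂ) : Polynomial ℂ)),
    ∀ w : W, IsLaurent₂ (distMul (polyRatio q) (prod₁₂ (𝒲.Y u) (𝒲.Y v) w))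

end PhiCoord

end

noncomputable section

namespace PhiCoord

open Function

local notation "𝕂" => LaurentSeries (LaurentSeries ℂ)

/-! Fix a linear functional `ℓ` on `W` and a vector `w`. Associativity lets a nonzero element of
`ℂ((x₁, x₂))` clear denominators in `ℓ(Y_W(u, x₁)Y_W(v, x₂)w)`. This matrix coefficient is therefore
the expansion in `ℂ((x₁))((x₂))` of a fraction `F`, and the substitution `x₁ = φ(x₂, z)` turns the
same `F` into `ℓ(Y_W(Y(u, z)v, x₂)w)` (`exists_frac`). Since `p ≠ 0`, the substitution is injective
(`phiHom_injective`), so `F` is determined by either of its two images.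

The other product in the commutator is the opposite expansion of `F`. Locality on `V`, applied to
the vacuum, yields the skew symmetry `Y(u, z)v = ∑ f_i(z) e^{zD} Y(v_i, -z)u_i`, where `e^{zD}a`
stands for `Y(a, z)1` (`coeff_eq_sum_skewCoeff`). This step treats `V` as a module over itself for
`φ = x + z`. On `W`, the passage from `z` to `-z` combined with `e^{zD}` is the exchange of `x₁` and
`x₂` (`tauHom_phiHom_swapHom`). Skew symmetry and the definition of `f̂_i` thus give `∑ ι(f̂_i)
Y_W(v_i, x₂)Y_W(u_i, x₁)` as the expansion of `F` in `ℂ((x₂))((x₁))` (`fracLift_iotaHom_eq`).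

The left side is now the difference of two expansions of one fraction. By quasi-locality its
denominator is a product of factors `x₁/x₂ - c` with `c` a value of `χ_φ`. A residue theorem in
`x₁`, proved by partial fractions, writes each coefficient of the difference as a sum of residues at
`x₁ = c x₂` (`coeff_sub_coeff_eq_sum_residue`). Near such a pole use the coordinate `z` with `x₁ = c
φ(x₂, z)`, so that `dx₁ = c p(φ) dz`. Equivariance identifies `F(c φ(x, z), x)`, for `c = χ_φ(g)⁻¹`,
with `ℓ(Y_W(Y(R(g)u, z)v, x)w)` (`fracLift_sigma_eq`). Its polar coefficients are the modes
`(R(g)u)_j v`, and the Taylor expansion of `p(φ) φ^M` supplies the derivatives of the delta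
function. Finiteness holds because the pole order at `c` is at most the multiplicity of `c` in the
denominator. -/

instance : Field (LaurentSeries (LaurentSeries ℂ)) := HahnSeries.instField

/-! ### Convolution, rescaling and Euler operators on Hahn series -/

section HahnSeriesConvolution

variable {Γ R : Type*} [AddCommGroup Γ] [PartialOrder Γ] [IsOrderedCancelAddMonoid Γ]

theorem finite_setOf_coeff_ne_zero [Zero R] {S : Type*} [Zero S] (x : HahnSeries Γ R)
    (y : HahnSeries Γ S) (g : Γ) : {a | x.coeff a ≠ 0 ∧ y.coeff (g - a) ≠ 0}.Finite := by
  refine ((Finset.antidiagonal x.isPWO_support y.isPWO_support g).finite_toSet.image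
    Prod.fst).subset fun a ha => ⟨(a, g - a), ?_, rfl⟩
  simpa using ha

theorem hasFiniteSupport_coeff_mul [NonUnitalNonAssocSemiring R] (x y : HahnSeries Γ R) (g : Γ) :
    HasFiniteSupport fun a => x.coeff a * y.coeff (g - a) :=
  (finite_setOf_coeff_ne_zero x y g).subset fun _ ha =>
    ⟨left_ne_zero_of_mul ha, right_ne_zero_of_mul ha⟩

theorem coeff_mul_eq_finsum [NonUnitalNonAssocSemiring R] (x y : HahnSeries Γ R) (g : Γ) :
    (x * y).coeff g = ∑ᶠ a, x.coeff a * y.coeff (g - a) := by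
  classical
  rw [HahnSeries.coeff_mul, finsum_eq_sum_of_support_subset _
    (s := (Finset.antidiagonal x.isPWO_support y.isPWO_support g).image Prod.fst), Finset.sum_image]
  · refine Finset.sum_congr rfl fun ij hij => ?_
    simp only [Finset.mem_antidiagonal] at hij
    rw [← hij.2.2, add_sub_cancel_left]
  · intro a ha b hb hab
    simp only [Finset.mem_coe, Finset.mem_antidiagonal] at ha hb
    have h := ha.2.2.trans hb.2.2.symm
    rw [hab, add_right_inj] at h
    exact Prod.ext hab h
  · intro a ha
    simp only [Finset.coe_image, Set.mem_image]
    refine ⟨(a, g - a), ?_, rfl⟩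
    simp only [Finset.mem_coe, Finset.mem_antidiagonal, HahnSeries.mem_support]
    exact ⟨left_ne_zero_of_mul ha, right_ne_zero_of_mul ha, by simp⟩

/-- Rescaling of the coefficients by a character of the exponents. -/
def twist [CommRing R] (κ : Γ → R) (h0 : κ 0 = 1) (hadd : ∀ a b, κ (a + b) = κ a * κ b) :
    HahnSeries Γ R →+* HahnSeries Γ R where
  toFun x := ⟨fun g => κ g * x.coeff g, x.isPWO_support.mono fun _ h => right_ne_zero_of_mul h⟩
  map_one' := by
    ext g
    simp only [HahnSeries.coeff_one]
    split_ifs with h <;> simp [h, h0]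
  map_zero' := by ext; simp
  map_add' x y := by ext; simp [mul_add]
  map_mul' x y := by
    ext g
    simp only [coeff_mul_eq_finsum]
    rw [mul_finsum' _ _ (hasFiniteSupport_coeff_mul x y g)]
    refine finsum_congr fun a => ?_
    have : κ g = κ a * κ (g - a) := by rw [← hadd, add_sub_cancel]
    rw [this]; ring

/-- Multiplication of the coefficients by an additive weight of the exponents. -/
def weightDeriv [CommRing R] (ω : Γ →+ R) : HahnSeries Γ R →ₗ[R] HahnSeries Γ R where
  toFun x := ⟨fun g => ω g * x.coeff g, x.isPWO_support.mono fun _ h => right_ne_zero_of_mul h⟩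
  map_add' x y := by ext; simp [mul_add]
  map_smul' c x := by ext; simp [mul_left_comm]

omit [IsOrderedCancelAddMonoid Γ] in
@[simp]
theorem coeff_weightDeriv [CommRing R] (ω : Γ →+ R) (x : HahnSeries Γ R) (g : Γ) :
    (weightDeriv ω x).coeff g = ω g * x.coeff g := rfl

/-- An operator that is diagonal on monomials satisfies the Leibniz rule as soon as its weight is
additive in the exponent. Every derivation used below is a multiple of such an Euler operator. -/
theorem weightDeriv_mul [CommRing R] (ω : Γ →+ R) (x y : HahnSeries Γ R) :
    weightDeriv ω (x * y) = weightDeriv ω x * y + x * weightDeriv ω y := by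
  ext g
  rw [coeff_weightDeriv, HahnSeries.coeff_add]
  simp only [coeff_mul_eq_finsum, coeff_weightDeriv]
  have h := finite_setOf_coeff_ne_zero x y g
  rw [mul_finsum' _ _ (hasFiniteSupport_coeff_mul x y g), ← finsum_add_distrib]
  · refine finsum_congr fun a => ?_
    have : ω g = ω a + ω (g - a) := by rw [← map_add, add_sub_cancel]
    rw [this]; ring
  · refine h.subset fun a ha => ⟨?_, right_ne_zero_of_mul ha⟩
    exact right_ne_zero_of_mul (left_ne_zero_of_mul ha)
  · refine h.subset fun a ha => ⟨left_ne_zero_of_mul ha, ?_⟩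
    exact right_ne_zero_of_mul (right_ne_zero_of_mul ha)

end HahnSeriesConvolution

/-! ### Distributions as elements of `ℂ((x₁, x₂))` and of `ℂ((y₂))((y₁))` -/

section Classes

variable {U : Type*} [AddCommGroup U] [Module ℂ U]

/-- Membership in `U((y₂))((y₁))`. -/
def IsIter (A : FDist U) : Prop :=
  (∃ N : ℤ, ∀ m n, A m n ≠ 0 → N ≤ m) ∧ ∀ m, BddBelow (support (A m))

/-- Exchange of the two variables. -/
def dswap (A : FDist U) : FDist U := fun m n => A n m

omit [Module ℂ U] in
theorem IsLaurent₂.isIter {A : FDist U} (h : IsLaurent₂ A) : IsIter A := by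
  obtain ⟨N, hN⟩ := h
  exact ⟨⟨N, fun m n h => (hN m n h).1⟩, fun m => ⟨N, fun n h => (hN m n h).2⟩⟩

omit [Module ℂ U] in
theorem IsLaurent₂.dswap {A : FDist U} (h : IsLaurent₂ A) : IsLaurent₂ (dswap A) := by
  obtain ⟨N, hN⟩ := h
  exact ⟨N, fun m n h => (hN n m h).symm⟩

theorem dswap_distMul (c : FDist ℂ) (A : FDist U) :
    dswap (distMul c A) = distMul (dswap c) (dswap A) := by
  funext m n
  exact (finsum_comp_equiv (Equiv.prodComm ℤ ℤ)
    (f := fun ab : ℤ × ℤ => c ab.1 ab.2 • A (n - ab.1) (m - ab.2))).symm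

-- The outer exponents are confined to a finite interval, and for each of them so are the inner
-- ones. This is what makes the `finsum` in `distMul` a genuine Cauchy product.
omit [Module ℂ U] in
theorem IsIter.finite {c : FDist ℂ} {A : FDist U} (hc : IsIter c) (hA : IsIter A) (m n : ℤ) :
    {ab : ℤ × ℤ | c ab.1 ab.2 ≠ 0 ∧ A (m - ab.1) (n - ab.2) ≠ 0}.Finite := by
  obtain ⟨⟨N, hN⟩, hc⟩ := hc
  obtain ⟨⟨M, hM⟩, hA⟩ := hA
  choose lc hlc using hc
  choose lA hlA using hA
  refine Set.Finite.subset (s := ⋃ a ∈ Set.Icc N (m - M),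
    (fun b => (a, b)) '' Set.Icc (lc a) (n - lA (m - a))) ?_ ?_
  · exact (Set.finite_Icc _ _).biUnion fun a _ => (Set.finite_Icc _ _).image _
  · rintro ⟨a, b⟩ ⟨h1, h2⟩
    simp only [Set.mem_iUnion, Set.mem_image, Prod.mk.injEq]
    have h3 := hN _ _ h1
    have h4 := hM _ _ h2
    have h5 := hlc a h1
    have h6 := hlA (m - a) h2
    exact ⟨a, ⟨h3, by dsimp only at h4; lia⟩, b, ⟨h5, by dsimp only at h6; lia⟩, rfl, rfl⟩

theorem IsIter.hasFiniteSupport {c : FDist ℂ} {A : FDist U} (hc : IsIter c) (hA : IsIter A)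
    (m n : ℤ) :
    HasFiniteSupport fun ab : ℤ × ℤ => c ab.1 ab.2 • A (m - ab.1) (n - ab.2) :=
  (hc.finite hA m n).subset fun _ h => ⟨left_ne_zero_of_smul h, right_ne_zero_of_smul h⟩

theorem isIter_iterDist (E : LaurentSeries (LaurentSeries ℂ)) : IsIter (iterDist E) := by
  constructor
  · obtain ⟨N, hN⟩ := exists_lower_bound E
    refine ⟨N, fun m n h => hN m fun h0 => h ?_⟩
    simp [iterDist, h0]
  · intro m
    obtain ⟨N, hN⟩ := exists_lower_bound (E.coeff m)
    exact ⟨N, fun n h => hN n h⟩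

theorem iterDist_injective : Injective iterDist := fun E F h => by
  ext m n
  exact congrFun (congrFun h m) n

@[simp]
theorem iterDist_ofIter (A : FDist ℂ) (h1) (h2) : iterDist (ofIter A h1 h2) = A := by
  funext m n
  simp [iterDist, ofIter]

theorem distMul_apply_mul (c A : FDist ℂ) (m n : ℤ) :
    distMul c A m n = ∑ᶠ ab : ℤ × ℤ, c ab.1 ab.2 * A (m - ab.1) (n - ab.2) := rfl

theorem iterDist_mul (E F : LaurentSeries (LaurentSeries ℂ)) :
    iterDist (E * F) = distMul (iterDist E) (iterDist F) := by
  funext m n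
  have hE := isIter_iterDist E
  have hF := isIter_iterDist F
  rw [distMul, finsum_curry _ (hE.hasFiniteSupport hF m n)]
  simp only [iterDist]
  rw [coeff_mul_eq_finsum]
  let φ : LaurentSeries ℂ →+ ℂ :=
    { toFun := fun x => x.coeff n, map_zero' := rfl, map_add' := fun _ _ => rfl }
  change φ _ = _
  rw [φ.map_finsum (hasFiniteSupport_coeff_mul E F m)]
  refine finsum_congr fun a => ?_
  exact coeff_mul_eq_finsum _ _ _

theorem toDist_mul (a b : Laurent₂) : toDist (a * b) = distMul (toDist a) (toDist b) := by
  funext m n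
  exact coeff_mul_eq_finsum a b (m, n)

theorem toDist_injective : Injective toDist := fun a b h => by
  ext ⟨m, n⟩
  exact congrFun (congrFun h m) n

@[simp]
theorem toDist_ofDist (A : FDist ℂ) (h) : toDist (ofDist A h) = A := rfl

theorem toDist_add (a b : Laurent₂) : toDist (a + b) = toDist a + toDist b := rfl

theorem iterDist_add (a b : LaurentSeries (LaurentSeries ℂ)) :
    iterDist (a + b) = iterDist a + iterDist b := rfl

@[simp]
theorem iterDist_iota₂₁ (a : Laurent₂) : iterDist (iota₂₁ a) = toDist a := iterDist_ofIter _ _ _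

/-- `iota₂₁` as a ring homomorphism. -/
def iotaHom : Laurent₂ →+* LaurentSeries (LaurentSeries ℂ) where
  toFun := iota₂₁
  map_one' := iterDist_injective <| by
    rw [iterDist_iota₂₁]
    funext m n
    simp only [toDist, iterDist, HahnSeries.coeff_one, Prod.mk_eq_zero]
    by_cases hm : m = 0 <;> simp [hm, HahnSeries.coeff_one]
  map_zero' := iterDist_injective <| by rw [iterDist_iota₂₁]; rfl
  map_add' a b := iterDist_injective <| by
    rw [iterDist_iota₂₁, toDist_add, iterDist_add, iterDist_iota₂₁, iterDist_iota₂₁]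
  map_mul' a b := iterDist_injective <| by
    rw [iterDist_iota₂₁, toDist_mul, iterDist_mul, iterDist_iota₂₁, iterDist_iota₂₁]

@[simp]
theorem iterDist_iotaHom (a : Laurent₂) : iterDist (iotaHom a) = toDist a := iterDist_iota₂₁ a

theorem iotaHom_injective : Injective iotaHom := fun a b h =>
  toDist_injective <| by rw [← iterDist_iotaHom, h, iterDist_iotaHom]

/-- The order on `ℤ × ℤ` is not linear, so leading terms are not available directly; the domain
property is inherited from the field `ℂ((x₂))((x₁))`. -/
instance : IsDomain Laurent₂ := iotaHom_injective.isDomain iotaHom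

/-- Exchange of the two variables. -/
def swapHom : Laurent₂ →+* Laurent₂ where
  toFun a := ofDist (dswap (toDist a)) (isLaurent₂_toDist a).dswap
  map_one' := toDist_injective <| by
    funext m n
    simp [toDist, ofDist, dswap, HahnSeries.coeff_one, and_comm]
  map_zero' := rfl
  map_add' a b := rfl
  map_mul' a b := toDist_injective <| by
    refine Eq.trans ?_ (toDist_mul _ _).symm
    exact (congrArg dswap (toDist_mul a b)).trans (dswap_distMul _ _)

@[simp]
theorem toDist_swapHom (a : Laurent₂) : toDist (swapHom a) = dswap (toDist a) := rfl

@[simp]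
theorem swapHom_swapHom (a : Laurent₂) : swapHom (swapHom a) = a := rfl

end Classes

/-! ### Restriction to the diagonal as a ring homomorphism -/

section Diagonal

theorem diag_hasFiniteSupport {U : Type*} [AddCommGroup U] {A : FDist U} (h : IsLaurent₂ A)
    (l : ℤ) : HasFiniteSupport fun m => A m (l - m) := by
  obtain ⟨N, hN⟩ := h
  refine (Set.finite_Icc N (l - N)).subset fun m hm => ?_
  have := hN _ _ hm
  exact ⟨by lia, by lia⟩

/-- Restriction to the diagonal. -/
def diagHom : Laurent₂ →+* LaurentSeries ℂ where
  toFun a := HahnSeries.ofSuppBddBelow (distDiag (toDist a))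
    (bddBelow_distDiag (isLaurent₂_toDist a))
  map_one' := by
    ext l
    simp only [HahnSeries.coeff_ofSuppBddBelow, distDiag, toDist, HahnSeries.coeff_one,
      Prod.mk_eq_zero]
    rw [finsum_eq_single _ 0 (fun m hm => by simp [hm])]
    simp
  map_zero' := by
    ext l
    simp [distDiag, toDist]
  map_add' a b := by
    ext l
    simp only [HahnSeries.coeff_ofSuppBddBelow, HahnSeries.coeff_add]
    exact finsum_add_distrib (diag_hasFiniteSupport (isLaurent₂_toDist a) l)
      (diag_hasFiniteSupport (isLaurent₂_toDist b) l)
  map_mul' a b := by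
    ext l
    rw [coeff_mul_eq_finsum]
    simp only [HahnSeries.coeff_ofSuppBddBelow]
    have ha := isLaurent₂_toDist a
    have hb := isLaurent₂_toDist b
    -- The triple lists both exponents of the term of `a` and the `x₁`-exponent of the term of `b`.
    -- Grouping by the total `x₁`-exponent gives the diagonal of the product; grouping by the total
    -- degree of the term of `a` gives the product of the diagonals.
    let T : ℤ × ℤ × ℤ → ℂ := fun x =>
      toDist a x.1 x.2.1 * toDist b x.2.2 (l - x.1 - x.2.1 - x.2.2)
    have hT : HasFiniteSupport T := by
      obtain ⟨N, hN⟩ := ha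
      obtain ⟨M, hM⟩ := hb
      refine ((Set.finite_Icc N (l - N - M - M)).prod ((Set.finite_Icc N (l - N - M - M)).prod
        (Set.finite_Icc M (l - N - N - M)))).subset fun x hx => ?_
      have h1 := hN _ _ (left_ne_zero_of_mul hx)
      have h2 := hM _ _ (right_ne_zero_of_mul hx)
      simp only [Set.mem_prod, Set.mem_Icc]
      lia
    have e1 : ∑ᶠ x, T x = distDiag (toDist (a * b)) l := by
      let e : ℤ × ℤ × ℤ ≃ ℤ × ℤ × ℤ :=
        { toFun := fun x => (x.2.1, x.2.2, x.1 - x.2.1)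
          invFun := fun x => (x.1 + x.2.2, x.1, x.2.1)
          left_inv := fun x => by ext <;> simp
          right_inv := fun x => by ext <;> simp }
      rw [← finsum_comp_equiv e, finsum_curry _ (hT.preimage e.injective.injOn)]
      refine finsum_congr fun m => ?_
      rw [toDist_mul, distMul_apply_mul]
      refine finsum_congr fun x => ?_
      simp only [T, e, Equiv.coe_fn_mk]
      congr 2
      ring
    have e2 : ∑ᶠ x, T x = ∑ᶠ l', distDiag (toDist a) l' * distDiag (toDist b) (l - l') := by
      let e : ℤ × ℤ × ℤ ≃ ℤ × ℤ × ℤ :=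
        { toFun := fun x => (x.2.1, x.1 - x.2.1, x.2.2)
          invFun := fun x => (x.1 + x.2.1, x.1, x.2.2)
          left_inv := fun x => by ext <;> simp
          right_inv := fun x => by ext <;> simp }
      rw [← finsum_comp_equiv e, finsum_curry₃ _ (hT.preimage e.injective.injOn)]
      refine finsum_congr fun l' => ?_
      rw [distDiag, finsum_mul' _ _ (diag_hasFiniteSupport ha l')]
      refine finsum_congr fun m => ?_
      rw [distDiag, mul_finsum' _ _ (diag_hasFiniteSupport hb _)]
      refine finsum_congr fun m' => ?_
      simp only [T, e, Equiv.coe_fn_mk]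
      congr 2
      ring
    rw [← e1, e2]

@[simp]
theorem coeff_diagHom (a : Laurent₂) (l : ℤ) : (diagHom a).coeff l = distDiag (toDist a) l := by
  simp [diagHom]

end Diagonal

/-! ### The exponential of a derivation -/

section Exponential

variable {R : Type*} [CommRing R] [Module ℂ R]

/-- The Leibniz rule. -/
def IsLeibniz (D : R →ₗ[ℂ] R) : Prop := ∀ a b, D (a * b) = D a * b + a * D b

theorem IsLeibniz.map_one {D : R →ₗ[ℂ] R} (hD : IsLeibniz D) : D 1 = 0 := by
  simpa using hD 1 1

/-- The series `e^{zD} a`. -/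
def expSeries (D : R →ₗ[ℂ] R) (a : R) : PowerSeries R :=
  PowerSeries.mk fun k => ((k.factorial : ℂ))⁻¹ • D^[k] a

@[simp]
theorem coeff_expSeries (D : R →ₗ[ℂ] R) (a : R) (k : ℕ) :
    PowerSeries.coeff k (expSeries D a) = ((k.factorial : ℂ))⁻¹ • D^[k] a := by
  simp [expSeries]

theorem expSeries_add (D : R →ₗ[ℂ] R) (a b : R) :
    expSeries D (a + b) = expSeries D a + expSeries D b := by
  ext k
  simp [smul_add]

theorem succ_smul_coeff_expSeries (D : R →ₗ[ℂ] R) (a : R) (k : ℕ) :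
    ((k + 1 : ℕ) : ℂ) • PowerSeries.coeff (k + 1) (expSeries D a) =
      PowerSeries.coeff k (expSeries D (D a)) := by
  rw [coeff_expSeries, coeff_expSeries, iterate_succ_apply, smul_smul, Nat.factorial_succ]
  congr 1
  push_cast
  have : ((k : ℂ) + 1) ≠ 0 := by exact_mod_cast k.succ_ne_zero
  have : ((k.factorial : ℂ)) ≠ 0 := by exact_mod_cast k.factorial_ne_zero
  field_simp

theorem succ_smul_coeff (F : PowerSeries R) (n : ℕ) :
    ((n + 1 : ℕ) : ℂ) • PowerSeries.coeff (n + 1) F =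
      PowerSeries.coeff n (PowerSeries.derivative R F) := by
  rw [PowerSeries.coeff_derivative, Nat.cast_smul_eq_nsmul, nsmul_eq_mul, mul_comm]
  push_cast
  rfl

theorem derivative_expSeries (D : R →ₗ[ℂ] R) (a : R) :
    PowerSeries.derivative R (expSeries D a) = expSeries D (D a) := by
  ext k
  rw [← succ_smul_coeff, ← succ_smul_coeff_expSeries]

/-- Since `d/dz e^{zD} a = e^{zD} D a`, the `z`-derivatives of both sides are sums of series of the
same shape, by Leibniz for `D` and for `d/dz`. Induction on the coefficient therefore closes after
division by `n + 1`. -/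
theorem expSeries_mul {D : R →ₗ[ℂ] R} (hD : IsLeibniz D) (a b : R) :
    expSeries D (a * b) = expSeries D a * expSeries D b := by
  ext n
  induction n generalizing a b with
  | zero => simp [PowerSeries.coeff_mul]
  | succ n ih =>
    have h : ((n + 1 : ℕ) : ℂ) ≠ 0 := by exact_mod_cast n.succ_ne_zero
    refine (smul_right_injective R h : Injective _) ?_
    simp only [succ_smul_coeff]
    rw [Derivation.leibniz, derivative_expSeries, derivative_expSeries, derivative_expSeries,
      hD, expSeries_add, smul_eq_mul, smul_eq_mul, map_add, map_add, ih, ih, add_comm,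
      mul_comm (expSeries D b)]

/-- `a ↦ e^{zD} a` as a ring homomorphism. -/
def expHom (D : R →ₗ[ℂ] R) (hD : IsLeibniz D) : R →+* PowerSeries R where
  toFun := expSeries D
  map_one' := by
    ext k
    rw [coeff_expSeries]
    cases k with
    | zero => simp
    | succ k => simp [hD.map_one, PowerSeries.coeff_one]
  map_zero' := by ext k; simp
  map_add' := expSeries_add D
  map_mul' := expSeries_mul hD

@[simp]
theorem coeff_expHom (D : R →ₗ[ℂ] R) (hD : IsLeibniz D) (a : R) (k : ℕ) :
    PowerSeries.coeff k (expHom D hD a) = ((k.factorial : ℂ))⁻¹ • D^[k] a := coeff_expSeries D a k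

end Exponential

/-! ### The substitution `x₁ = φ(x, z)` as a ring homomorphism -/

section Substitution

/-- A multiple of a derivation. -/
def mulWeightDeriv {Γ : Type*} [AddCommGroup Γ] [PartialOrder Γ] [IsOrderedCancelAddMonoid Γ]
    (f : HahnSeries Γ ℂ) (ω : Γ →+ ℂ) : HahnSeries Γ ℂ →ₗ[ℂ] HahnSeries Γ ℂ where
  toFun x := f * weightDeriv ω x
  map_add' x y := by rw [map_add, mul_add]
  map_smul' c x := by
    rw [map_smul, ← HahnSeries.C_mul_eq_smul, mul_left_comm, HahnSeries.C_mul_eq_smul]; rfl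

theorem isLeibniz_mulWeightDeriv {Γ : Type*} [AddCommGroup Γ] [PartialOrder Γ]
    [IsOrderedCancelAddMonoid Γ] (f : HahnSeries Γ ℂ) (ω : Γ →+ ℂ) :
    IsLeibniz (mulWeightDeriv f ω) := fun a b => by
  simp only [mulWeightDeriv, LinearMap.coe_mk, AddHom.coe_mk, weightDeriv_mul]
  ring

/-- `p(x) d/dx` on `ℂ((x))`. -/
def pD (p : LaurentSeries ℂ) : LaurentSeries ℂ →ₗ[ℂ] LaurentSeries ℂ :=
  mulWeightDeriv (p * HahnSeries.single (-1) 1) (Int.castAddHom ℂ)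

/-- `p(x₁) ∂/∂x₁` on `ℂ((x₁, x₂))`. -/
def pD₁ (p : LaurentSeries ℂ) : Laurent₂ →ₗ[ℂ] Laurent₂ :=
  mulWeightDeriv (embFst p * HahnSeries.single (-1, 0) 1)
    ((Int.castAddHom ℂ).comp (AddMonoidHom.fst ℤ ℤ))

/-- `p(x₂) ∂/∂x₂` on `ℂ((x₁, x₂))`. -/
def pD₂ (p : LaurentSeries ℂ) : Laurent₂ →ₗ[ℂ] Laurent₂ :=
  mulWeightDeriv (embSnd p * HahnSeries.single (0, -1) 1)
    ((Int.castAddHom ℂ).comp (AddMonoidHom.snd ℤ ℤ))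

theorem isLeibniz_pD (p : LaurentSeries ℂ) : IsLeibniz (pD p) := isLeibniz_mulWeightDeriv _ _

theorem isLeibniz_pD₁ (p : LaurentSeries ℂ) : IsLeibniz (pD₁ p) := isLeibniz_mulWeightDeriv _ _

theorem pD_apply (p a : LaurentSeries ℂ) :
    pD p a = p * (HahnSeries.single (-1) 1 * weightDeriv (Int.castAddHom ℂ) a) :=
  mul_assoc _ _ _

theorem pD₁_apply (p : LaurentSeries ℂ) (a : Laurent₂) :
    pD₁ p a = embFst p * (HahnSeries.single (-1, 0) 1 *
      weightDeriv ((Int.castAddHom ℂ).comp (AddMonoidHom.fst ℤ ℤ)) a) :=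
  mul_assoc _ _ _

theorem pD₂_apply (p : LaurentSeries ℂ) (a : Laurent₂) :
    pD₂ p a = embSnd p * (HahnSeries.single (0, -1) 1 *
      weightDeriv ((Int.castAddHom ℂ).comp (AddMonoidHom.snd ℤ ℤ)) a) :=
  mul_assoc _ _ _

theorem toDist_pD₁ (p : LaurentSeries ℂ) (a : Laurent₂) :
    toDist (pD₁ p a) = distPD₁ p (toDist a) := by
  rw [pD₁_apply, toDist_mul, distPD₁]
  congr 1
  funext m n
  simp [toDist, distD₁, HahnSeries.coeff_single_mul]

theorem swapHom_pD₁ (p : LaurentSeries ℂ) (a : Laurent₂) :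
    swapHom (pD₁ p a) = pD₂ p (swapHom a) := by
  rw [pD₁_apply, pD₂_apply, map_mul]
  congr 1
  ext ⟨m, n⟩
  change (HahnSeries.single (-1, 0) (1 : ℂ) * weightDeriv _ a).coeff (n, m) = _
  simp [HahnSeries.coeff_single_mul, swapHom, ofDist, dswap, toDist]

theorem toDist_iterate_pD₁ (p : LaurentSeries ℂ) (a : Laurent₂) (k : ℕ) :
    toDist ((pD₁ p)^[k] a) = (distPD₁ p)^[k] (toDist a) := by
  induction k generalizing a with
  | zero => rfl
  | succ k ih => rw [iterate_succ_apply, iterate_succ_apply, ih, toDist_pD₁]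

theorem pD_eq (p f : LaurentSeries ℂ) :
    pD p f = p * LaurentSeries.derivative ℂ f := by
  rw [pD_apply]
  congr 1
  ext n
  simp [HahnSeries.coeff_single_mul]

/-- The substitution `x₁ = φ(x, z)`, `x₂ = x` as a ring homomorphism. -/
def phiHom (p : LaurentSeries ℂ) : Laurent₂ →+* LaurentSeries (LaurentSeries ℂ) :=
  (HahnSeries.ofPowerSeries ℤ (LaurentSeries ℂ)).comp
    ((PowerSeries.map diagHom).comp (expHom (pD₁ p) (isLeibniz_pD₁ p)))

/-- `g(x) ↦ g(φ(x, z))`. -/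
def expX (p : LaurentSeries ℂ) : LaurentSeries ℂ →+* LaurentSeries (LaurentSeries ℂ) :=
  (HahnSeries.ofPowerSeries ℤ (LaurentSeries ℂ)).comp (expHom (pD p) (isLeibniz_pD p))

theorem iterDist_phiSubst (p : LaurentSeries ℂ) (a : Laurent₂) :
    iterDist (phiSubst p a) = substPhi p (toDist a) := iterDist_ofIter _ _ _

/-- The substitution is `e^{zD}` followed by restriction to the diagonal; both factors are
multiplicative, and this is how `phiSubst` becomes multiplicative. -/
theorem phiSubst_eq (p : LaurentSeries ℂ) (a : Laurent₂) : phiSubst p a = phiHom p a := by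
  apply iterDist_injective
  rw [iterDist_phiSubst]
  funext k l
  rw [iterDist, phiHom]
  simp only [RingHom.comp_apply, substPhi]
  rw [PowerSeries.coeff_coe]
  rcases lt_or_ge k 0 with h | h
  · rw [if_pos h, if_neg (not_le.2 h)]; rfl
  · rw [if_neg (not_lt.2 h), if_pos h]
    obtain ⟨k, rfl⟩ := Int.eq_ofNat_of_zero_le h
    simp only [Int.toNat_natCast, Int.natAbs_natCast, PowerSeries.coeff_map, coeff_expHom]
    rw [coeff_diagHom, ← toDist_iterate_pD₁]
    have : toDist ((k.factorial : ℂ)⁻¹ • (pD₁ p)^[k] a) =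
      fun m n => (k.factorial : ℂ)⁻¹ • toDist ((pD₁ p)^[k] a) m n := rfl
    rw [this]
    exact smul_finsum' ((k.factorial : ℂ)⁻¹) (diag_hasFiniteSupport (isLaurent₂_toDist _) l)

theorem coeff_phiHom_of_neg (p : LaurentSeries ℂ) (a : Laurent₂) {k : ℤ} (hk : k < 0) :
    (phiHom p a).coeff k = 0 := by
  simp only [phiHom, RingHom.comp_apply]
  rw [PowerSeries.coeff_coe, if_pos hk]

theorem coeff_phiHom (p : LaurentSeries ℂ) (a : Laurent₂) (k : ℕ) :
    (phiHom p a).coeff k = diagHom (((k.factorial : ℂ))⁻¹ • (pD₁ p)^[k] a) := by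
  simp only [phiHom, RingHom.comp_apply]
  rw [LaurentSeries.coeff_coe_powerSeries]
  simp

theorem coeff_expX_of_neg (p a : LaurentSeries ℂ) {k : ℤ} (hk : k < 0) :
    (expX p a).coeff k = 0 := by
  simp only [expX, RingHom.comp_apply]
  rw [PowerSeries.coeff_coe, if_pos hk]

theorem coeff_expX (p a : LaurentSeries ℂ) (k : ℕ) :
    (expX p a).coeff k = ((k.factorial : ℂ))⁻¹ • (pD p)^[k] a := by
  simp only [expX, RingHom.comp_apply]
  rw [LaurentSeries.coeff_coe_powerSeries]
  simp

theorem diagHom_smul (c : ℂ) (a : Laurent₂) : diagHom (c • a) = c • diagHom a := by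
  ext l
  simp only [coeff_diagHom, HahnSeries.coeff_smul]
  exact (smul_finsum' c (diag_hasFiniteSupport (isLaurent₂_toDist _) l)).symm

theorem diagHom_embFst (g : LaurentSeries ℂ) : diagHom (embFst g) = g := by
  ext l
  rw [coeff_diagHom, distDiag, finsum_eq_single _ l]
  · simp [embFst, inFst]
  · intro m hm
    simp [embFst, inFst, sub_eq_zero, hm.symm]

theorem diagHom_embSnd (g : LaurentSeries ℂ) : diagHom (embSnd g) = g := by
  ext l
  rw [coeff_diagHom, distDiag, finsum_eq_single _ 0]
  · simp [embSnd, inSnd]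
  · intro m hm
    simp [embSnd, inSnd, hm]

theorem embFst_mul (f g : LaurentSeries ℂ) : embFst (f * g) = embFst f * embFst g := by
  apply toDist_injective
  funext m n
  rw [toDist_mul, distMul_apply_mul, finsum_curry]
  · simp only [embFst, toDist_ofDist, inFst]
    split_ifs with h
    · rw [coeff_mul_eq_finsum]
      refine finsum_congr fun a => ?_
      rw [finsum_eq_single _ 0 (fun b hb => by simp [hb])]
      simp [h]
    · refine (finsum_eq_zero_of_forall_eq_zero fun a => ?_).symm
      refine finsum_eq_zero_of_forall_eq_zero fun b => ?_
      by_cases hb : b = 0 <;> simp [hb, h]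
  · exact (isLaurent₂_toDist _).isIter.hasFiniteSupport (isLaurent₂_toDist _).isIter m n

theorem embSnd_eq_swapHom (g : LaurentSeries ℂ) : embSnd g = swapHom (embFst g) := rfl

theorem embSnd_mul (f g : LaurentSeries ℂ) : embSnd (f * g) = embSnd f * embSnd g := by
  rw [embSnd_eq_swapHom, embFst_mul, map_mul]; rfl

theorem pD₁_embFst (p g : LaurentSeries ℂ) : pD₁ p (embFst g) = embFst (pD p g) := by
  rw [pD₁_apply, pD_apply, embFst_mul]
  congr 1
  ext ⟨m, n⟩
  simp only [HahnSeries.coeff_single_mul, embFst, ofDist, inFst]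
  by_cases h : n = 0 <;> simp [h]

theorem pD₁_embSnd (p g : LaurentSeries ℂ) : pD₁ p (embSnd g) = 0 := by
  rw [pD₁_apply]
  convert! mul_zero _
  ext ⟨m, n⟩
  simp only [HahnSeries.coeff_single_mul, embSnd, ofDist, inSnd, coeff_weightDeriv]
  by_cases h : m + 1 = 0 <;> simp [h]

theorem phiHom_embFst (p g : LaurentSeries ℂ) : phiHom p (embFst g) = expX p g := by
  refine HahnSeries.ext (funext fun k => ?_)
  rcases lt_or_ge k 0 with h | h
  · rw [coeff_phiHom_of_neg p _ h, coeff_expX_of_neg p _ h]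
  · lift k to ℕ using h
    rw [coeff_phiHom, coeff_expX, diagHom_smul]
    congr 1
    have : (pD₁ p)^[k] (embFst g) = embFst ((pD p)^[k] g) := by
      induction k generalizing g with
      | zero => rfl
      | succ k ih => rw [iterate_succ_apply, iterate_succ_apply, pD₁_embFst, ih]
    rw [this, diagHom_embFst]

theorem phiHom_embSnd (p g : LaurentSeries ℂ) : phiHom p (embSnd g) = HahnSeries.C g := by
  refine HahnSeries.ext (funext fun k => ?_)
  rcases lt_or_ge k 0 with h | h
  · rw [coeff_phiHom_of_neg p _ h, HahnSeries.C_apply, HahnSeries.coeff_single_of_ne h.ne]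
  · lift k to ℕ using h
    rw [coeff_phiHom, diagHom_smul]
    cases k with
    | zero => simp [diagHom_embSnd]
    | succ k =>
      rw [iterate_succ_apply, pD₁_embSnd, iterate_map_zero, map_zero, smul_zero,
        HahnSeries.C_apply, HahnSeries.coeff_single_of_ne (by lia)]

end Substitution

/-! ### Division by `x₁ - x₂` and injectivity of the substitution -/

section Division

/-- The variable `x₁`. -/
abbrev X₁ : Laurent₂ := HahnSeries.single ((1, 0) : ℤ × ℤ) (1 : ℂ)

/-- The variable `x₂`. -/
abbrev X₂ : Laurent₂ := HahnSeries.single ((0, 1) : ℤ × ℤ) (1 : ℂ)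

theorem embFst_single (n : ℤ) (c : ℂ) :
    embFst (HahnSeries.single n c) = HahnSeries.single (n, 0) c := by
  ext ⟨a, b⟩
  simp only [embFst, ofDist, inFst, HahnSeries.coeff_single, Prod.mk.injEq]
  by_cases hb : b = 0 <;> simp [hb]

theorem embSnd_single (n : ℤ) (c : ℂ) :
    embSnd (HahnSeries.single n c) = HahnSeries.single (0, n) c := by
  ext ⟨a, b⟩
  simp only [embSnd, ofDist, inSnd, HahnSeries.coeff_single, Prod.mk.injEq]
  by_cases ha : a = 0 <;> simp [ha]

/-- All exponents of `a` are at least `N` in both variables. -/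
def BddBy (a : Laurent₂) (N : ℤ) : Prop := ∀ m n, a.coeff (m, n) ≠ 0 → N ≤ m ∧ N ≤ n

theorem coeff_sub_mul (b : Laurent₂) (m n : ℤ) :
    ((X₁ - X₂) * b).coeff (m, n) = b.coeff (m - 1, n) - b.coeff (m, n - 1) := by
  rw [sub_mul, HahnSeries.coeff_sub, HahnSeries.coeff_single_mul, HahnSeries.coeff_single_mul]
  simp

/-- Each antidiagonal of `a` sums to zero, so telescoping along it solves for the quotient. Keeping
the same lower bound `N` matters for the iteration in `le_of_phiHom_eq_zero`. -/
theorem exists_eq_sub_mul {a : Laurent₂} (h : diagHom a = 0) {N : ℤ} (hN : BddBy a N) :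
    ∃ b, a = (X₁ - X₂) * b ∧ BddBy b N := by
  -- The tail sums satisfy `B (m - 1) n - B m (n - 1) = a (m, n)`. For `m < N` the tail is the whole
  -- antidiagonal, hence zero.
  let B : FDist ℂ := fun m n => ∑ᶠ j : ℤ, if m < j then a.coeff (j, m + n + 1 - j) else 0
  have hB : ∀ m n, B m n ≠ 0 → N ≤ m ∧ N ≤ n := by
    intro m n hmn
    constructor
    · by_contra hm
      refine hmn ?_
      have h1 : (diagHom a).coeff (m + n + 1) = 0 := by rw [h]; rfl
      rw [coeff_diagHom] at h1
      rw [← h1]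
      refine finsum_congr fun j => ?_
      split_ifs with hj
      · rfl
      · by_contra h2
        have := hN _ _ (Ne.symm h2)
        lia
    · obtain ⟨j, hj⟩ := exists_term_ne_zero hmn
      split_ifs at hj with h1
      · have := hN _ _ hj
        lia
      · exact absurd rfl hj
  refine ⟨ofDist B ⟨N, hB⟩, ?_, hB⟩
  ext ⟨m, n⟩
  rw [coeff_sub_mul]
  change _ = B (m - 1) n - B m (n - 1)
  have hfin : ∀ q : ℤ → Prop, [DecidablePred q] → HasFiniteSupport fun j : ℤ =>
      if q j then a.coeff (j, m + n - j) else 0 := fun q _ => by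
    refine (Set.finite_Icc N (m + n - N)).subset fun j hj => ?_
    have : a.coeff (j, m + n - j) ≠ 0 := by
      intro h0
      simp [h0] at hj
    have := hN _ _ this
    exact ⟨by lia, by lia⟩
  have e1 : B (m - 1) n = ∑ᶠ j : ℤ, if m - 1 < j then a.coeff (j, m + n - j) else 0 := by
    refine finsum_congr fun j => ?_
    rw [show m - 1 + n + 1 - j = m + n - j by ring]
  have e2 : B m (n - 1) = ∑ᶠ j : ℤ, if m < j then a.coeff (j, m + n - j) else 0 := by
    refine finsum_congr fun j => ?_
    rw [show m + (n - 1) + 1 - j = m + n - j by ring]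
  rw [e1, e2, ← finsum_sub_distrib (hfin _) (hfin _), finsum_eq_single _ m]
  · simp
  · intro j hj
    by_cases h1 : m < j
    · rw [if_pos h1, if_pos (by lia), sub_self]
    · rw [if_neg h1, if_neg (by lia), sub_self]

theorem exists_bddBy (a : Laurent₂) : ∃ N, BddBy a N := isLaurent₂_toDist a

/-- The series `φ(x, z)`. -/
def phi (p : LaurentSeries ℂ) : LaurentSeries (LaurentSeries ℂ) := expX p (HahnSeries.single 1 1)

theorem phiHom_X₁ (p : LaurentSeries ℂ) : phiHom p X₁ = phi p := by
  rw [X₁, ← embFst_single, phiHom_embFst]; rfl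

theorem phiHom_X₂ (p : LaurentSeries ℂ) :
    phiHom p X₂ = HahnSeries.C (HahnSeries.single 1 1) := by
  rw [X₂, ← embSnd_single, phiHom_embSnd]

theorem pD_X (p : LaurentSeries ℂ) : pD p (HahnSeries.single 1 1) = p := by
  rw [pD_apply]
  convert! mul_one p using 2
  ext n
  simp only [HahnSeries.coeff_single_mul, coeff_weightDeriv, HahnSeries.coeff_single,
    HahnSeries.coeff_one]
  by_cases h : n = 0 <;> simp [h]

theorem coeff_phi_zero (p : LaurentSeries ℂ) : (phi p).coeff 0 = HahnSeries.single 1 1 := by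
  rw [phi]
  simpa using coeff_expX p (HahnSeries.single 1 1) 0

theorem coeff_phi_one (p : LaurentSeries ℂ) : (phi p).coeff 1 = p := by
  rw [phi]
  simpa [pD_X] using coeff_expX p (HahnSeries.single 1 1) 1

theorem phi_sub_ne_zero {p : LaurentSeries ℂ} (hp : p ≠ 0) :
    phi p - HahnSeries.C (HahnSeries.single 1 1) ≠ 0 := by
  intro h
  have h1 := congrArg (fun E => HahnSeries.coeff E 1) h
  simp only [HahnSeries.coeff_sub, HahnSeries.C_apply] at h1
  rw [coeff_phi_one, HahnSeries.coeff_single_of_ne (by norm_num), sub_zero] at h1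
  exact hp h1

theorem coeff_phiHom_zero (p : LaurentSeries ℂ) (a : Laurent₂) :
    (phiHom p a).coeff 0 = diagHom a := by
  simpa using coeff_phiHom p a 0

/-- The `z⁰` coefficient of the substitution is the diagonal, so `a` is divisible by `x₁ - x₂`. As
`φ(x, z) - x ≠ 0`, the quotient is again in the kernel and has the same bound `N`. Each division
raises the lower bound on the total degree by one. -/
theorem le_of_phiHom_eq_zero {p : LaurentSeries ℂ} (hp : p ≠ 0) {N : ℤ} (k : ℕ) {a : Laurent₂}
    (ha : phiHom p a = 0) (hN : BddBy a N) (m n : ℤ) (h : a.coeff (m, n) ≠ 0) :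
    2 * N + k ≤ m + n := by
  induction k generalizing a m n with
  | zero =>
    have := hN m n h
    lia
  | succ k ih =>
    have hd : diagHom a = 0 := by rw [← coeff_phiHom_zero p, ha]; rfl
    obtain ⟨b, rfl, hb⟩ := exists_eq_sub_mul hd hN
    rw [map_mul, map_sub, phiHom_X₁, phiHom_X₂] at ha
    have hb0 : phiHom p b = 0 := by
      by_contra hb0
      exact mul_ne_zero (phi_sub_ne_zero hp) hb0 ha
    rw [coeff_sub_mul] at h
    by_cases h1 : b.coeff (m - 1, n) = 0
    · have h2 : b.coeff (m, n - 1) ≠ 0 := by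
        intro h2
        simp [h1, h2] at h
      have := ih hb0 hb _ _ h2
      push_cast
      lia
    · have := ih hb0 hb _ _ h1
      push_cast
      lia

theorem phiHom_injective {p : LaurentSeries ℂ} (hp : p ≠ 0) : Injective (phiHom p) := by
  rw [injective_iff_map_eq_zero]
  intro a ha
  obtain ⟨N, hN⟩ := exists_bddBy a
  ext ⟨m, n⟩
  by_contra h
  have := le_of_phiHom_eq_zero hp (m + n - 2 * N + 1).toNat ha hN m n h
  have := hN m n h
  lia

/-- The substitution `x₁ ↦ c x₁`. -/
def scaleHom (c : ℂˣ) : Laurent₂ →+* Laurent₂ :=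
  twist (fun g : ℤ × ℤ => (c : ℂ) ^ g.1) (by simp) (fun a b => zpow_add₀ c.ne_zero _ _)

@[simp]
theorem coeff_scaleHom (c : ℂˣ) (a : Laurent₂) (g : ℤ × ℤ) :
    (scaleHom c a).coeff g = (c : ℂ) ^ g.1 * a.coeff g := rfl

theorem scaleHom_injective (c : ℂˣ) : Injective (scaleHom c) := fun a b h => by
  ext g
  have h1 := congrArg (fun x => HahnSeries.coeff x g) h
  simpa [zpow_ne_zero] using h1

/-- The substitution `x₁ = c φ(x, z)`, `x₂ = x`. -/
def sigma (p : LaurentSeries ℂ) (c : ℂˣ) : Laurent₂ →+* LaurentSeries (LaurentSeries ℂ) :=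
  (phiHom p).comp (scaleHom c)

theorem sigma_injective {p : LaurentSeries ℂ} (hp : p ≠ 0) (c : ℂˣ) : Injective (sigma p c) :=
  (phiHom_injective hp).comp (scaleHom_injective c)

end Division

/-! ### Exchange of variables after the substitution -/

section Flip

variable (p : LaurentSeries ℂ)

/-- The coefficients of `∑ (-z)^k e^{z p d/dx} g_k(x)` for `G = ∑ g_k(x) z^k`. -/
def tauCoeff (G : 𝕂) (n : ℤ) : LaurentSeries ℂ :=
  ∑ᶠ k : ℤ, (-1) ^ k * (expX p (G.coeff k)).coeff (n - k)

theorem tauCoeff_finite (G : 𝕂) (n : ℤ) :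
    HasFiniteSupport fun k : ℤ => (-1) ^ k * (expX p (G.coeff k)).coeff (n - k) := by
  obtain ⟨N, hN⟩ := exists_lower_bound G
  refine (Set.finite_Icc N n).subset fun k hk => ⟨hN k fun h => hk ?_, ?_⟩
  · simp [h]
  · by_contra h
    exact hk (by dsimp only; rw [coeff_expX_of_neg p _ (by lia), mul_zero])

theorem tauCoeff_mul (G H : 𝕂) (n : ℤ) :
    tauCoeff p (G * H) n = ∑ᶠ r, tauCoeff p G r * tauCoeff p H (n - r) := by
  obtain ⟨N, hN⟩ := exists_lower_bound G
  obtain ⟨M, hM⟩ := exists_lower_bound H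
  -- The triple records the `z`-exponents of the terms of `G` and `H` and the power of `z` produced
  -- by `expX` from the term of `G`; the two sides group this family differently.
  let T : ℤ × ℤ × ℤ → LaurentSeries ℂ := fun x => (-1) ^ (x.1 + x.2.1) *
    ((expX p (G.coeff x.1)).coeff x.2.2 * (expX p (H.coeff x.2.1)).coeff (n - x.1 - x.2.1 - x.2.2))
  have hT : HasFiniteSupport T := by
    refine ((Set.finite_Icc N (n - M)).prod ((Set.finite_Icc M (n - N)).prod
      (Set.finite_Icc 0 (n - N - M)))).subset fun x hx => ?_
    have hx := right_ne_zero_of_mul hx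
    have h1 := left_ne_zero_of_mul hx
    have h2 := right_ne_zero_of_mul hx
    have h3 := hN x.1 fun h => h1 (by simp [h])
    have h4 := hM x.2.1 fun h => h2 (by simp [h])
    have h5 : 0 ≤ x.2.2 := by
      by_contra h
      exact h1 (coeff_expX_of_neg p _ (by lia))
    have h6 : 0 ≤ n - x.1 - x.2.1 - x.2.2 := by
      by_contra h
      exact h2 (coeff_expX_of_neg p _ (by lia))
    simp only [Set.mem_prod, Set.mem_Icc]
    lia
  have e1 : ∑ᶠ x, T x = tauCoeff p (G * H) n := by
    let e : ℤ × ℤ × ℤ ≃ ℤ × ℤ × ℤ :=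
      { toFun := fun x => (x.2.1, x.1 - x.2.1, x.2.2)
        invFun := fun x => (x.1 + x.2.1, x.1, x.2.2)
        left_inv := fun x => by ext <;> simp
        right_inv := fun x => by ext <;> simp }
    rw [← finsum_comp_equiv e, finsum_curry₃ _ (hT.preimage e.injective.injOn)]
    refine finsum_congr fun k => ?_
    rw [coeff_mul_eq_finsum, map_finsum (expX p) (hasFiniteSupport_coeff_mul _ _ _)]
    let π : 𝕂 →+ LaurentSeries ℂ :=
      { toFun := fun x => x.coeff (n - k), map_zero' := rfl, map_add' := fun _ _ => rfl }
    have hfin : HasFiniteSupport fun a => expX p (G.coeff a * H.coeff (k - a)) :=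
      (hasFiniteSupport_coeff_mul G H k).subset fun a ha h0 => ha (by
        change G.coeff a * H.coeff (k - a) = 0 at h0
        simp only [h0, map_zero])
    have hπ : π (∑ᶠ a, expX p (G.coeff a * H.coeff (k - a))) =
      ∑ᶠ a, π (expX p (G.coeff a * H.coeff (k - a))) :=
      π.map_finsum (f := fun a => expX p (G.coeff a * H.coeff (k - a))) hfin
    change _ = _ * π _
    rw [hπ, mul_finsum' _ _ (hfin.subset fun a ha h0 => ha ?_)]
    swap
    · change expX p (G.coeff a * H.coeff (k - a)) = 0 at h0
      simp only [h0, map_zero]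
    refine finsum_congr fun a => ?_
    change _ = _ * (expX p (G.coeff a * H.coeff (k - a))).coeff (n - k)
    rw [map_mul, coeff_mul_eq_finsum, mul_finsum' _ _ (hasFiniteSupport_coeff_mul
      (expX p (G.coeff a)) (expX p (H.coeff (k - a))) (n - k))]
    refine finsum_congr fun i => ?_
    simp only [T, e, Equiv.coe_fn_mk]
    rw [show a + (k - a) = k by ring, show n - a - (k - a) - i = n - k - i by ring]
  have e2 : ∑ᶠ x, T x = ∑ᶠ r, tauCoeff p G r * tauCoeff p H (n - r) := by
    let e : ℤ × ℤ × ℤ ≃ ℤ × ℤ × ℤ :=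
      { toFun := fun x => (x.2.1, x.2.2, x.1 - x.2.1)
        invFun := fun x => (x.2.2 + x.1, x.1, x.2.1)
        left_inv := fun x => by ext <;> simp
        right_inv := fun x => by ext <;> simp }
    rw [← finsum_comp_equiv e, finsum_curry₃ _ (hT.preimage e.injective.injOn)]
    refine finsum_congr fun r => ?_
    rw [tauCoeff, finsum_mul' _ _ (tauCoeff_finite p G r)]
    refine finsum_congr fun a => ?_
    rw [tauCoeff, mul_finsum' _ _ (tauCoeff_finite p H _)]
    refine finsum_congr fun b => ?_
    simp only [T, e, Equiv.coe_fn_mk]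
    rw [show n - a - b - (r - a) = n - r - b by ring, zpow_add₀ (by simp)]
    ring
  rw [← e1, e2]

theorem tauCoeff_bddBelow (G : 𝕂) : BddBelow (support (tauCoeff p G)) := by
  obtain ⟨N, hN⟩ := exists_lower_bound G
  refine ⟨N, fun n hn => ?_⟩
  obtain ⟨k, hk⟩ := exists_term_ne_zero hn
  have h1 := hN k fun h => hk (by simp [h])
  by_contra h
  exact hk (by rw [coeff_expX_of_neg p _ (by lia), mul_zero])

/-- `∑ g_k(x) z^k ↦ ∑ (-z)^k e^{z p d/dx} g_k(x)`. -/
def tauHom : 𝕂 →+* 𝕂 where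
  toFun G := HahnSeries.ofSuppBddBelow (tauCoeff p G) (tauCoeff_bddBelow p G)
  map_one' := by
    refine HahnSeries.ext (funext fun n => ?_)
    rw [HahnSeries.coeff_ofSuppBddBelow, tauCoeff, finsum_eq_single _ 0]
    · simp
    · intro k hk
      simp [HahnSeries.coeff_one, hk]
  map_zero' := by
    refine HahnSeries.ext (funext fun n => ?_)
    simp [tauCoeff]
  map_add' G H := by
    refine HahnSeries.ext (funext fun n => ?_)
    rw [HahnSeries.coeff_add, HahnSeries.coeff_ofSuppBddBelow, HahnSeries.coeff_ofSuppBddBelow,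
      HahnSeries.coeff_ofSuppBddBelow, tauCoeff, tauCoeff, tauCoeff,
      ← finsum_add_distrib (tauCoeff_finite p G n) (tauCoeff_finite p H n)]
    refine finsum_congr fun k => ?_
    rw [HahnSeries.coeff_add, map_add, HahnSeries.coeff_add, mul_add]
  map_mul' G H := by
    refine HahnSeries.ext (funext fun n => ?_)
    rw [coeff_mul_eq_finsum]
    simp only [HahnSeries.coeff_ofSuppBddBelow]
    exact tauCoeff_mul p G H n

theorem coeff_tauHom (G : 𝕂) (n : ℤ) : (tauHom p G).coeff n = tauCoeff p G n := by
  simp [tauHom]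

theorem diagHom_swapHom (a : Laurent₂) : diagHom (swapHom a) = diagHom a := by
  ext l
  rw [coeff_diagHom, coeff_diagHom, distDiag, distDiag,
    ← finsum_comp_equiv (Equiv.subLeft l)]
  refine finsum_congr fun m => ?_
  simp [dswap]

theorem swapHom_iterate_pD₁ (a : Laurent₂) (k : ℕ) :
    (pD₁ p)^[k] (swapHom a) = swapHom ((pD₂ p)^[k] a) := by
  induction k generalizing a with
  | zero => rfl
  | succ k ih =>
    rw [iterate_succ_apply, iterate_succ_apply, ← ih, ← swapHom_swapHom (pD₁ p (swapHom a)),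
      swapHom_pD₁, swapHom_swapHom]

theorem diagHom_weightDeriv (a : Laurent₂) :
    weightDeriv (Int.castAddHom ℂ) (diagHom a) =
      diagHom (weightDeriv ((Int.castAddHom ℂ).comp (AddMonoidHom.fst ℤ ℤ)) a) +
      diagHom (weightDeriv ((Int.castAddHom ℂ).comp (AddMonoidHom.snd ℤ ℤ)) a) := by
  rw [← map_add]
  ext l
  rw [coeff_weightDeriv, coeff_diagHom, coeff_diagHom, distDiag, distDiag,
    mul_finsum' _ _ (diag_hasFiniteSupport (isLaurent₂_toDist a) l)]
  refine finsum_congr fun m => ?_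
  simp only [toDist, HahnSeries.coeff_add, coeff_weightDeriv]
  simp
  ring

/-- Chain rule on the diagonal: differentiating `a(x, x)` adds the two partial derivatives. -/
theorem pD_diagHom (a : Laurent₂) : pD p (diagHom a) = diagHom ((pD₁ p + pD₂ p) a) := by
  rw [LinearMap.add_apply, pD₁_apply, pD₂_apply, pD_apply, diagHom_weightDeriv,
    ← embFst_single, ← embSnd_single, map_add, map_mul, map_mul, map_mul, map_mul,
    diagHom_embFst, diagHom_embFst, diagHom_embSnd, diagHom_embSnd]
  ring

theorem iterate_pD_smul (c : ℂ) (a : LaurentSeries ℂ) (k : ℕ) :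
    (pD p)^[k] (c • a) = c • (pD p)^[k] a := by
  rw [← Module.End.pow_apply, map_smul, Module.End.pow_apply]

theorem iterate_pD_diagHom (a : Laurent₂) (k : ℕ) :
    (pD p)^[k] (diagHom a) = diagHom (((pD₁ p + pD₂ p) ^ k) a) := by
  induction k generalizing a with
  | zero => rfl
  | succ k ih => rw [iterate_succ_apply, pD_diagHom, ih, pow_succ, Module.End.mul_apply]

theorem pD₁_pD₂_comm : Commute (pD₁ p) (pD₂ p) := by
  have h1 : weightDeriv ((Int.castAddHom ℂ).comp (AddMonoidHom.fst ℤ ℤ))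
      (embSnd (p * HahnSeries.single (-1) 1)) = 0 := by
    ext ⟨m, n⟩
    simp only [coeff_weightDeriv, embSnd, ofDist, inSnd]
    by_cases h : m = 0 <;> simp [h]
  have h2 : weightDeriv ((Int.castAddHom ℂ).comp (AddMonoidHom.snd ℤ ℤ))
      (embFst (p * HahnSeries.single (-1) 1)) = 0 := by
    ext ⟨m, n⟩
    simp only [coeff_weightDeriv, embFst, ofDist, inFst]
    by_cases h : n = 0 <;> simp [h]
  refine LinearMap.ext fun a => ?_
  rw [Module.End.mul_apply, Module.End.mul_apply]
  simp only [pD₁_apply, pD₂_apply]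
  rw [← embFst_single, ← embSnd_single]
  simp only [← mul_assoc]
  rw [← embFst_mul, ← embSnd_mul, weightDeriv_mul, weightDeriv_mul, h1, h2, zero_mul, zero_mul,
    zero_add, zero_add, mul_left_comm]
  congr 2
  ext g
  simp only [coeff_weightDeriv]
  ring

theorem inv_factorial_mul_choose {n m : ℕ} (h : m ≤ n) :
    ((n.factorial : ℂ))⁻¹ * (n.choose m : ℂ) =
      ((m.factorial : ℂ))⁻¹ * (((n - m).factorial : ℂ))⁻¹ := by
  have h1 : ((n.choose m : ℂ)) * m.factorial * (n - m).factorial = n.factorial := by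
    exact_mod_cast Nat.choose_mul_factorial_mul_factorial h
  have := fun k : ℕ => (Nat.cast_ne_zero (R := ℂ)).2 k.factorial_ne_zero
  have h2 := this n
  have h3 := this m
  have h4 := this (n - m)
  field_simp
  linear_combination h1

theorem neg_pow_end_apply {M : Type*} [AddCommGroup M] [Module ℂ M] (S : Module.End ℂ M) (k : ℕ)
    (c : M) : ((-S) ^ k) c = ((-1 : ℂ) ^ k) • S^[k] c := by
  induction k generalizing c with
  | zero => simp
  | succ k ih =>
    rw [pow_succ, Module.End.mul_apply, ih, LinearMap.neg_apply, iterate_map_neg,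
      ← iterate_succ_apply, pow_succ]
    simp

/-- The degree `n` part of `e^{zT} = e^{z(T + S)} e^{-zS}`. -/
theorem iterate_eq_sum_of_commute {M : Type*} [AddCommGroup M] [Module ℂ M]
    {T S : Module.End ℂ M} (h : Commute T S) (n : ℕ) (c : M) :
    ((n.factorial : ℂ))⁻¹ • T^[n] c = ∑ m ∈ Finset.range (n + 1),
      (((m.factorial : ℂ))⁻¹ * (((n - m).factorial : ℂ))⁻¹ * (-1) ^ (n - m)) •
        ((T + S) ^ m) (S^[n - m] c) := by
  have hT : T^[n] c = ((T + S + -S) ^ n) c := by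
    rw [add_neg_cancel_right, Module.End.pow_apply]
  have hcomm : Commute (T + S) (-S) := (h.add_left (Commute.refl _)).neg_right
  rw [hT, hcomm.add_pow, LinearMap.sum_apply, Finset.smul_sum]
  refine Finset.sum_congr rfl fun m hm => ?_
  have hm : m ≤ n := by simpa [Nat.lt_succ_iff] using hm
  rw [Module.End.mul_apply, Module.End.natCast_apply, map_nsmul, Module.End.mul_apply,
    neg_pow_end_apply, map_smul, ← Nat.cast_smul_eq_nsmul ℂ, smul_smul, smul_smul,
    inv_factorial_mul_choose hm]

/-- Formally, replacing `(x, z)` by `(φ(x, z), -z)` in `c(x, φ(x, z))` gives `c(φ(x, z), x)`, as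
`φ(φ(x, z), -z) = x`. In coefficients, factor `e^{z pD₁}` as `e^{z(pD₁ + pD₂)} e^{-z pD₂}`; on the
diagonal the first factor becomes `e^{z p d/dx}`. -/
theorem tauHom_phiHom_swapHom (c : Laurent₂) :
    tauHom p (phiHom p (swapHom c)) = phiHom p c := by
  refine HahnSeries.ext (funext fun n => ?_)
  rw [coeff_tauHom, tauCoeff]
  rcases lt_or_ge n 0 with h | h
  · rw [coeff_phiHom_of_neg p _ h]
    refine finsum_eq_zero_of_forall_eq_zero fun k => ?_
    rcases lt_or_ge k 0 with hk | hk
    · rw [coeff_phiHom_of_neg p _ hk, map_zero]; simp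
    · rw [coeff_expX_of_neg p _ (by lia), mul_zero]
  lift n to ℕ using h
  rw [coeff_phiHom, iterate_eq_sum_of_commute (pD₁_pD₂_comm p), map_sum,
    finsum_eq_sum_of_support_subset _
      -- The index `k = n - m` is the power of `-z`, and `m` the order of the exponential applied to
      -- that coefficient.
      (s := (Finset.range (n + 1)).image fun m : ℕ => (n : ℤ) - (m : ℤ))]
  · rw [Finset.sum_image fun a _ b _ h => by simpa using h]
    refine Finset.sum_congr rfl fun m hm => ?_
    have hm : m ≤ n := by simpa [Nat.lt_succ_iff] using hm
    rw [show (n : ℤ) - (n - m) = m by ring, show (n : ℤ) - m = ((n - m : ℕ) : ℤ) by lia,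
      coeff_phiHom, coeff_expX, swapHom_iterate_pD₁, diagHom_smul, diagHom_smul, diagHom_swapHom,
      iterate_pD_smul, iterate_pD_diagHom, smul_smul, zpow_natCast]
    have e2 : ((-1 : LaurentSeries ℂ)) ^ (n - m) = HahnSeries.C ((-1) ^ (n - m)) := by
      rw [map_pow, map_neg, map_one]
    rw [e2, HahnSeries.C_mul_eq_smul, smul_smul]
    congr 1
    ring
  · intro k hk
    simp only [Finset.coe_image, Set.mem_image, Finset.coe_range, Set.mem_Iio]
    have h1 : 0 ≤ k := by
      by_contra h
      exact hk (by dsimp only; rw [coeff_phiHom_of_neg p _ (by lia), map_zero]; simp)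
    have h2 : k ≤ n := by
      by_contra h
      exact hk (by dsimp only; rw [coeff_expX_of_neg p _ (by lia), mul_zero])
    exact ⟨(n - k).toNat, by lia, by lia⟩

end Flip

/-! ### Extension of the expansions and substitutions to fractions -/

section Fractions

/-- The expansion in `ℂ((x₁))((x₂))`. -/
def iotaSwapHom : Laurent₂ →+* 𝕂 := iotaHom.comp swapHom

theorem iotaSwapHom_injective : Injective iotaSwapHom :=
  iotaHom_injective.comp fun a b h => by rw [← swapHom_swapHom a, h, swapHom_swapHom]

theorem iterDist_iotaSwapHom (a : Laurent₂) : iterDist (iotaSwapHom a) = dswap (toDist a) :=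
  iterDist_iotaHom _

section

variable {K : Type*} [Field K]

/-- The extension of an embedding of `ℂ((x₁, x₂))` into a field to the fraction field. -/
def fracLift {g : Laurent₂ →+* K} (hg : Injective g) : Frac₂ →+* K := IsFractionRing.lift hg

@[simp]
theorem fracLift_algebraMap {g : Laurent₂ →+* K} (hg : Injective g) (a : Laurent₂) :
    fracLift hg (algebraMap Laurent₂ Frac₂ a) = g a := IsFractionRing.lift_algebraMap hg a

theorem fracLift_injective {g : Laurent₂ →+* K} (hg : Injective g) : Injective (fracLift hg) :=
  RingHom.injective _

theorem fden_ne_zero (F : Frac₂) : (fden F : Laurent₂) ≠ 0 := nonZeroDivisors.ne_zero (fden F).2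

theorem eq_fnum_div_fden (F : Frac₂) :
    F = algebraMap Laurent₂ Frac₂ (fnum F) / algebraMap Laurent₂ Frac₂ (fden F) := by
  rw [← IsFractionRing.mk'_eq_div]
  exact (IsLocalization.mk'_sec Frac₂ F).symm

theorem fracLift_eq {g : Laurent₂ →+* K} (hg : Injective g) (F : Frac₂) :
    fracLift hg F = g (fnum F) / g (fden F : Laurent₂) := by
  conv_lhs => rw [eq_fnum_div_fden F]
  rw [map_div₀, fracLift_algebraMap, fracLift_algebraMap]

/-- A series that becomes the image of a numerator after multiplication by a denominator is the
image of the quotient. This is how matrix coefficients are recognised as fractions. -/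
theorem fracLift_div {g : Laurent₂ →+* K} (hg : Injective g) {a b : Laurent₂} (hb : b ≠ 0) {x : K}
    (h : g b * x = g a) :
    fracLift hg (algebraMap Laurent₂ Frac₂ a / algebraMap Laurent₂ Frac₂ b) = x := by
  rw [map_div₀, fracLift_algebraMap, fracLift_algebraMap, ← h]
  exact mul_div_cancel_left₀ x ((map_ne_zero_iff g hg).2 hb)

end

theorem fracIota₂₁_eq (F : Frac₂) : fracIota₂₁ F = fracLift iotaHom_injective F := by
  rw [fracLift_eq, fracIota₂₁]
  rfl

theorem phiEval_eq {p : LaurentSeries ℂ} (hp : p ≠ 0) (F : Frac₂) :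
    phiEval p F = fracLift (phiHom_injective hp) F := by
  rw [fracLift_eq, phiEval, phiSubst_eq, phiSubst_eq]

theorem phiEval_hat {p f : LaurentSeries ℂ} (hf : f ∈ CPhi p) :
    phiEval p (hat p f) = constInX f := Function.invFunOn_eq hf

end Fractions

/-! ### Matrix coefficients of vertex operators as expansions of fractions -/

section Scalar

variable {V W : Type*} [AddCommGroup V] [Module ℂ V] [AddCommGroup W] [Module ℂ W]

theorem exists_coeff_bound (a : VertexOperator ℂ W) (w : W) :
    ∃ N : ℤ, ∀ n, HVertexOperator.coeff a n w ≠ 0 → N ≤ n :=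
  exists_lower_bound ((HahnModule.of ℂ).symm (a w))

theorem isIter_prod₂₁ (b a : VertexOperator ℂ W) (w : W) : IsIter (prod₂₁ b a w) := by
  constructor
  · obtain ⟨N, hN⟩ := exists_coeff_bound a w
    exact ⟨N, fun m n h => hN m fun h0 => h (by rw [prod₂₁, h0, map_zero])⟩
  · intro m
    obtain ⟨N, hN⟩ := exists_coeff_bound b (HVertexOperator.coeff a m w)
    exact ⟨N, fun n h => hN n h⟩

theorem isIter_iterate (Y_W : V →ₗ[ℂ] VertexOperator ℂ W) (a : VertexOperator ℂ V) (v : V) (w : W) :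
    IsIter (iterate Y_W a v w) := by
  constructor
  · obtain ⟨N, hN⟩ := exists_coeff_bound a v
    refine ⟨N, fun m n h => hN m fun h0 => h ?_⟩
    rw [iterate, h0, map_zero, map_zero]
    rfl
  · intro m
    obtain ⟨N, hN⟩ := exists_coeff_bound (Y_W (HVertexOperator.coeff a m v)) w
    exact ⟨N, fun n h => hN n h⟩

/-- Application of a linear functional to the coefficients. -/
def lmap (ℓ : W →ₗ[ℂ] ℂ) (A : FDist W) : FDist ℂ := fun m n => ℓ (A m n)

theorem lmap_isIter (ℓ : W →ₗ[ℂ] ℂ) {A : FDist W} (h : IsIter A) : IsIter (lmap ℓ A) := by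
  obtain ⟨⟨N, hN⟩, hA⟩ := h
  have key : ∀ m n, lmap ℓ A m n ≠ 0 → A m n ≠ 0 := fun m n h h0 => h (by rw [lmap, h0, map_zero])
  exact ⟨⟨N, fun m n h => hN m n (key m n h)⟩, fun m => (hA m).mono fun n h => key m n h⟩

theorem lmap_isLaurent₂ (ℓ : W →ₗ[ℂ] ℂ) {A : FDist W} (h : IsLaurent₂ A) :
    IsLaurent₂ (lmap ℓ A) := by
  obtain ⟨N, hN⟩ := h
  exact ⟨N, fun m n h => hN m n fun h0 => h (by rw [lmap, h0, map_zero])⟩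

theorem lmap_distMul (ℓ : W →ₗ[ℂ] ℂ) {c : FDist ℂ} {A : FDist W} (hc : IsIter c) (hA : IsIter A) :
    lmap ℓ (distMul c A) = distMul c (lmap ℓ A) := by
  funext m n
  refine (ℓ.toAddMonoidHom.map_finsum (hc.hasFiniteSupport hA m n)).trans ?_
  exact finsum_congr fun ab => map_smul ℓ _ _

theorem lmap_iterate_distPD₁ (ℓ : W →ₗ[ℂ] ℂ) (p : LaurentSeries ℂ) {A : FDist W} (h : IsLaurent₂ A)
    (k : ℕ) : lmap ℓ ((distPD₁ p)^[k] A) = (distPD₁ p)^[k] (lmap ℓ A) := by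
  induction k with
  | zero => rfl
  | succ k ih =>
    rw [iterate_succ_apply', iterate_succ_apply', ← ih, distPD₁, lmap_distMul ℓ
      (isLaurent₂_inFst p).isIter (h.iterate_distPD₁ p k).distD₁.isIter, distPD₁]
    congr 1
    funext m n
    exact map_smul ℓ _ _

theorem lmap_substPhi (ℓ : W →ₗ[ℂ] ℂ) (p : LaurentSeries ℂ) {A : FDist W} (h : IsLaurent₂ A) :
    lmap ℓ (substPhi p A) = substPhi p (lmap ℓ A) := by
  funext k l
  simp only [lmap, substPhi]
  split_ifs with hk
  · rw [map_smul]
    congr 1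
    refine (ℓ.toAddMonoidHom.map_finsum (diag_hasFiniteSupport (h.iterate_distPD₁ p _) l)).trans ?_
    refine finsum_congr fun m => ?_
    exact congrFun (congrFun (lmap_iterate_distPD₁ ℓ p h k.toNat) _) _
  · exact map_zero ℓ

/-- The element of `ℂ((y₂))((y₁))` with coefficients `A`. -/
def toIter (A : FDist ℂ) (h : IsIter A) : 𝕂 := ofIter A h.1 h.2

@[simp]
theorem iterDist_toIter (A : FDist ℂ) (h : IsIter A) : iterDist (toIter A h) = A :=
  iterDist_ofIter _ _ _

/-- The series `ℓ(a(y₂) b(y₁) w)`. -/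
def opProd (ℓ : W →ₗ[ℂ] ℂ) (a b : VertexOperator ℂ W) (w : W) : 𝕂 :=
  toIter (lmap ℓ (prod₂₁ a b w)) (lmap_isIter ℓ (isIter_prod₂₁ a b w))

@[simp]
theorem iterDist_opProd (ℓ : W →ₗ[ℂ] ℂ) (a b : VertexOperator ℂ W) (w : W) :
    iterDist (opProd ℓ a b w) = lmap ℓ (prod₂₁ a b w) := iterDist_toIter _ _

theorem prod₁₂_eq (a b : VertexOperator ℂ W) (w : W) : prod₁₂ a b w = dswap (prod₂₁ a b w) := rfl

theorem lmap_distMul_prod₁₂ (ℓ : W →ₗ[ℂ] ℂ) (f : Laurent₂) (a b : VertexOperator ℂ W) (w : W) :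
    lmap ℓ (distMul (toDist f) (prod₁₂ a b w)) =
      dswap (iterDist (iotaSwapHom f * opProd ℓ a b w)) := by
  rw [prod₁₂_eq, iterDist_mul, iterDist_iotaSwapHom, iterDist_opProd,
    ← lmap_distMul ℓ (isLaurent₂_toDist f).dswap.isIter (isIter_prod₂₁ a b w)]
  change lmap ℓ (distMul (dswap (dswap (toDist f))) _) = _
  rw [← dswap_distMul]
  rfl

variable {p : LaurentSeries ℂ} {𝒱 : NonlocalVertexAlgebra V} (𝒲 : PhiQuasiModule p 𝒱 W)

/-- The series `ℓ(Y_W(v, x) w)`, as an additive function of `v`. -/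
def opSeries (ℓ : W →ₗ[ℂ] ℂ) (w : W) : V →ₗ[ℂ] LaurentSeries ℂ where
  toFun v := ((HahnModule.of ℂ).symm (𝒲.Y v w)).map ℓ
  map_add' u v := by ext; simp
  map_smul' c v := by
    ext n
    change ℓ (HVertexOperator.coeff (𝒲.Y (c • v)) n w) =
      c * ℓ (HVertexOperator.coeff (𝒲.Y v) n w)
    rw [map_smul, map_smul, Pi.smul_apply, LinearMap.smul_apply, map_smul, smul_eq_mul]

theorem coeff_opSeries (ℓ : W →ₗ[ℂ] ℂ) (w : W) (v : V) (n : ℤ) :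
    (opSeries 𝒲 ℓ w v).coeff n = ℓ (HVertexOperator.coeff (𝒲.Y v) n w) := rfl

/-- The series `ℓ(Y_W(a(z)v, x) w)` in `ℂ((x))((z))`. -/
def iterSeries (ℓ : W →ₗ[ℂ] ℂ) (w : W) (a : VertexOperator ℂ V) (v : V) : 𝕂 :=
  ((HahnModule.of ℂ).symm (a v)).map (opSeries 𝒲 ℓ w)

theorem coeff_iterSeries (ℓ : W →ₗ[ℂ] ℂ) (w : W) (a : VertexOperator ℂ V) (v : V) (n : ℤ) :
    (iterSeries 𝒲 ℓ w a v).coeff n = opSeries 𝒲 ℓ w (HVertexOperator.coeff a n v) := rfl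

theorem iterDist_iterSeries (ℓ : W →ₗ[ℂ] ℂ) (w : W) (a : VertexOperator ℂ V) (v : V) :
    iterDist (iterSeries 𝒲 ℓ w a v) = lmap ℓ (iterate 𝒲.Y a v w) := rfl

/-- Both clauses of associativity use the same cleared product `c`, and the denominator `f` depends
neither on `ℓ` nor on `w`. -/
theorem exists_assoc (a b : V) : ∃ f : Laurent₂, f ≠ 0 ∧ ∀ (ℓ : W →ₗ[ℂ] ℂ) (w : W), ∃ c : Laurent₂,
    iotaSwapHom f * opProd ℓ (𝒲.Y a) (𝒲.Y b) w = iotaSwapHom c ∧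
    phiHom p f * iterSeries 𝒲 ℓ w (𝒱.Y a) b = phiHom p c := by
  obtain ⟨f, hf, h⟩ := 𝒲.assoc a b
  refine ⟨f, hf, fun ℓ w => ?_⟩
  obtain ⟨h1, h2⟩ := h w
  refine ⟨ofDist _ (lmap_isLaurent₂ ℓ h1), ?_, ?_⟩
  · apply iterDist_injective
    rw [iterDist_iotaSwapHom, toDist_ofDist, lmap_distMul_prod₁₂]
    rfl
  · apply iterDist_injective
    rw [← phiSubst_eq p (ofDist _ _), iterDist_phiSubst, toDist_ofDist, ← lmap_substPhi ℓ p h1, h2,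
      ← iterDist_phiSubst, phiSubst_eq, iterDist_mul, iterDist_iterSeries,
      ← lmap_distMul ℓ (isIter_iterDist _) (isIter_iterate _ _ _ _)]

/-- One fraction governs both the product and the iterate: an identity between fractions checked in
one of the two fields transfers to the other. -/
theorem exists_frac (hp : p ≠ 0) (a b : V) (ℓ : W →ₗ[ℂ] ℂ) (w : W) : ∃ F : Frac₂,
    fracLift iotaSwapHom_injective F = opProd ℓ (𝒲.Y a) (𝒲.Y b) w ∧
    fracLift (phiHom_injective hp) F = iterSeries 𝒲 ℓ w (𝒱.Y a) b := by
  obtain ⟨f, hf, h⟩ := exists_assoc 𝒲 a b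
  obtain ⟨c, h1, h2⟩ := h ℓ w
  exact ⟨_, fracLift_div _ hf h1, fracLift_div _ hf h2⟩

/-- For the opposite product, take the fraction of `Y_W(b, x₁)Y_W(a, x₂)` and exchange the
variables; on the side of the iterate this exchange is `tauHom`. -/
theorem exists_frac_flip (hp : p ≠ 0) (a b : V) (ℓ : W →ₗ[ℂ] ℂ) (w : W) : ∃ F : Frac₂,
    fracLift iotaHom_injective F = opProd ℓ (𝒲.Y b) (𝒲.Y a) w ∧
    fracLift (phiHom_injective hp) F = tauHom p (iterSeries 𝒲 ℓ w (𝒱.Y b) a) := by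
  obtain ⟨f, hf, h⟩ := exists_assoc 𝒲 b a
  obtain ⟨c, h1, h2⟩ := h ℓ w
  have hf' : swapHom f ≠ 0 := fun h0 => hf (by rw [← swapHom_swapHom f, h0, map_zero])
  refine ⟨_, fracLift_div _ hf' h1, fracLift_div _ hf' ?_⟩
  have h3 := congrArg (tauHom p) h2
  rwa [map_mul, ← swapHom_swapHom f, ← swapHom_swapHom c, tauHom_phiHom_swapHom,
    tauHom_phiHom_swapHom] at h3

/-- With the vacuum as second vector the product is just `Y_W(a, x₁)`, so its fraction is a series
in `x₁` alone, on which the substitution is `e^{z p d/dx}`. Thus `Y(a, z)1` plays the role of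
`e^{zD}a`. -/
theorem expX_opSeries (hp : p ≠ 0) (a : V) (ℓ : W →ₗ[ℂ] ℂ) (w : W) :
    expX p (opSeries 𝒲 ℓ w a) = iterSeries 𝒲 ℓ w (𝒱.Y a) 𝒱.one := by
  obtain ⟨F, h1, h2⟩ := exists_frac 𝒲 hp a 𝒱.one ℓ w
  have h3 : F = algebraMap Laurent₂ Frac₂ (embFst (opSeries 𝒲 ℓ w a)) := by
    apply fracLift_injective (K := 𝕂) (g := iotaSwapHom) iotaSwapHom_injective
    rw [h1, fracLift_algebraMap]
    apply iterDist_injective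
    rw [iterDist_iotaSwapHom, iterDist_opProd]
    funext m n
    simp only [lmap, prod₂₁, dswap, embFst, toDist_ofDist, inFst, 𝒲.one_left]
    split_ifs with h
    · rfl
    · rw [map_zero, map_zero]
  rw [← h2, h3, fracLift_algebraMap, phiHom_embFst]

/-- The coefficient of `z^n` in `e^{zD} Y(b, -z)a`. -/
def skewCoeff (𝒱 : NonlocalVertexAlgebra V) (b a : V) (n : ℤ) : V :=
  ∑ᶠ k : ℤ, ((-1 : ℂ) ^ k) •
    HVertexOperator.coeff (𝒱.Y (HVertexOperator.coeff (𝒱.Y b) k a)) (n - k) 𝒱.one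

theorem skewCoeff_finite (𝒱 : NonlocalVertexAlgebra V) (b a : V) (n : ℤ) :
    HasFiniteSupport fun k : ℤ => ((-1 : ℂ) ^ k) •
      HVertexOperator.coeff (𝒱.Y (HVertexOperator.coeff (𝒱.Y b) k a)) (n - k) 𝒱.one := by
  obtain ⟨N, hN⟩ := exists_coeff_bound (𝒱.Y b) a
  refine (Set.finite_Icc N n).subset fun k hk => ?_
  have hk := right_ne_zero_of_smul hk
  refine ⟨hN k fun h => hk ?_, ?_⟩
  · rw [h, map_zero, map_zero]
    rfl
  · by_contra h
    exact hk (𝒱.creation _ _ (by lia))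

/-- By `expX_opSeries` the exponential in `x` can be moved inside `Y_W`, so `tauHom` becomes an
operation on vectors of `V` that does not involve `W` or `p`. -/
theorem coeff_tauHom_iterSeries (hp : p ≠ 0) (a b : V) (ℓ : W →ₗ[ℂ] ℂ) (w : W) (n : ℤ) :
    (tauHom p (iterSeries 𝒲 ℓ w (𝒱.Y b) a)).coeff n = opSeries 𝒲 ℓ w (skewCoeff 𝒱 b a n) := by
  rw [coeff_tauHom, tauCoeff, skewCoeff]
  refine Eq.trans ?_ ((opSeries 𝒲 ℓ w).toAddMonoidHom.map_finsum (skewCoeff_finite 𝒱 b a n)).symm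
  refine finsum_congr fun k => ?_
  rw [coeff_iterSeries, expX_opSeries 𝒲 hp, coeff_iterSeries]
  refine Eq.trans ?_ (map_smul (opSeries 𝒲 ℓ w) ((-1 : ℂ) ^ k) _).symm
  rw [← HahnSeries.C_mul_eq_smul, map_zpow₀, map_neg, map_one]

end Scalar

/-! ### Comparing the two expansions of a fraction -/

section Closure

variable {U : Type*} [AddCommGroup U] [Module ℂ U]

theorem IsIter.distMul {c : FDist ℂ} {A : FDist U} (hc : IsIter c) (hA : IsIter A) :
    IsIter (distMul c A) := by
  obtain ⟨⟨N, hN⟩, hc⟩ := hc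
  obtain ⟨⟨M, hM⟩, hA⟩ := hA
  choose lc hlc using hc
  choose lA hlA using hA
  constructor
  · refine ⟨N + M, fun m n h => ?_⟩
    obtain ⟨ab, hab⟩ := exists_term_ne_zero h
    have h1 := hN _ _ (left_ne_zero_of_smul hab)
    have h2 := hM _ _ (right_ne_zero_of_smul hab)
    lia
  · intro m
    obtain ⟨B, hB⟩ := ((Set.finite_Icc N (m - M)).image fun a => lc a + lA (m - a)).bddBelow
    refine ⟨B, fun n h => ?_⟩
    obtain ⟨⟨a, b⟩, hab⟩ := exists_term_ne_zero h
    have h1 := left_ne_zero_of_smul hab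
    have h2 := right_ne_zero_of_smul hab
    have h3 := hN _ _ h1
    have h4 := hM _ _ h2
    have h5 := hlc a h1
    have h6 := hlA (m - a) h2
    dsimp only at h3 h4 h5 h6
    have h7 := hB ⟨a, ⟨h3, by lia⟩, rfl⟩
    dsimp only at h7
    lia

omit [Module ℂ U] in
theorem isIter_zero : IsIter (0 : FDist U) :=
  ⟨⟨0, fun _ _ h => absurd rfl h⟩, fun _ => ⟨0, fun _ h => absurd rfl h⟩⟩

omit [Module ℂ U] in
theorem IsIter.add {A B : FDist U} (hA : IsIter A) (hB : IsIter B) : IsIter (A + B) := by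
  obtain ⟨⟨N, hN⟩, hA⟩ := hA
  obtain ⟨⟨M, hM⟩, hB⟩ := hB
  have key : ∀ m n, (A + B) m n ≠ 0 → A m n ≠ 0 ∨ B m n ≠ 0 := fun m n h => by
    by_contra! h0
    exact h (by simp [h0.1, h0.2])
  constructor
  · refine ⟨min N M, fun m n h => ?_⟩
    rcases key m n h with h | h
    · exact (min_le_left _ _).trans (hN m n h)
    · exact (min_le_right _ _).trans (hM m n h)
  · intro m
    obtain ⟨a, ha⟩ := hA m
    obtain ⟨b, hb⟩ := hB m
    refine ⟨min a b, fun n h => ?_⟩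
    rcases key m n h with h | h
    · exact (min_le_left _ _).trans (ha h)
    · exact (min_le_right _ _).trans (hb h)

omit [Module ℂ U] in
theorem IsIter.sum {ι : Type*} (s : Finset ι) {A : ι → FDist U} (h : ∀ i, IsIter (A i)) :
    IsIter (∑ i ∈ s, A i) :=
  Finset.sum_induction _ IsIter (fun _ _ => IsIter.add) isIter_zero fun i _ => h i

theorem lmap_sum {W : Type*} [AddCommGroup W] [Module ℂ W] {ι : Type*} (ℓ : W →ₗ[ℂ] ℂ)
    (s : Finset ι) (A : ι → FDist W) : lmap ℓ (∑ i ∈ s, A i) = ∑ i ∈ s, lmap ℓ (A i) := by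
  funext m n
  simp [lmap]

theorem iterDist_sum {ι : Type*} (s : Finset ι) (E : ι → 𝕂) :
    iterDist (∑ i ∈ s, E i) = ∑ i ∈ s, iterDist (E i) :=
  map_sum (AddMonoidHom.mk' iterDist iterDist_add) E s

/-- Here `α` and `β` lie in different fields and agree only as distributions, after multiplication
by `s`. Multiplying further by the denominator of `F` gives an element of `ℂ((x₁, x₂))`, for which
both expansions are the same; then `s` is cancelled inside the field of `β`. -/
theorem fracLift_eq_of_dswap_eq {F : Frac₂} {s : Laurent₂} (hs : s ≠ 0) {α β : 𝕂}
    (h1 : fracLift iotaSwapHom_injective F = α)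
    (h2 : dswap (iterDist (iotaSwapHom s * α)) = iterDist (iotaHom s * β)) :
    fracLift iotaHom_injective F = β := by
  have hd := fden_ne_zero F
  have h3 : iotaSwapHom (fden F : Laurent₂) * α = iotaSwapHom (fnum F) := by
    rw [← h1, fracLift_eq]
    exact mul_div_cancel₀ _ ((map_ne_zero_iff _ iotaSwapHom_injective).2 hd)
  have h4 := congrArg (distMul (toDist (fden F : Laurent₂))) h2
  rw [← iterDist_iotaHom, ← iterDist_mul, iterDist_iotaHom] at h4
  have h5 : distMul (toDist (fden F : Laurent₂)) (dswap (iterDist (iotaSwapHom s * α))) =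
      iterDist (iotaHom (s * fnum F)) := by
    change distMul (dswap (dswap (toDist (fden F : Laurent₂)))) _ = _
    rw [← dswap_distMul, ← iterDist_iotaSwapHom, ← iterDist_mul, mul_left_comm, h3, ← map_mul,
      iterDist_iotaSwapHom, iterDist_iotaHom]
    rfl
  rw [h5] at h4
  have h6 := iterDist_injective h4
  rw [mul_left_comm, map_mul] at h6
  have h7 := mul_left_cancel₀ ((map_ne_zero_iff _ iotaHom_injective).2 hs) h6
  rw [eq_fnum_div_fden F]
  exact fracLift_div _ hd h7.symm

end Closure

/-! ### A nonlocal vertex algebra as a module over itself, with `φ = x + z` -/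

section Adjoint

theorem phi_one : phi 1 = HahnSeries.C (HahnSeries.single 1 1) + HahnSeries.single 1 1 := by
  refine HahnSeries.ext (funext fun k => ?_)
  rw [HahnSeries.coeff_add, HahnSeries.C_apply]
  rcases lt_or_ge k 0 with h | h
  · rw [phi, coeff_expX_of_neg _ _ h, HahnSeries.coeff_single_of_ne (by lia),
      HahnSeries.coeff_single_of_ne (by lia), add_zero]
  lift k to ℕ using h
  match k with
  | 0 => simp [coeff_phi_zero]
  | 1 => simp [coeff_phi_one]
  | k + 2 =>
    rw [phi, coeff_expX, iterate_succ_apply, iterate_succ_apply, pD_X, (isLeibniz_pD 1).map_one,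
      HahnSeries.coeff_single_of_ne (by lia), HahnSeries.coeff_single_of_ne (by lia),
      iterate_map_zero, smul_zero, add_zero]

theorem phiHom_one_sub : phiHom 1 (X₁ - X₂) = HahnSeries.single 1 1 := by
  rw [map_sub, phiHom_X₁, phiHom_X₂, phi_one, add_sub_cancel_left]

theorem phiHom_one_subPow (k : ℕ) : phiHom 1 (subPow k) = HahnSeries.single (k : ℤ) 1 := by
  rw [subPow, map_pow, phiHom_one_sub, HahnSeries.single_pow, one_pow, nsmul_one]

theorem subPow_ne_zero (k : ℕ) : subPow k ≠ 0 := by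
  refine pow_ne_zero k fun h => ?_
  have h1 := congrArg (fun a => HahnSeries.coeff a (1, 0)) h
  simp at h1

theorem distMul_single {U : Type*} [AddCommGroup U] [Module ℂ U] (k : ℤ) (A : FDist U) :
    distMul (iterDist (HahnSeries.single k 1)) A = fun n l => A (n - k) l := by
  funext n l
  rw [distMul, finsum_eq_single _ (k, 0)]
  · simp [iterDist, HahnSeries.coeff_one]
  · rintro ⟨a, b⟩ hab
    by_cases ha : a = k
    · have hb : b ≠ 0 := fun hb => hab (by rw [ha, hb])
      simp [iterDist, ha, HahnSeries.coeff_one, hb]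
    · simp [iterDist, HahnSeries.coeff_single_of_ne ha]

/-- A nonlocal vertex algebra as a `φ`-coordinated quasi module over itself, for `p = 1`. -/
def adjointModule {V : Type*} [AddCommGroup V] [Module ℂ V] (𝒱 : NonlocalVertexAlgebra V) :
    PhiQuasiModule 1 𝒱 V where
  Y := 𝒱.Y
  one_left := 𝒱.one_left
  assoc u v := by
    obtain ⟨k, hk⟩ := 𝒱.assoc u v
    refine ⟨subPow k, subPow_ne_zero k, fun w => ⟨(hk w).1, (hk w).2.trans ?_⟩⟩
    rw [← iterDist_phiSubst, phiSubst_eq, phiHom_one_subPow, distMul_single]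

end Adjoint

/-! ### The series `f(-x₂ + x₁)` as the expansion of a fraction -/

section ExpandNeg

/-- Pascal's rule for binomial coefficients with an arbitrary integer on top, the sign being
absorbed by `(-1) ^ b`. -/
theorem expandNeg_single_mul (f : LaurentSeries ℂ) (a b : ℤ) :
    expandNeg (HahnSeries.single 1 1 * f) a b =
      expandNeg f (a - 1) b - expandNeg f a (b - 1) := by
  simp only [expandNeg, HahnSeries.coeff_single_mul, one_mul]
  have hs : (-1 : ℂ) ^ (b - 1) = -(-1) ^ b := by
    rw [zpow_sub_one₀ (by norm_num)]
    ring
  rw [show a + (b - 1) = a + b - 1 by ring, show a - 1 + b = a + b - 1 by ring, hs]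
  rcases lt_trichotomy a 0 with h | rfl | h
  · rw [if_neg (by lia), if_neg (by lia), if_neg (by lia), sub_zero]
  · simp
  · rw [if_pos h.le, if_pos (by lia), if_pos h.le]
    obtain ⟨k, rfl⟩ : ∃ k : ℕ, a = k + 1 := ⟨(a - 1).toNat, by lia⟩
    rw [show ((k : ℤ) + 1).toNat = k + 1 by lia, show ((k : ℤ) + 1 - 1).toNat = k by lia,
      show (k : ℤ) + 1 + b = (k + b) + 1 by ring, show (k : ℤ) + b + 1 - 1 = k + b by ring,
      Ring.choose_succ_succ]
    push_cast
    ring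

theorem isIter_expandNeg (f : LaurentSeries ℂ) : IsIter (expandNeg f) := by
  obtain ⟨N, hN⟩ := exists_lower_bound f
  have key : ∀ a b, expandNeg f a b ≠ 0 → 0 ≤ a ∧ N ≤ a + b := by
    intro a b h
    rw [expandNeg] at h
    split_ifs at h with ha
    · exact ⟨ha, hN _ (left_ne_zero_of_mul (left_ne_zero_of_mul h))⟩
    · exact absurd rfl h
  refine ⟨⟨0, fun a b h => (key a b h).1⟩, fun a => ⟨N - a, fun b h => ?_⟩⟩
  have := (key a b h).2
  lia

/-- The series `f(-x₂ + x₁)`. -/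
def expandNegIter (f : LaurentSeries ℂ) : 𝕂 := toIter (expandNeg f) (isIter_expandNeg f)

theorem iotaHom_X₁ : iotaHom X₁ = HahnSeries.single 1 1 := by
  apply iterDist_injective
  rw [iterDist_iotaHom]
  funext m n
  simp only [toDist, iterDist, HahnSeries.coeff_single, Prod.mk.injEq]
  by_cases h : m = 1 <;> simp [h, HahnSeries.coeff_one]

theorem iotaHom_embSnd (g : LaurentSeries ℂ) : iotaHom (embSnd g) = HahnSeries.C g := by
  apply iterDist_injective
  rw [iterDist_iotaHom]
  funext m n
  simp only [embSnd, toDist_ofDist, inSnd, iterDist, HahnSeries.C_apply, HahnSeries.coeff_single]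
  by_cases h : m = 0 <;> simp [h]

theorem iotaHom_X₂ : iotaHom X₂ = HahnSeries.C (HahnSeries.single 1 1) := by
  rw [X₂, ← embSnd_single, iotaHom_embSnd]

theorem iotaHom_sub_mul_expandNegIter (f : LaurentSeries ℂ) :
    iotaHom (X₁ - X₂) * expandNegIter f = expandNegIter (HahnSeries.single 1 1 * f) := by
  apply iterDist_injective
  rw [expandNegIter, expandNegIter, iterDist_toIter]
  funext m n
  rw [expandNeg_single_mul, map_sub, iotaHom_X₁, iotaHom_X₂, iterDist, sub_mul,
    HahnSeries.C_apply, HahnSeries.coeff_sub, HahnSeries.coeff_single_mul,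
    HahnSeries.coeff_single_mul, one_mul, HahnSeries.coeff_sub, HahnSeries.coeff_single_mul,
    one_mul, sub_zero]
  rfl

theorem iotaHom_subPow_mul_expandNegIter (f : LaurentSeries ℂ) (n : ℕ) :
    iotaHom (subPow n) * expandNegIter f = expandNegIter (HahnSeries.single (n : ℤ) 1 * f) := by
  induction n with
  | zero => simp [subPow]
  | succ n ih =>
    rw [show subPow (n + 1) = (X₁ - X₂) * subPow n from pow_succ' _ _, map_mul, mul_assoc, ih,
      iotaHom_sub_mul_expandNegIter, ← mul_assoc, HahnSeries.single_mul_single, mul_one,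
      show (1 : ℤ) + n = ((n + 1 : ℕ) : ℤ) by push_cast; ring]

/-- For a natural number `a + b` the binomial coefficient vanishes when `a` exceeds it, which
excludes `b < 0`. -/
theorem isLaurent₂_expandNeg {h : LaurentSeries ℂ} (hh : ∀ m, h.coeff m ≠ 0 → 0 ≤ m) :
    IsLaurent₂ (expandNeg h) := by
  refine ⟨0, fun a b hab => ?_⟩
  rw [expandNeg] at hab
  split_ifs at hab with ha
  · refine ⟨ha, ?_⟩
    have h1 := hh _ (left_ne_zero_of_mul (left_ne_zero_of_mul hab))
    by_contra hb
    refine hab ?_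
    obtain ⟨k, hk⟩ : ∃ k : ℕ, a + b = k := ⟨(a + b).toNat, by lia⟩
    rw [hk, Ring.choose_natCast, Nat.choose_eq_zero_of_lt (by lia)]
    simp
  · exact absurd rfl hab

/-- The element `h(x₁ - x₂)` for a power series `h`. -/
def subSeries (h : LaurentSeries ℂ) (hh : ∀ m, h.coeff m ≠ 0 → 0 ≤ m) : Laurent₂ :=
  ofDist (expandNeg h) (isLaurent₂_expandNeg hh)

/-- Write `h = z h' + h(0)`. As `x₁ - x₂` is sent to `z`, the coefficient of `z ^ (k + 1)` for `h`
is that of `z ^ k` for `h'`. -/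
theorem coeff_phiHom_subSeries (k : ℕ) (h : LaurentSeries ℂ) (hh : ∀ m, h.coeff m ≠ 0 → 0 ≤ m) :
    (phiHom 1 (subSeries h hh)).coeff k = HahnSeries.C (h.coeff k) := by
  let h' : LaurentSeries ℂ := HahnSeries.single (-1) 1 * (h - HahnSeries.C (h.coeff 0))
  have hc : ∀ m, h'.coeff m = if m + 1 = 0 then 0 else h.coeff (m + 1) := fun m => by
    rw [HahnSeries.coeff_single_mul, one_mul, sub_neg_eq_add, HahnSeries.coeff_sub,
      HahnSeries.C_apply, HahnSeries.coeff_single]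
    split_ifs with h0 <;> simp [h0]
  have hh' : ∀ m, h'.coeff m ≠ 0 → 0 ≤ m := fun m hm => by
    rw [hc] at hm
    split_ifs at hm with h0
    · exact absurd rfl hm
    · have := hh _ hm
      lia
  have hdec : h = HahnSeries.single 1 1 * h' + HahnSeries.C (h.coeff 0) := by
    rw [← mul_assoc, HahnSeries.single_mul_single]
    simp
  have e : subSeries h hh =
      (X₁ - X₂) * subSeries h' hh' + embSnd (HahnSeries.C (h.coeff 0)) := by
    ext ⟨a, b⟩
    rw [HahnSeries.coeff_add, coeff_sub_mul]
    change expandNeg h a b = expandNeg h' (a - 1) b - expandNeg h' a (b - 1) + _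
    rw [← expandNeg_single_mul]
    conv_lhs => rw [hdec]
    simp only [expandNeg, HahnSeries.coeff_add, embSnd, ofDist, inSnd, HahnSeries.C_apply,
      HahnSeries.coeff_single]
    by_cases ha : 0 ≤ a
    · by_cases ha0 : a = 0
      · subst ha0
        by_cases hb : b = 0 <;> simp [hb]
      · by_cases hab : a + b = 0
        · have : Ring.choose (0 : ℤ) a.toNat = 0 := by
            have := Ring.choose_natCast (R := ℤ) 0 a.toNat
            rw [Nat.choose_eq_zero_of_lt (by lia)] at this
            simpa using this
          simp [ha, ha0, hab, this]
        · simp [ha, ha0, hab]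
    · have ha0 : a ≠ 0 := by lia
      simp [ha, ha0]
  rw [e, map_add, map_mul, phiHom_one_sub, phiHom_embSnd, HahnSeries.coeff_add,
    HahnSeries.coeff_single_mul, one_mul]
  cases k with
  | zero =>
    rw [coeff_phiHom_of_neg _ _ (by simp)]
    simp
  | succ k =>
    have ih := coeff_phiHom_subSeries k h' hh'
    rw [show ((k + 1 : ℕ) : ℤ) - 1 = k by push_cast; ring, ih, hc, if_neg (by lia),
      HahnSeries.C_apply (HahnSeries.C (h.coeff 0)), HahnSeries.coeff_single_of_ne (by lia), add_zero]
    rfl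

theorem coeff_constInX (f : LaurentSeries ℂ) (k : ℤ) :
    (constInX f).coeff k = HahnSeries.C (f.coeff k) := rfl

theorem phiHom_subSeries (h : LaurentSeries ℂ) (hh : ∀ m, h.coeff m ≠ 0 → 0 ≤ m) :
    phiHom 1 (subSeries h hh) = constInX h := by
  refine HahnSeries.ext (funext fun k => ?_)
  rw [coeff_constInX]
  rcases lt_or_ge k 0 with hk | hk
  · rw [coeff_phiHom_of_neg _ _ hk]
    have : h.coeff k = 0 := by
      by_contra h0
      exact absurd (hh k h0) (by lia)
    rw [this, map_zero]
  · lift k to ℕ using hk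
    exact coeff_phiHom_subSeries k h hh

/-- A power of `x₁ - x₂` clears the pole of `f` and leaves a power series in `x₁ - x₂`, which lies
in `ℂ((x₁, x₂))`. -/
theorem exists_frac_expandNeg (h1 : (1 : LaurentSeries ℂ) ≠ 0) (f : LaurentSeries ℂ) :
    ∃ F : Frac₂, fracLift iotaHom_injective F = expandNegIter f ∧
      fracLift (phiHom_injective h1) F = constInX f := by
  obtain ⟨N, hN⟩ := exists_lower_bound f
  let n : ℕ := (-N).toNat
  have hh : ∀ m, (HahnSeries.single (n : ℤ) 1 * f).coeff m ≠ 0 → 0 ≤ m := fun m hm => by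
    rw [HahnSeries.coeff_single_mul, one_mul] at hm
    have := hN _ hm
    lia
  refine ⟨_, fracLift_div (a := subSeries _ hh) _ (subPow_ne_zero n) ?_,
    fracLift_div _ (subPow_ne_zero n) ?_⟩
  · rw [iotaHom_subPow_mul_expandNegIter]
    apply iterDist_injective
    rw [iterDist_iotaHom, expandNegIter, iterDist_toIter]
    rfl
  · rw [phiHom_one_subPow, phiHom_subSeries]
    refine HahnSeries.ext (funext fun k => ?_)
    rw [HahnSeries.coeff_single_mul, one_mul, coeff_constInX, coeff_constInX,
      HahnSeries.coeff_single_mul, one_mul]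

end ExpandNeg

/-! ### Locality on `V` implies skew symmetry -/

section SkewSymmetry

variable {V W : Type*} [AddCommGroup V] [Module ℂ V] [AddCommGroup W] [Module ℂ W]

theorem exists_skewCoeff_bound (𝒱 : NonlocalVertexAlgebra V) (b a : V) :
    ∃ N : ℤ, ∀ n, skewCoeff 𝒱 b a n ≠ 0 → N ≤ n := by
  obtain ⟨N, hN⟩ := exists_coeff_bound (𝒱.Y b) a
  refine ⟨N, fun n hn => ?_⟩
  obtain ⟨k, hk⟩ := exists_term_ne_zero hn
  have hk := right_ne_zero_of_smul hk
  have h1 := hN k fun h => hk <| by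
    rw [h, map_zero, map_zero]
    rfl
  by_contra h
  exact hk (𝒱.creation _ _ (by lia))

theorem skewConv_finite (𝒱 : NonlocalVertexAlgebra V) (b a : V) (f : LaurentSeries ℂ) (n : ℤ) :
    HasFiniteSupport fun j : ℤ => f.coeff j • skewCoeff 𝒱 b a (n - j) := by
  obtain ⟨N, hN⟩ := exists_lower_bound f
  obtain ⟨M, hM⟩ := exists_skewCoeff_bound 𝒱 b a
  refine (Set.finite_Icc N (n - M)).subset fun j hj => ⟨hN j (left_ne_zero_of_smul hj), ?_⟩
  have := hM _ (right_ne_zero_of_smul hj)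
  lia

variable {p : LaurentSeries ℂ} {𝒱 : NonlocalVertexAlgebra V} (𝒲 : PhiQuasiModule p 𝒱 W)

theorem coeff_constInX_mul_tauHom (hp : p ≠ 0) (f : LaurentSeries ℂ) (a b : V) (ℓ : W →ₗ[ℂ] ℂ)
    (w : W) (n : ℤ) :
    (constInX f * tauHom p (iterSeries 𝒲 ℓ w (𝒱.Y b) a)).coeff n =
      opSeries 𝒲 ℓ w (∑ᶠ j : ℤ, f.coeff j • skewCoeff 𝒱 b a (n - j)) := by
  rw [coeff_mul_eq_finsum]
  refine Eq.trans ?_ ((opSeries 𝒲 ℓ w).toAddMonoidHom.map_finsum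
    (skewConv_finite 𝒱 b a f n)).symm
  refine finsum_congr fun j => ?_
  rw [coeff_constInX, coeff_tauHom_iterSeries 𝒲 hp, HahnSeries.C_mul_eq_smul]
  exact (map_smul (opSeries 𝒲 ℓ w) _ _).symm

theorem coeff_sum_constInX_mul_tauHom (hp : p ≠ 0) {r : ℕ} (f : Fin r → LaurentSeries ℂ)
    (a b : Fin r → V) (ℓ : W →ₗ[ℂ] ℂ) (w : W) (n : ℤ) :
    (∑ i, constInX (f i) * tauHom p (iterSeries 𝒲 ℓ w (𝒱.Y (b i)) (a i))).coeff n =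
      opSeries 𝒲 ℓ w (∑ i, ∑ᶠ j : ℤ, (f i).coeff j • skewCoeff 𝒱 (b i) (a i) (n - j)) := by
  rw [map_sum, HahnSeries.coeff_sum]
  exact Finset.sum_congr rfl fun i _ => coeff_constInX_mul_tauHom 𝒲 hp _ _ _ _ _ _

/-- Locality identifies the opposite expansion of the fraction of `Y(u, x₁)Y(v, x₂)`. Injectivity of
that expansion gives an identity of fractions, and the substitution `x₁ = x₂ + z` translates it into
one about iterates. -/
theorem coeff_eq_sum_skewCoeff (𝒱 : NonlocalVertexAlgebra V)
    (u v : V) (r : ℕ) (u' v' : Fin r → V) (f : Fin r → LaurentSeries ℂ) (k : ℕ)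
    (hloc : ∀ w : V,
      distMul (toDist (subPow k)) (prod₁₂ (𝒱.Y u) (𝒱.Y v) w) =
        distMul (toDist (subPow k))
          (∑ i, distMul (expandNeg (f i)) (prod₂₁ (𝒱.Y (v' i)) (𝒱.Y (u' i)) w))) (n : ℤ) :
    HVertexOperator.coeff (𝒱.Y u) n v =
      ∑ i, ∑ᶠ j : ℤ, (f i).coeff j • skewCoeff 𝒱 (v' i) (u' i) (n - j) := by
  rw [← sub_eq_zero, ← Module.forall_dual_apply_eq_zero_iff ℂ]
  intro ℓ
  have h1 : (1 : LaurentSeries ℂ) ≠ 0 := one_ne_zero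
  have hS := congrArg (lmap ℓ) (hloc 𝒱.one)
  rw [lmap_distMul_prod₁₂, lmap_distMul ℓ (isLaurent₂_toDist _).isIter (IsIter.sum _ fun i =>
    (isIter_expandNeg (f i)).distMul (isIter_prod₂₁ _ _ _)), lmap_sum] at hS
  simp only [lmap_distMul ℓ (isIter_expandNeg _) (isIter_prod₂₁ _ _ _)] at hS
  have e : ∀ i, distMul (expandNeg (f i)) (lmap ℓ (prod₂₁ (𝒱.Y (v' i)) (𝒱.Y (u' i)) 𝒱.one)) =
      iterDist (expandNegIter (f i) * opProd ℓ (𝒱.Y (v' i)) (𝒱.Y (u' i)) 𝒱.one) := fun i => by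
    rw [iterDist_mul, iterDist_opProd, expandNegIter, iterDist_toIter]
  simp only [e] at hS
  rw [← iterDist_sum, ← iterDist_iotaHom, ← iterDist_mul] at hS
  obtain ⟨F, hF1, hF2⟩ := exists_frac (adjointModule 𝒱) h1 u v ℓ 𝒱.one
  choose E hE1 hE2 using fun i => exists_frac_expandNeg h1 (f i)
  choose B hB1 hB2 using fun i =>
    exists_frac_flip (adjointModule 𝒱) h1 (u' i) (v' i) ℓ 𝒱.one
  have h2 := fracLift_eq_of_dswap_eq (subPow_ne_zero k) hF1 hS
  have h3 : F = ∑ i, E i * B i := by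
    apply fracLift_injective iotaHom_injective
    rw [h2, map_sum]
    refine Finset.sum_congr rfl fun i _ => ?_
    rw [map_mul, hE1, hB1]
    rfl
  have h4 : iterSeries (adjointModule 𝒱) ℓ 𝒱.one (𝒱.Y u) v = ∑ i, constInX (f i) *
      tauHom 1 (iterSeries (adjointModule 𝒱) ℓ 𝒱.one (𝒱.Y (v' i)) (u' i)) := by
    rw [← hF2, h3, map_sum]
    refine Finset.sum_congr rfl fun i _ => ?_
    rw [map_mul, hE2, hB2]
  -- Acting on the vacuum and taking the coefficient of `x⁰` recovers the vector itself by the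
  -- creation property.
  have h5 := congrArg (fun T => (HahnSeries.coeff T n).coeff 0) h4
  rw [coeff_iterSeries, coeff_sum_constInX_mul_tauHom (adjointModule 𝒱) h1, coeff_opSeries,
    coeff_opSeries] at h5
  have h6 : ∀ x : V, HVertexOperator.coeff ((adjointModule 𝒱).Y x) 0 𝒱.one = x := 𝒱.creation_zero
  rw [h6, h6] at h5
  rw [map_sub, h5, sub_self]

end SkewSymmetry

/-! ### The opposite expansion on `W`, and rescaling of the first variable -/

section Rational

variable {G V W : Type*} [Group G] [AddCommGroup V] [Module ℂ V] [AddCommGroup W] [Module ℂ W]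
variable {p : LaurentSeries ℂ} {𝒱 : NonlocalVertexAlgebra V} (𝒲 : PhiQuasiModule p 𝒱 W)

/-- Skew symmetry is an identity in `V`, so it holds under `Y_W`. It is read after `x₁ = φ(x, z)`,
where `f̂_i` becomes `f_i(z)`; injectivity lifts it to fractions, which are then expanded the other
way. -/
theorem fracLift_iotaHom_eq (hp : p ≠ 0) (u v : V) (r : ℕ) (u' v' : Fin r → V)
    (f : Fin r → LaurentSeries ℂ) (hf : ∀ i, f i ∈ CPhi p)
    (hskew : ∀ n, HVertexOperator.coeff (𝒱.Y u) n v =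
      ∑ i, ∑ᶠ j : ℤ, (f i).coeff j • skewCoeff 𝒱 (v' i) (u' i) (n - j))
    (ℓ : W →ₗ[ℂ] ℂ) (w : W) {F : Frac₂}
    (hF : fracLift (phiHom_injective hp) F = iterSeries 𝒲 ℓ w (𝒱.Y u) v) :
    fracLift iotaHom_injective F =
      ∑ i, fracIota₂₁ (hat p (f i)) * opProd ℓ (𝒲.Y (v' i)) (𝒲.Y (u' i)) w := by
  choose B hB1 hB2 using fun i => exists_frac_flip 𝒲 hp (u' i) (v' i) ℓ w
  have h3 : F = ∑ i, hat p (f i) * B i := by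
    apply fracLift_injective (phiHom_injective hp)
    rw [hF, map_sum]
    refine HahnSeries.ext (funext fun n => ?_)
    rw [coeff_iterSeries, hskew, ← coeff_sum_constInX_mul_tauHom 𝒲 hp]
    congr 1
    refine Finset.sum_congr rfl fun i _ => ?_
    rw [map_mul, hB2, ← phiEval_eq hp, phiEval_hat (hf i)]
  rw [h3, map_sum]
  refine Finset.sum_congr rfl fun i _ => ?_
  rw [map_mul, hB1, fracIota₂₁_eq]

/-- The substitution `y₁ ↦ c y₁` in a distribution. -/
def scaleDist (c : ℂˣ) (A : FDist ℂ) : FDist ℂ := fun m n => (c : ℂ) ^ m * A m n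

theorem scaleDist_distMul (c : ℂˣ) (A B : FDist ℂ) :
    scaleDist c (distMul A B) = distMul (scaleDist c A) (scaleDist c B) := by
  funext m n
  simp only [scaleDist, distMul, smul_eq_mul]
  rw [mul_finsum]
  refine finsum_congr fun ab => ?_
  have : (c : ℂ) ^ m = (c : ℂ) ^ ab.1 * (c : ℂ) ^ (m - ab.1) := by
    rw [← zpow_add₀ c.ne_zero, add_sub_cancel]
  rw [this]
  ring

theorem toDist_scaleHom (c : ℂˣ) (a : Laurent₂) :
    toDist (scaleHom c a) = scaleDist c (toDist a) := rfl

/-- By equivariance the fraction attached to `R g u` and `v` is `F(χ_φ(g)⁻¹ x₁, x₂)`. The modes of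
`R g u` thus govern the behaviour of `F` near `x₁ = χ_φ(g)⁻¹ x₂`. -/
theorem fracLift_sigma_eq (hp : p ≠ 0) {χφ : G →* ℂˣ} {R : Representation ℂ G V}
    (hW : IsEquivariant 𝒲 χφ R) (u v : V) (ℓ : W →ₗ[ℂ] ℂ) (w : W) (g : G) {F : Frac₂}
    (hF : fracLift iotaSwapHom_injective F = opProd ℓ (𝒲.Y u) (𝒲.Y v) w) :
    fracLift (sigma_injective hp (χφ g)⁻¹) F = iterSeries 𝒲 ℓ w (𝒱.Y (R g u)) v := by
  obtain ⟨F', h1, h2⟩ := exists_frac 𝒲 hp (R g u) v ℓ w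
  have hd := fden_ne_zero F
  have hd' : scaleHom (χφ g)⁻¹ (fden F : Laurent₂) ≠ 0 :=
    (map_ne_zero_iff _ (scaleHom_injective _)).2 hd
  have hF3 : iotaSwapHom (fden F : Laurent₂) * opProd ℓ (𝒲.Y u) (𝒲.Y v) w =
      iotaSwapHom (fnum F) := by
    rw [← hF, fracLift_eq]
    exact mul_div_cancel₀ _ ((map_ne_zero_iff _ iotaSwapHom_injective).2 hd)
  have h3 : F' = algebraMap Laurent₂ Frac₂ (scaleHom (χφ g)⁻¹ (fnum F)) /
      algebraMap Laurent₂ Frac₂ (scaleHom (χφ g)⁻¹ (fden F : Laurent₂)) := by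
    apply fracLift_injective iotaSwapHom_injective
    rw [h1]
    refine (fracLift_div _ hd' ?_).symm
    apply iterDist_injective
    have e : iterDist (opProd ℓ (𝒲.Y (R g u)) (𝒲.Y v) w) =
        dswap (scaleDist (χφ g)⁻¹ (dswap (iterDist (opProd ℓ (𝒲.Y u) (𝒲.Y v) w)))) := by
      rw [iterDist_opProd, iterDist_opProd]
      funext m n
      simp only [lmap, prod₂₁, dswap, scaleDist]
      rw [hW.equivariant, map_smul, smul_eq_mul, Units.val_inv_eq_inv_val]
    rw [iterDist_mul, e, iterDist_iotaSwapHom, toDist_scaleHom, ← dswap_distMul,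
      ← scaleDist_distMul, iterDist_iotaSwapHom, toDist_scaleHom]
    congr 2
    have h4 := congrArg (fun T => dswap (iterDist T)) hF3
    rwa [iterDist_mul, iterDist_iotaSwapHom, dswap_distMul, iterDist_iotaSwapHom] at h4
  rw [← h2, h3, map_div₀, fracLift_algebraMap, fracLift_algebraMap, fracLift_eq]
  rfl

end Rational

/-! ### Orders of Laurent series -/

section Order

variable {K : Type*} [Field K]

theorem order_inv_eq (x : LaurentSeries K) : (x⁻¹).order = -x.order := by
  by_cases hx : x = 0
  · simp [hx]
  · have h := HahnSeries.order_mul hx (inv_ne_zero hx)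
    rw [mul_inv_cancel₀ hx, HahnSeries.order_one] at h
    lia

theorem order_nonneg_mul {x y : LaurentSeries K} (hx : 0 ≤ x.order) (hy : 0 ≤ y.order) :
    0 ≤ (x * y).order := by
  by_cases h : x = 0
  · simp [h]
  by_cases h' : y = 0
  · simp [h']
  rw [HahnSeries.order_mul h h']
  lia

theorem le_order_of_coeff {x : LaurentSeries K} {N : ℤ} (hx : x ≠ 0)
    (h : ∀ n, n < N → x.coeff n = 0) : N ≤ x.order := by
  by_contra! h1
  exact hx (HahnSeries.coeff_order_eq_zero.1 (h _ h1))

theorem order_nonneg_of_coeff {x : LaurentSeries K} (h : ∀ n, n < 0 → x.coeff n = 0) :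
    0 ≤ x.order := by
  by_cases hx : x = 0
  · simp [hx]
  · exact le_order_of_coeff hx h

theorem order_C (a : K) : (HahnSeries.C a : LaurentSeries K).order = 0 := HahnSeries.order_C

end Order

/-! ### Residues of `y' / y` and of higher inverse powers -/

section LogDerivative

variable {K : Type*} [Field K]

/-- The weight operator is `z d/dz`, so the `z⁰` coefficient is the residue of `y' / y`. At order
one, `z y'` and `y` have the same leading term. -/
theorem coeff_zero_inv_mul_weightDeriv {y : LaurentSeries K} (hy : y.order = 1) :
    (y⁻¹ * weightDeriv (Int.castAddHom K) y).coeff 0 = 1 := by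
  have hy0 : y ≠ 0 := by
    rintro rfl
    simp at hy
  set d := weightDeriv (Int.castAddHom K) y with hd
  have h1 : d.coeff 1 = y.coeff 1 := by simp [hd]
  have h2 : y.coeff 1 ≠ 0 := by
    rw [← hy]
    exact mt HahnSeries.coeff_order_eq_zero.1 hy0
  have hd0 : d ≠ 0 := fun h => h2 (by rw [← h1, h]; rfl)
  have hdo : d.order = 1 := by
    refine le_antisymm (HahnSeries.order_le_of_coeff_ne_zero (by rwa [h1])) ?_
    refine le_order_of_coeff hd0 fun n hn => ?_
    rw [hd, coeff_weightDeriv, HahnSeries.coeff_eq_zero_of_lt_order (by lia), mul_zero]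
  have h3 := HahnSeries.coeff_mul_order_add_order y⁻¹ y
  have h4 := HahnSeries.coeff_mul_order_add_order y⁻¹ d
  rw [order_inv_eq, hy, inv_mul_cancel₀ hy0] at h3
  rw [order_inv_eq, hy, hdo] at h4
  rw [neg_add_cancel] at h3 h4
  rw [HahnSeries.coeff_one, if_pos rfl] at h3
  rw [h4, h3, HahnSeries.leadingCoeff_eq (x := d), HahnSeries.leadingCoeff_eq (x := y), hdo, hy, h1]

theorem weightDeriv_one' : weightDeriv (Int.castAddHom K) (1 : LaurentSeries K) = 0 := by
  ext n
  by_cases h : n = 0 <;> simp [HahnSeries.coeff_one, h]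

theorem weightDeriv_pow_succ (z : LaurentSeries K) (n : ℕ) :
    weightDeriv (Int.castAddHom K) (z ^ (n + 1)) =
      ((n + 1 : ℕ) : LaurentSeries K) * (z ^ n * weightDeriv (Int.castAddHom K) z) := by
  induction n with
  | zero => simp
  | succ n ih =>
    rw [pow_succ z (n + 1), weightDeriv_mul, ih]
    push_cast
    ring

theorem weightDeriv_inv' {y : LaurentSeries K} (hy : y ≠ 0) :
    weightDeriv (Int.castAddHom K) y⁻¹ = -((y⁻¹) ^ 2 * weightDeriv (Int.castAddHom K) y) := by
  have h := weightDeriv_mul (Int.castAddHom K) y y⁻¹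
  rw [mul_inv_cancel₀ hy, weightDeriv_one'] at h
  have h1 : y * y⁻¹ = 1 := mul_inv_cancel₀ hy
  linear_combination -(y⁻¹) * h - weightDeriv (Int.castAddHom K) y⁻¹ * h1

/-- Up to the factor `-(n + 1)` this series is `z d/dz` of `y⁻¹ ^ (n + 1)`, and an exact form has no
residue. -/
theorem coeff_zero_inv_pow_mul_weightDeriv [CharZero K] {y : LaurentSeries K} (hy : y ≠ 0) (n : ℕ) :
    ((y⁻¹) ^ (n + 2) * weightDeriv (Int.castAddHom K) y).coeff 0 = 0 := by
  have h := weightDeriv_pow_succ y⁻¹ n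
  rw [weightDeriv_inv' hy] at h
  have h1 := congrArg (fun x => HahnSeries.coeff x 0) h
  have e : (y⁻¹) ^ n * -((y⁻¹) ^ 2 * weightDeriv (Int.castAddHom K) y) =
      -((y⁻¹) ^ (n + 2) * weightDeriv (Int.castAddHom K) y) := by ring
  have e2 : ((n + 1 : ℕ) : LaurentSeries K) = HahnSeries.C ((n + 1 : ℕ) : K) := by
    rw [map_natCast]
  simp only [coeff_weightDeriv, e, e2, HahnSeries.C_mul_eq_smul, HahnSeries.coeff_smul,
    HahnSeries.coeff_neg, smul_eq_mul, map_zero, zero_mul] at h1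
  have h2 : ((n + 1 : ℕ) : K) ≠ 0 := Nat.cast_ne_zero.2 (by lia)
  rcases mul_eq_zero.1 h1.symm with h3 | h3
  · exact absurd h3 h2
  · exact neg_eq_zero.1 h3

end LogDerivative

/-! ### The denominators `x₁ / x₂ - c` and their orders of vanishing -/

section Denominators

/-- `x₁ / x₂ - c`. -/
def ratioSub (c : ℂˣ) : Laurent₂ :=
  HahnSeries.single ((1, -1) : ℤ × ℤ) (1 : ℂ) - HahnSeries.single (0 : ℤ × ℤ) (c : ℂ)

theorem ratioSub_sub (c c' : ℂˣ) :
    ratioSub c - ratioSub c' = embSnd (HahnSeries.C ((c' : ℂ) - c)) := by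
  rw [HahnSeries.C_apply, embSnd_single, ratioSub, ratioSub, ← Prod.zero_eq_mk,
    sub_sub_sub_cancel_left, HahnSeries.single_sub]

theorem ratioSub_ne_zero (c : ℂˣ) : ratioSub c ≠ 0 := by
  intro h
  have := congrArg (fun x => HahnSeries.coeff x ((1, -1) : ℤ × ℤ)) h
  simp [ratioSub] at this

theorem ratioSub_eq (c : ℂˣ) :
    ratioSub c = embFst (HahnSeries.single 1 1) * embSnd (HahnSeries.single (-1) 1) -
      embSnd (HahnSeries.C (c : ℂ)) := by
  rw [HahnSeries.C_apply, embSnd_single, embFst_single, embSnd_single, HahnSeries.single_mul_single,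
    ratioSub, ← Prod.zero_eq_mk]
  simp

theorem scaleHom_ratioSub (c : ℂˣ) :
    scaleHom c (ratioSub c) = HahnSeries.single ((0, -1) : ℤ × ℤ) (c : ℂ) * (X₁ - X₂) := by
  rw [mul_sub, HahnSeries.single_mul_single, HahnSeries.single_mul_single, ratioSub]
  ext ⟨m, n⟩
  simp only [coeff_scaleHom, HahnSeries.coeff_sub, HahnSeries.coeff_single, Prod.mk_add_mk,
    Prod.mk.injEq, Prod.mk_eq_zero]
  by_cases h1 : m = 1
  · simp [h1]
  · by_cases h0 : m = 0 <;> simp [h1, h0]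

theorem scaleHom_embSnd (c : ℂˣ) (w : LaurentSeries ℂ) : scaleHom c (embSnd w) = embSnd w := by
  ext ⟨m, n⟩
  simp only [coeff_scaleHom, embSnd, ofDist, inSnd]
  by_cases h : m = 0 <;> simp [h]

theorem scaleHom_scaleHom_inv (c : ℂˣ) (a : Laurent₂) : scaleHom c (scaleHom c⁻¹ a) = a := by
  ext g
  simp [zpow_ne_zero]

/-- Division with remainder: `w(x₂) = a(c x₂, x₂)` is the remainder, and after rescaling `x₁` the
difference vanishes on the diagonal, hence is divisible by `x₁ - x₂`. -/
theorem exists_eq_embSnd_add (c : ℂˣ) (a : Laurent₂) :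
    ∃ w b, a = embSnd w + ratioSub c * b := by
  let w := diagHom (scaleHom c a)
  have h : diagHom (scaleHom c a - embSnd w) = 0 := by
    rw [map_sub, diagHom_embSnd, sub_self]
  obtain ⟨N, hN⟩ := exists_bddBy (scaleHom c a - embSnd w)
  obtain ⟨b, hb, -⟩ := exists_eq_sub_mul h hN
  refine ⟨w, scaleHom c⁻¹ (HahnSeries.single ((0, 1) : ℤ × ℤ) ((c : ℂ)⁻¹) * b), ?_⟩
  apply scaleHom_injective c
  rw [map_add, map_mul, scaleHom_embSnd, scaleHom_ratioSub, scaleHom_scaleHom_inv,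
    eq_add_of_sub_eq' hb]
  congr 1
  have : HahnSeries.single ((0, -1) : ℤ × ℤ) (c : ℂ) *
      HahnSeries.single ((0, 1) : ℤ × ℤ) ((c : ℂ)⁻¹) = 1 := by
    rw [HahnSeries.single_mul_single]
    simp [← Prod.zero_eq_mk]
  linear_combination (-(X₁ - X₂) * b) * this

theorem iotaSwapHom_embSnd (w : LaurentSeries ℂ) : iotaSwapHom (embSnd w) = constInX w := by
  apply iterDist_injective
  rw [iterDist_iotaSwapHom]
  funext m n
  simp only [dswap, toDist, embSnd, ofDist, inSnd, iterDist, coeff_constInX, HahnSeries.C_apply,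
    HahnSeries.coeff_single]
  split_ifs <;> rfl

theorem iotaSwapHom_embFst (w : LaurentSeries ℂ) : iotaSwapHom (embFst w) = HahnSeries.C w := by
  apply iterDist_injective
  rw [iterDist_iotaSwapHom]
  funext m n
  simp only [dswap, toDist, embFst, ofDist, inFst, iterDist, HahnSeries.C_apply,
    HahnSeries.coeff_single]
  split_ifs <;> rfl

variable (p : LaurentSeries ℂ)

theorem sigma_embSnd (c : ℂˣ) (w : LaurentSeries ℂ) :
    sigma p c (embSnd w) = HahnSeries.C w := by
  rw [sigma, RingHom.comp_apply, scaleHom_embSnd, phiHom_embSnd]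

theorem sigma_embFst_single (c : ℂˣ) (M : ℤ) :
    sigma p c (embFst (HahnSeries.single M 1)) =
      HahnSeries.C (HahnSeries.C ((c : ℂ) ^ M)) * expX p (HahnSeries.single M 1) := by
  have : scaleHom c (embFst (HahnSeries.single M 1)) =
      embSnd (HahnSeries.C ((c : ℂ) ^ M)) * embFst (HahnSeries.single M 1) := by
    rw [HahnSeries.C_apply, embSnd_single, embFst_single, HahnSeries.single_mul_single]
    ext g
    simp only [coeff_scaleHom, HahnSeries.coeff_single]
    by_cases h : g = (M, 0) <;> simp [h]
  rw [sigma, RingHom.comp_apply, this, map_mul, phiHom_embSnd, phiHom_embFst]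

theorem sigma_ratioSub_self (c : ℂˣ) : sigma p c (ratioSub c) =
    HahnSeries.C (HahnSeries.single (-1) (c : ℂ)) * (phi p - HahnSeries.C (HahnSeries.single 1 1)) := by
  rw [sigma, RingHom.comp_apply, scaleHom_ratioSub, map_mul, map_sub, phiHom_X₁, phiHom_X₂,
    ← embSnd_single, phiHom_embSnd]

theorem order_phi_sub {p : LaurentSeries ℂ} (hp : p ≠ 0) :
    (phi p - HahnSeries.C (HahnSeries.single 1 1)).order = 1 := by
  refine le_antisymm (HahnSeries.order_le_of_coeff_ne_zero ?_)
    (le_order_of_coeff (phi_sub_ne_zero hp) fun n hn => ?_)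
  · rw [HahnSeries.coeff_sub, coeff_phi_one, HahnSeries.C_apply,
      HahnSeries.coeff_single_of_ne (by norm_num), sub_zero]
    exact hp
  · rw [HahnSeries.coeff_sub]
    rcases eq_or_ne n 0 with rfl | h
    · rw [coeff_phi_zero, HahnSeries.C_apply, HahnSeries.coeff_single_same, sub_self]
    · rw [phi, coeff_expX_of_neg p _ (by lia), HahnSeries.C_apply,
        HahnSeries.coeff_single_of_ne h, sub_self]

/-- In `x₁ = c φ(x, z)` the factor at `c` is a unit times `φ(x, z) - x`, which has a simple zero at
`z = 0`; a factor at `c' ≠ c` takes the nonzero value `c - c'` there. -/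
theorem order_sigma_ratioSub {p : LaurentSeries ℂ} (hp : p ≠ 0) (c c' : ℂˣ) :
    (sigma p c (ratioSub c')).order ≤ if c = c' then 1 else 0 := by
  split_ifs with h
  · subst h
    rw [sigma_ratioSub_self, HahnSeries.order_mul _ (phi_sub_ne_zero hp), order_phi_sub hp, order_C,
      zero_add]
    rw [Ne, map_eq_zero_iff _ HahnSeries.C_injective]
    exact HahnSeries.single_ne_zero c.ne_zero
  · refine HahnSeries.order_le_of_coeff_ne_zero ?_
    have e : ratioSub c' = ratioSub c + embSnd (HahnSeries.C ((c : ℂ) - c')) := by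
      rw [← ratioSub_sub]
      ring
    rw [e, map_add, sigma_embSnd, HahnSeries.coeff_add, HahnSeries.C_apply (Γ := ℤ),
      HahnSeries.coeff_single_same, HahnSeries.coeff_eq_zero_of_lt_order, zero_add]
    · rw [Ne, map_eq_zero_iff _ HahnSeries.C_injective, sub_eq_zero]
      exact fun h1 => h (Units.ext h1)
    · rw [sigma_ratioSub_self, HahnSeries.order_mul _ (phi_sub_ne_zero hp), order_phi_sub hp,
        order_C]
      · norm_num
      · rw [Ne, map_eq_zero_iff _ HahnSeries.C_injective]
        exact HahnSeries.single_ne_zero c.ne_zero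

theorem order_sigma_nonneg (c : ℂˣ) (a : Laurent₂) : 0 ≤ (sigma p c a).order :=
  order_nonneg_of_coeff fun _ hn => coeff_phiHom_of_neg p _ hn

theorem order_expX_nonneg (a : LaurentSeries ℂ) : 0 ≤ (expX p a).order :=
  order_nonneg_of_coeff fun _ hn => coeff_expX_of_neg p _ hn

/-- The product of the `x₁ / x₂ - c` for `c` in the multiset `s`. -/
def ratioProd (s : Multiset ℂˣ) : Laurent₂ := (s.map ratioSub).prod

theorem ratioProd_ne_zero (s : Multiset ℂˣ) : ratioProd s ≠ 0 := by
  rw [ratioProd, Ne, Multiset.prod_eq_zero_iff, Multiset.mem_map]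
  rintro ⟨c, -, h⟩
  exact ratioSub_ne_zero c h

theorem order_sigma_ratioProd {p : LaurentSeries ℂ} (hp : p ≠ 0) (c : ℂˣ) (s : Multiset ℂˣ) :
    (sigma p c (ratioProd s)).order ≤ s.count c := by
  induction s using Multiset.induction_on with
  | empty => simp [ratioProd]
  | cons a s ih =>
    have h1 : sigma p c (ratioSub a) ≠ 0 :=
      (map_ne_zero_iff _ (sigma_injective hp c)).2 (ratioSub_ne_zero a)
    have h2 : sigma p c (ratioProd s) ≠ 0 :=
      (map_ne_zero_iff _ (sigma_injective hp c)).2 (ratioProd_ne_zero s)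
    have e : ratioProd (a ::ₘ s) = ratioSub a * ratioProd s := by simp [ratioProd]
    rw [e, map_mul, HahnSeries.order_mul h1 h2, Multiset.count_cons]
    have h3 := order_sigma_ratioSub hp c a
    push_cast
    split_ifs at h3 ⊢ <;> lia

/-- The numerator has no pole at `z = 0`, so the pole order is at most the multiplicity of `c` in
the denominator. -/
theorem coeff_fracLift_sigma_eq_zero {p : LaurentSeries ℂ} (hp : p ≠ 0) (c : ℂˣ) (a : Laurent₂)
    (s : Multiset ℂˣ) {n : ℤ} (hn : n < -(s.count c : ℤ)) :
    (fracLift (sigma_injective hp c) (algebraMap Laurent₂ Frac₂ a /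
      algebraMap Laurent₂ Frac₂ (ratioProd s))).coeff n = 0 := by
  rw [map_div₀, fracLift_algebraMap, fracLift_algebraMap, div_eq_mul_inv]
  have h2 : sigma p c (ratioProd s) ≠ 0 :=
    (map_ne_zero_iff _ (sigma_injective hp c)).2 (ratioProd_ne_zero s)
  by_cases h : sigma p c a = 0
  · rw [h, zero_mul]; rfl
  refine HahnSeries.coeff_eq_zero_of_lt_order ?_
  rw [HahnSeries.order_mul h (inv_ne_zero h2), order_inv_eq]
  have := order_sigma_nonneg p c a
  have := order_sigma_ratioProd hp c s
  lia

end Denominators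

/-! ### The residue theorem in `x₁` -/

section Residues

/-- The coefficient of `y₂ ^ n * y₁ ^ m` as an additive map. -/
def coeffHom (m n : ℤ) : 𝕂 →+ ℂ :=
  (HahnSeries.coeff.addMonoidHom n).comp (HahnSeries.coeff.addMonoidHom m)

theorem coeffHom_apply (m n : ℤ) (E : 𝕂) : coeffHom m n E = (E.coeff m).coeff n := rfl

theorem coeffHom_constInX_mul (w : LaurentSeries ℂ) (E : 𝕂) (m n : ℤ) :
    coeffHom m n (constInX w * E) = ∑ᶠ j : ℤ, w.coeff j * coeffHom (m - j) n E := by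
  rw [coeffHom_apply, coeff_mul_eq_finsum]
  refine ((HahnSeries.coeff.addMonoidHom (R := ℂ) n).map_finsum
    (hasFiniteSupport_coeff_mul (constInX w) E m)).trans (finsum_congr fun j => ?_)
  rw [coeff_constInX, HahnSeries.C_mul_eq_smul]
  rfl

theorem coeffHom_C_mul (w : LaurentSeries ℂ) (E : 𝕂) (m n : ℤ) :
    coeffHom m n (HahnSeries.C w * E) = ∑ᶠ j : ℤ, w.coeff j * coeffHom m (n - j) E := by
  rw [coeffHom_apply, HahnSeries.C_mul_eq_smul, HahnSeries.coeff_smul, smul_eq_mul,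
    coeff_mul_eq_finsum]
  rfl

theorem coeffHom_neg_one_eq_zero {E : 𝕂} (h : 0 ≤ E.order) (n : ℤ) : coeffHom (-1) n E = 0 := by
  have : E.coeff (-1) = 0 := HahnSeries.coeff_eq_zero_of_lt_order (by lia)
  rw [coeffHom_apply, this]
  rfl

instance : CharZero (LaurentSeries ℂ) := charZero_of_injective_ringHom
  (HahnSeries.C_injective : Injective (HahnSeries.C : ℂ →+* LaurentSeries ℂ))

variable {p : LaurentSeries ℂ} (hp : p ≠ 0)

/-- The residue form `F(c φ(x, z), x) ∂(c φ(x, z))/∂z` whose residue at `z = 0` is the residue of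
`F(x₁, x) dx₁` at `x₁ = c x`. -/
def residueForm (c : ℂˣ) (F : Frac₂) : 𝕂 :=
  fracLift (sigma_injective hp c) F * (HahnSeries.C (HahnSeries.C (c : ℂ)) * expX p p)

/-- The residue theorem in the variable `x₁` for `F`, with all nonzero finite poles at `x₁ = c x₂`
for `c ∈ T`. -/
def ResidueFormula (T : Finset ℂˣ) (F : Frac₂) : Prop :=
  ∀ n, coeffHom n (-1) (fracLift iotaSwapHom_injective F) -
    coeffHom (-1) n (fracLift iotaHom_injective F) = ∑ c ∈ T, coeffHom (-1) n (residueForm hp c F)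

variable {hp} {T : Finset ℂˣ}

theorem ResidueFormula.add {E F : Frac₂} (hE : ResidueFormula hp T E) (hF : ResidueFormula hp T F) :
    ResidueFormula hp T (E + F) := fun n => by
  have h1 := hE n
  have h2 := hF n
  simp only [residueForm, map_add, add_mul, Finset.sum_add_distrib] at h1 h2 ⊢
  linear_combination h1 + h2

theorem ResidueFormula.sub {E F : Frac₂} (hE : ResidueFormula hp T E) (hF : ResidueFormula hp T F) :
    ResidueFormula hp T (E - F) := fun n => by
  have h1 := hE n
  have h2 := hF n
  simp only [residueForm, map_sub, sub_mul, Finset.sum_sub_distrib] at h1 h2 ⊢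
  linear_combination h1 - h2

/-- All terms are linear over series in `x₂`: multiplication by `w(x₂)` only convolves the
coefficients indexed by `n`. It is the reason for stating the formula for all `n` at once. -/
theorem ResidueFormula.embSnd_mul {F : Frac₂} (hF : ResidueFormula hp T F) (w : LaurentSeries ℂ) :
    ResidueFormula hp T (algebraMap Laurent₂ Frac₂ (embSnd w) * F) := fun n => by
  simp only [residueForm, map_mul, fracLift_algebraMap, iotaSwapHom_embSnd, iotaHom_embSnd,
    sigma_embSnd, mul_assoc, coeffHom_constInX_mul, coeffHom_C_mul]
  have hfin : ∀ (m : ℤ) (E : 𝕂), HasFiniteSupport fun j : ℤ => w.coeff j * coeffHom m (n - j) E :=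
    fun m E => hasFiniteSupport_coeff_mul w (E.coeff m) n
  have hfin' : ∀ (m : ℤ) (E : 𝕂), HasFiniteSupport fun j : ℤ => w.coeff j * coeffHom (n - j) m E :=
    fun m E => (finite_setOf_coeff_ne_zero w E n).subset fun j hj =>
      ⟨left_ne_zero_of_mul hj, fun h => right_ne_zero_of_mul hj (by rw [coeffHom_apply, h]; rfl)⟩
  rw [← finsum_sub_distrib (hfin' _ _) (hfin _ _), ← finsum_sum_comm _ _ fun c _ => hfin _ _]
  refine finsum_congr fun j => ?_
  rw [← mul_sub, hF (n - j), Finset.mul_sum]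
  rfl

/-- The two expansions coincide on `ℂ((x₁, x₂))`, and the residue forms are regular at `z = 0`. -/
theorem residueFormula_algebraMap (a : Laurent₂) :
    ResidueFormula hp T (algebraMap Laurent₂ Frac₂ a) := fun n => by
  have h1 : ∀ c ∈ T, coeffHom (-1) n (residueForm hp c (algebraMap Laurent₂ Frac₂ a)) = 0 := by
    intro c _
    rw [residueForm, fracLift_algebraMap]
    exact coeffHom_neg_one_eq_zero (order_nonneg_mul (order_sigma_nonneg p c a)
      (order_nonneg_mul (order_C (HahnSeries.C (c : ℂ))).ge (order_expX_nonneg p p))) n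
  rw [Finset.sum_eq_zero h1, fracLift_algebraMap, fracLift_algebraMap, sub_eq_zero]
  have h2 := congrFun (congrFun (iterDist_iotaSwapHom a) n) (-1)
  have h3 := congrFun (congrFun (iterDist_iotaHom a) (-1)) n
  exact h2.trans h3.symm

/-- The support condition: only the monomials `(y₁ / y₂) ^ n` with `n ≥ N` occur. -/
def IsRatioSeries (N : ℤ) (E : 𝕂) : Prop := ∀ m n, (E.coeff m).coeff n ≠ 0 → n = -m ∧ N ≤ m

theorem IsRatioSeries.mul {N M : ℤ} {E F : 𝕂} (hE : IsRatioSeries N E) (hF : IsRatioSeries M F) :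
    IsRatioSeries (N + M) (E * F) := fun m n h => by
  have h' : iterDist (E * F) m n ≠ 0 := h
  rw [iterDist_mul] at h'
  obtain ⟨ab, hab⟩ := exists_term_ne_zero h'
  have h1 := hE _ _ (left_ne_zero_of_smul hab)
  have h2 := hF _ _ (right_ne_zero_of_smul hab)
  lia

theorem isRatioSeries_one : IsRatioSeries 0 1 := fun m n h => by
  rw [HahnSeries.coeff_one] at h
  by_cases hm : m = 0
  · rw [if_pos hm, HahnSeries.coeff_one] at h
    by_cases hn : n = 0
    · lia
    · simp [hn] at h
  · simp [hm] at h

theorem IsRatioSeries.pow {N : ℤ} {E : 𝕂} (hE : IsRatioSeries N E) (k : ℕ) :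
    IsRatioSeries (k * N) (E ^ k) := by
  induction k with
  | zero => simpa using isRatioSeries_one
  | succ k ih =>
    rw [pow_succ]
    convert! ih.mul hE using 1
    push_cast
    ring

/-- The coefficients of the expansion of `(x₁ / x₂ - c)⁻¹` in nonnegative powers of `x₂`. -/
def ratioSubInvCoeff (c : ℂˣ) (n : ℤ) : LaurentSeries ℂ :=
  if 1 ≤ n then HahnSeries.single (-n) ((c : ℂ) ^ (n - 1)) else 0

theorem bddBelow_ratioSubInvCoeff (c : ℂˣ) : BddBelow (support (ratioSubInvCoeff c)) :=
  ⟨1, fun n hn => by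
    by_contra h
    exact hn (if_neg h)⟩

/-- The expansion of `(x₁ / x₂ - c)⁻¹` in nonnegative powers of `x₂`. -/
def ratioSubInv (c : ℂˣ) : 𝕂 :=
  HahnSeries.ofSuppBddBelow (ratioSubInvCoeff c) (bddBelow_ratioSubInvCoeff c)

theorem coeff_ratioSubInv (c : ℂˣ) (n : ℤ) : (ratioSubInv c).coeff n =
    if 1 ≤ n then HahnSeries.single (-n) ((c : ℂ) ^ (n - 1)) else 0 := by
  rw [ratioSubInv, HahnSeries.coeff_ofSuppBddBelow, ratioSubInvCoeff]

theorem isRatioSeries_ratioSubInv (c : ℂˣ) : IsRatioSeries 1 (ratioSubInv c) := fun m n h => by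
  rw [coeff_ratioSubInv] at h
  split_ifs at h with h1
  · refine ⟨?_, h1⟩
    by_contra h2
    exact h (HahnSeries.coeff_single_of_ne h2)
  · exact absurd rfl h

theorem constInX_single (n : ℤ) (c : ℂ) :
    constInX (HahnSeries.single n c) = HahnSeries.single n (HahnSeries.C c) := by
  refine HahnSeries.ext (funext fun m => ?_)
  rw [coeff_constInX]
  rcases eq_or_ne m n with rfl | h
  · simp
  · rw [HahnSeries.coeff_single_of_ne h, HahnSeries.coeff_single_of_ne h, map_zero]

theorem iotaSwapHom_ratioSub (c : ℂˣ) : iotaSwapHom (ratioSub c) =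
    (HahnSeries.single (-1) (HahnSeries.single 1 1 : LaurentSeries ℂ) : 𝕂) -
      HahnSeries.C (HahnSeries.C (c : ℂ)) := by
  rw [ratioSub_eq, map_sub, map_mul, iotaSwapHom_embFst, iotaSwapHom_embSnd, iotaSwapHom_embSnd,
    constInX_single, HahnSeries.C_apply (Γ := ℤ) (R := LaurentSeries ℂ),
    HahnSeries.single_mul_single, map_one HahnSeries.C, mul_one, zero_add]
  rw [HahnSeries.C_apply (Γ := ℤ) (R := ℂ), constInX_single]
  rfl

theorem iotaSwapHom_ratioSub_mul (c : ℂˣ) : iotaSwapHom (ratioSub c) * ratioSubInv c = 1 := by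
  refine HahnSeries.ext (funext fun n => ?_)
  rw [iotaSwapHom_ratioSub, sub_mul, HahnSeries.coeff_sub, HahnSeries.coeff_single_mul,
    HahnSeries.C_mul_eq_smul, HahnSeries.coeff_smul, smul_eq_mul, coeff_ratioSubInv,
    coeff_ratioSubInv, HahnSeries.coeff_one]
  rcases lt_trichotomy n 0 with h | rfl | h
  · rw [if_neg (by lia), if_neg (by lia), if_neg (by lia)]
    simp
  · simp [HahnSeries.single_mul_single]
  · rw [if_pos (by lia), if_pos (by lia), if_neg (by lia), HahnSeries.single_mul_single,
      HahnSeries.C_apply, HahnSeries.single_mul_single, one_mul, zero_add,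
      show (1 : ℤ) + -(n - -1) = -n by ring, sub_eq_zero]
    congr 1
    rw [show n - -1 - 1 = n - 1 + 1 by ring, zpow_add_one₀ c.ne_zero, mul_comm]

theorem iotaHom_ratioSub (c : ℂˣ) : iotaHom (ratioSub c) =
    HahnSeries.single 1 (HahnSeries.single (-1) 1) - HahnSeries.C (HahnSeries.C (c : ℂ)) := by
  rw [ratioSub_eq, map_sub, map_mul, iotaHom_embSnd, iotaHom_embSnd, embFst_single]
  rw [iotaHom_X₁, HahnSeries.C_apply (Γ := ℤ) (R := LaurentSeries ℂ),
    HahnSeries.single_mul_single, one_mul, add_zero]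

/-- The constant term `-c` in `x₁` is nonzero, so inverse powers of the factor have no negative
powers of `x₁` in this expansion. -/
theorem order_iotaHom_ratioSub (c : ℂˣ) : (iotaHom (ratioSub c)).order ≤ 0 := by
  refine HahnSeries.order_le_of_coeff_ne_zero ?_
  rw [iotaHom_ratioSub, HahnSeries.coeff_sub, HahnSeries.coeff_single_of_ne (by norm_num),
    HahnSeries.C_apply (Γ := ℤ) (R := LaurentSeries ℂ), HahnSeries.coeff_single_same, zero_sub, Ne,
    neg_eq_zero, map_eq_zero_iff _ HahnSeries.C_injective]
  exact c.ne_zero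

theorem order_inv_pow_nonneg {K : Type*} [Field K] {x : LaurentSeries K} (h : x.order ≤ 0) (n : ℕ) :
    0 ≤ ((x⁻¹) ^ n).order := by
  induction n with
  | zero => simp
  | succ n ih =>
    rw [pow_succ]
    refine order_nonneg_mul ih ?_
    rw [order_inv_eq]
    lia

theorem coeffHom_mul_expX (E : 𝕂) (y : 𝕂)
    (hy : weightDeriv (Int.castAddHom (LaurentSeries ℂ)) y = HahnSeries.single 1 1 * expX p p) (n : ℤ) :
    coeffHom (-1) n (E * expX p p) =
      coeffHom 0 n (E * weightDeriv (Int.castAddHom (LaurentSeries ℂ)) y) := by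
  rw [hy, mul_left_comm, coeffHom_apply, coeffHom_apply, HahnSeries.coeff_single_mul, one_mul,
    zero_sub]

/-- The flow equation `∂φ/∂z = p(φ)`, multiplied by `z`. It turns the residue forms into forms
`y^{-k} dy` with `y = φ(x, z) - x`. -/
theorem weightDeriv_phi_sub : weightDeriv (Int.castAddHom (LaurentSeries ℂ))
    (phi p - HahnSeries.C (HahnSeries.single 1 1)) = HahnSeries.single 1 1 * expX p p := by
  refine HahnSeries.ext (funext fun n => ?_)
  rw [coeff_weightDeriv, HahnSeries.coeff_single_mul, one_mul, HahnSeries.coeff_sub,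
    HahnSeries.C_apply (Γ := ℤ) (R := LaurentSeries ℂ)]
  rcases lt_trichotomy n 0 with h | rfl | h
  · rw [phi, coeff_expX_of_neg p _ h, coeff_expX_of_neg p _ (by lia),
      HahnSeries.coeff_single_of_ne h.ne, sub_zero, mul_zero]
  · rw [coeff_expX_of_neg p _ (by lia)]
    simp
  · obtain ⟨k, rfl⟩ : ∃ k : ℕ, n = k + 1 := ⟨(n - 1).toNat, by lia⟩
    rw [HahnSeries.coeff_single_of_ne h.ne', sub_zero, phi, add_sub_cancel_right, coeff_expX,
      show (k : ℤ) + 1 = ((k + 1 : ℕ) : ℤ) by push_cast; rfl, coeff_expX, iterate_succ_apply, pD_X]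
    have e : (Int.castAddHom (LaurentSeries ℂ)) ((k + 1 : ℕ) : ℤ) =
        HahnSeries.C (((k + 1 : ℕ) : ℂ)) := by
      rw [map_natCast HahnSeries.C]
      simp
    rw [e, HahnSeries.C_mul_eq_smul, smul_smul, Nat.factorial_succ]
    congr 1
    have h1 : ((k + 1 : ℕ) : ℂ) ≠ 0 := Nat.cast_ne_zero.2 (by lia)
    push_cast at h1 ⊢
    field_simp

theorem residueFormula_inv_pow {c : ℂˣ} (hc : c ∈ T) (N : ℕ) :
    ResidueFormula hp T ((algebraMap Laurent₂ Frac₂ (ratioSub c))⁻¹ ^ (N + 1)) := fun n => by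
  rw [Finset.sum_eq_single_of_mem c hc]
  · have e1 : fracLift iotaSwapHom_injective ((algebraMap Laurent₂ Frac₂ (ratioSub c))⁻¹ ^ (N + 1)) =
        ratioSubInv c ^ (N + 1) := by
      rw [map_pow, map_inv₀, fracLift_algebraMap, inv_eq_of_mul_eq_one_right
        (iotaSwapHom_ratioSub_mul c)]
    have e2 : coeffHom (-1) n (fracLift iotaHom_injective
        ((algebraMap Laurent₂ Frac₂ (ratioSub c))⁻¹ ^ (N + 1))) = 0 := by
      rw [map_pow, map_inv₀, fracLift_algebraMap]
      exact coeffHom_neg_one_eq_zero (order_inv_pow_nonneg (order_iotaHom_ratioSub c) (N + 1)) n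
    set y := phi p - HahnSeries.C (HahnSeries.single 1 1) with hy
    have e3 : residueForm hp c ((algebraMap Laurent₂ Frac₂ (ratioSub c))⁻¹ ^ (N + 1)) =
        HahnSeries.C ((HahnSeries.single (-1) (c : ℂ))⁻¹ ^ (N + 1) * HahnSeries.C (c : ℂ)) *
          (y⁻¹ ^ (N + 1) * expX p p) := by
      rw [residueForm, map_pow, map_inv₀, fracLift_algebraMap, sigma_ratioSub_self, mul_inv,
        mul_pow, map_mul, map_pow, map_inv₀]
      ring
    rw [e1, e2, e3, sub_zero, coeffHom_C_mul]
    simp only [coeffHom_mul_expX _ y weightDeriv_phi_sub]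
    cases N with
    -- Simple pole: the residue of `dy / y` is `1` and the prefactor is `x₂`, matching the single
    -- term `x₂ x₁⁻¹` of the expansion in nonnegative powers of `x₂`.
    | zero =>
      simp only [zero_add, pow_one]
      have h1 : (HahnSeries.single (-1) (c : ℂ))⁻¹ * HahnSeries.C (c : ℂ) =
          (HahnSeries.single 1 1 : LaurentSeries ℂ) := by
        rw [inv_mul_eq_iff_eq_mul₀ (HahnSeries.single_ne_zero c.ne_zero),
          HahnSeries.single_mul_single, mul_one]
        rfl
      have h2 : ∀ j, coeffHom 0 j (y⁻¹ * weightDeriv (Int.castAddHom (LaurentSeries ℂ)) y) =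
          if j = 0 then 1 else 0 := fun j => by
        rw [coeffHom_apply, coeff_zero_inv_mul_weightDeriv (order_phi_sub hp), HahnSeries.coeff_one]
        congr
      rw [h1, finsum_eq_single _ n fun j hj => by rw [h2, if_neg (by lia), mul_zero], h2,
        if_pos (sub_self n), mul_one, coeffHom_apply, coeff_ratioSubInv]
      by_cases hn : n = 1
      · simp [hn]
      · rw [HahnSeries.coeff_single_of_ne hn]
        split_ifs with h
        · rw [HahnSeries.coeff_single_of_ne (by lia)]
        · rfl
    -- Higher pole: the form is exact, and the expansion has only powers `(x₂ / x₁) ^ m` with `m ≥ N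
    -- + 2`, so `x₁⁻¹` does not occur.
    | succ N =>
      have h2 : ∀ j, coeffHom 0 j (y⁻¹ ^ (N + 1 + 1) *
          weightDeriv (Int.castAddHom (LaurentSeries ℂ)) y) = 0 := fun j => by
        rw [coeffHom_apply, coeff_zero_inv_pow_mul_weightDeriv (phi_sub_ne_zero hp)]
        rfl
      simp only [h2, mul_zero, finsum_zero]
      by_contra h
      have := (isRatioSeries_ratioSubInv c).pow (N + 1 + 1) n (-1) h
      push_cast at this
      lia
  · intro c' _ hcc
    have h1 := order_sigma_ratioSub hp c' c
    rw [if_neg hcc] at h1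
    rw [residueForm, map_pow, map_inv₀, fracLift_algebraMap]
    exact coeffHom_neg_one_eq_zero (order_nonneg_mul (order_inv_pow_nonneg h1 (N + 1))
      (order_nonneg_mul (order_C (HahnSeries.C (c' : ℂ))).ge (order_expX_nonneg p p))) n

/-- Dividing the numerator by `x₁/x₂ - c` splits off a multiple, by a series in `x₂`, of a pure
inverse power and lowers the exponent. -/
theorem residueFormula_div_pow {c : ℂˣ} (hc : c ∈ T) (N : ℕ) (a : Laurent₂) :
    ResidueFormula hp T (algebraMap Laurent₂ Frac₂ a *
      (algebraMap Laurent₂ Frac₂ (ratioSub c))⁻¹ ^ N) := by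
  induction N generalizing a with
  | zero => simpa using residueFormula_algebraMap a
  | succ N ih =>
    obtain ⟨w, b, rfl⟩ := exists_eq_embSnd_add c a
    have h := ((residueFormula_inv_pow (hp := hp) hc N).embSnd_mul w).add (ih b)
    convert! h using 1
    have h1 : algebraMap Laurent₂ Frac₂ (ratioSub c) ≠ 0 :=
      (map_ne_zero_iff _ (IsFractionRing.injective Laurent₂ Frac₂)).2 (ratioSub_ne_zero c)
    rw [map_add, map_mul, add_mul, pow_succ]
    field_simp

/-- Partial fractions. The extra power of the factor at `c` is an accumulator: a further factor at
`c` joins it, and for `c' ≠ c` the difference of the two factors is a nonzero constant, so their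
inverse product is a combination of the two inverses. -/
theorem residueFormula_div_mul (s : Multiset ℂˣ) (hs : ∀ c ∈ s, c ∈ T) {c : ℂˣ} (hc : c ∈ T) (N : ℕ)
    (a : Laurent₂) :
    ResidueFormula hp T (algebraMap Laurent₂ Frac₂ a *
      (algebraMap Laurent₂ Frac₂ (ratioSub c))⁻¹ ^ N *
      (algebraMap Laurent₂ Frac₂ (ratioProd s))⁻¹) := by
  induction s using Multiset.induction_on generalizing c N a with
  | empty => simpa [ratioProd] using residueFormula_div_pow hc N a
  | cons c' s ih =>
    have ih := @ih fun d hd => hs d (Multiset.mem_cons_of_mem hd)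
    have hc' := hs c' (Multiset.mem_cons_self c' s)
    have hne : ∀ d, algebraMap Laurent₂ Frac₂ (ratioSub d) ≠ 0 := fun d =>
      (map_ne_zero_iff _ (IsFractionRing.injective Laurent₂ Frac₂)).2 (ratioSub_ne_zero d)
    have e : algebraMap Laurent₂ Frac₂ (ratioProd (c' ::ₘ s)) =
        algebraMap Laurent₂ Frac₂ (ratioSub c') * algebraMap Laurent₂ Frac₂ (ratioProd s) := by
      rw [← map_mul]
      simp [ratioProd]
    rw [e, mul_inv, ← mul_assoc]
    by_cases h : c' = c
    · subst h
      convert! ih hc (N + 1) a using 1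
      ring
    induction N with
    | zero => simpa using ih hc' 1 a
    | succ N ihN =>
      have h1 := ((ihN.sub (ih hc (N + 1) a)).embSnd_mul
        (HahnSeries.C ((c' : ℂ) - (c : ℂ))⁻¹))
      convert! h1 using 1
      have h2 : (c' : ℂ) - c ≠ 0 := fun h3 => h (Units.ext (sub_eq_zero.1 h3))
      have h3 : algebraMap Laurent₂ Frac₂ (embSnd (HahnSeries.C ((c' : ℂ) - (c : ℂ))⁻¹)) *
          (algebraMap Laurent₂ Frac₂ (ratioSub c) - algebraMap Laurent₂ Frac₂ (ratioSub c')) = 1 := by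
        rw [← map_sub, ratioSub_sub, ← map_mul, ← embSnd_mul, ← map_mul, inv_mul_cancel₀ h2,
          map_one]
        have := iotaHom_embSnd 1
        rw [map_one, ← map_one iotaHom] at this
        rw [iotaHom_injective this, map_one]
      have h4 := hne c
      have h5 := hne c'
      rw [pow_succ]
      generalize algebraMap Laurent₂ Frac₂ (embSnd (HahnSeries.C ((c' : ℂ) - (c : ℂ))⁻¹)) = t at *
      generalize algebraMap Laurent₂ Frac₂ (ratioSub c) = x at *
      generalize algebraMap Laurent₂ Frac₂ (ratioSub c') = y at *
      have h6 : x⁻¹ * y⁻¹ = t * (y⁻¹ - x⁻¹) := by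
        field_simp
        linear_combination -h3
      linear_combination (algebraMap Laurent₂ Frac₂ a * x⁻¹ ^ N *
        (algebraMap Laurent₂ Frac₂ (ratioProd s))⁻¹) * h6

theorem residueFormula_div (s : Multiset ℂˣ) (hs : ∀ c ∈ s, c ∈ T) (a : Laurent₂) :
    ResidueFormula hp T (algebraMap Laurent₂ Frac₂ a / algebraMap Laurent₂ Frac₂ (ratioProd s)) := by
  rcases Multiset.empty_or_exists_mem s with rfl | ⟨c, hc⟩
  · simpa [ratioProd] using residueFormula_algebraMap a
  · simpa [div_eq_mul_inv] using residueFormula_div_mul s hs (hs c hc) 0 a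

/-- The residue formula sees only `x₁⁻¹`; applying it to `x₁ ^ M F` reaches the coefficient of `x₁ ^
(-1 - M)`. The factors `c ^ M` and `φ ^ M` from the substitution join `c p(φ)`. -/
theorem coeff_sub_coeff_eq_sum_residue (hp : p ≠ 0) (s : Multiset ℂˣ) (a : Laurent₂) {F : Frac₂}
    (hF : F = algebraMap Laurent₂ Frac₂ a / algebraMap Laurent₂ Frac₂ (ratioProd s)) (M n : ℤ) :
    ((fracLift iotaSwapHom_injective F).coeff n).coeff (-1 - M) -
        ((fracLift iotaHom_injective F).coeff (-1 - M)).coeff n =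
      ∑ c ∈ s.toFinset, (c : ℂ) ^ (M + 1) * ((fracLift (sigma_injective hp c) F *
        expX p (p * HahnSeries.single M 1)).coeff (-1)).coeff n := by
  have h := residueFormula_div (hp := hp) (T := s.toFinset) s (fun c hc => by simpa using hc)
    (embFst (HahnSeries.single M 1) * a) n
  rw [map_mul, mul_div_assoc, ← hF] at h
  simp only [residueForm, map_mul, fracLift_algebraMap, iotaSwapHom_embFst, sigma_embFst_single] at h
  have e1 : coeffHom n (-1) (HahnSeries.C (HahnSeries.single M 1) *
      fracLift iotaSwapHom_injective F) =
      ((fracLift iotaSwapHom_injective F).coeff n).coeff (-1 - M) := by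
    rw [coeffHom_apply, HahnSeries.C_mul_eq_smul, HahnSeries.coeff_smul, smul_eq_mul,
      HahnSeries.coeff_single_mul, one_mul]
  have e2 : coeffHom (-1) n (iotaHom (embFst (HahnSeries.single M 1)) *
      fracLift iotaHom_injective F) =
      ((fracLift iotaHom_injective F).coeff (-1 - M)).coeff n := by
    have : iotaHom (embFst (HahnSeries.single M 1)) = HahnSeries.single M 1 := by
      apply iterDist_injective
      rw [iterDist_iotaHom]
      funext i j
      simp only [toDist, embFst, ofDist, inFst, iterDist, HahnSeries.coeff_single]
      by_cases hi : i = M <;> by_cases hj : j = 0 <;> simp [hi, hj, HahnSeries.coeff_one]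
    rw [this, coeffHom_apply, HahnSeries.coeff_single_mul, one_mul]
  rw [e1, e2] at h
  rw [h]
  refine Finset.sum_congr rfl fun c _ => ?_
  have e3 : HahnSeries.C (HahnSeries.C ((c : ℂ) ^ M)) * expX p (HahnSeries.single M 1) *
      fracLift (sigma_injective hp c) F * (HahnSeries.C (HahnSeries.C (c : ℂ)) * expX p p) =
      HahnSeries.C (HahnSeries.C ((c : ℂ) ^ (M + 1))) *
        (fracLift (sigma_injective hp c) F * (expX p p * expX p (HahnSeries.single M 1))) := by
    rw [zpow_add_one₀ c.ne_zero, map_mul, map_mul]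
    ring
  rw [e3, coeffHom_apply, HahnSeries.C_mul_eq_smul, HahnSeries.coeff_smul, smul_eq_mul,
    HahnSeries.C_mul_eq_smul, HahnSeries.coeff_smul, smul_eq_mul, map_mul]

end Residues

/-! ### Rows of the delta distribution at a fixed power of `x₁` -/

section Rows

theorem finsum_prod_eq_of_fst {U : Type*} [AddCommMonoid U] (m : ℤ) {f : ℤ × ℤ → U}
    (h : ∀ ab, ab.1 ≠ m → f ab = 0) : ∑ᶠ ab, f ab = ∑ᶠ b, f (m, b) := by
  rw [← finsum_mem_range (f := f) (g := fun b : ℤ => (m, b)) fun _ _ h => (Prod.ext_iff.1 h).2,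
    ← finsum_mem_univ]
  refine finsum_mem_inter_support_eq' _ _ _ fun ab hab => ⟨fun _ => ⟨ab.2, ?_⟩, fun _ => trivial⟩
  have : ab.1 = m := by
    by_contra h1
    exact hab (h _ h1)
  rw [← this]

theorem distMul_inSnd_apply {U : Type*} [AddCommGroup U] [Module ℂ U] (T : FDist ℂ) (y : ℤ → U)
    (m n : ℤ) : distMul T (inSnd y) m n = ∑ᶠ b, T m b • y (n - b) := by
  rw [distMul, finsum_prod_eq_of_fst m]
  · simp [inSnd]
  · intro ab h
    rw [inSnd, if_neg (by lia), smul_zero]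

theorem inSnd_distMul_apply {U : Type*} [AddCommGroup U] [Module ℂ U] (y : ℤ → ℂ) (A : FDist U)
    (m n : ℤ) : distMul (inSnd y) A m n = ∑ᶠ b, y b • A m (n - b) := by
  rw [distMul, finsum_prod_eq_of_fst 0]
  · simp [inSnd]
  · intro ab h
    rw [inSnd, if_neg h, zero_smul]

theorem inFst_distMul_apply {U : Type*} [AddCommGroup U] [Module ℂ U] (y : ℤ → ℂ) (A : FDist U)
    (m n : ℤ) : distMul (inFst y) A m n = ∑ᶠ a, y a • A (m - a) n := by
  have := congrFun (congrFun (dswap_distMul (inSnd y) (dswap A)) m) n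
  change distMul (inSnd y) (dswap A) n m = distMul (inFst y) A m n at this
  rw [inSnd_distMul_apply] at this
  exact this.symm

theorem distPD₂_row (p : LaurentSeries ℂ) {A : FDist ℂ} {m : ℤ} {t : LaurentSeries ℂ}
    (h : A m = t.coeff) : distPD₂ p A m = (pD p t).coeff := by
  funext n
  rw [distPD₂, inSnd_distMul_apply, pD_eq, coeff_mul_eq_finsum]
  refine finsum_congr fun b => ?_
  simp [distD₂, h]

theorem iterate_distPD₂_row (p : LaurentSeries ℂ) {A : FDist ℂ} {m : ℤ} {t : LaurentSeries ℂ}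
    (h : A m = t.coeff) (j : ℕ) : (distPD₂ p)^[j] A m = ((pD p)^[j] t).coeff := by
  induction j generalizing A t with
  | zero => exact h
  | succ j ih => rw [iterate_succ_apply, iterate_succ_apply, ih (distPD₂_row p h)]

theorem phiCoeff_one (p : LaurentSeries ℂ) : phiCoeff p 1 = p := by
  simp [phiCoeff]

variable {G : Type*} [Group G]

/-- The `z¹` coefficient of the compatibility of `φ` says that `p(x)` is semi-invariant: `χ(g) p(x)
= χ_φ(g) p(χ_φ(g)⁻¹ x)`. This moves `p` from `x₁` to `x₂` and produces the factor `χ(g)` cancelled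
by `χ(g)⁻¹` in the theorem. -/
theorem distMul_deltaDist_row {p : LaurentSeries ℂ} {χ χφ : G →* ℂˣ} (hφ : PhiCompatible p χ χφ)
    (g : G) (M : ℤ) :
    distMul (inFst p.coeff) (deltaDist ((χφ g : ℂ)⁻¹)) (-1 - M) =
      (((χ g : ℂ) * ((χφ g : ℂ)⁻¹) ^ (M + 1)) • (p * HahnSeries.single M 1)).coeff := by
  funext b
  rw [inFst_distMul_apply, finsum_eq_single _ (b - M)]
  · have h := hφ g 1 (b - M)
    rw [phiCoeff_one, pow_one] at h
    have hc : (χφ g : ℂ) ≠ 0 := (χφ g).ne_zero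
    rw [deltaDist, if_pos (by ring), HahnSeries.coeff_smul, HahnSeries.coeff_mul_single, mul_one,
      smul_eq_mul, smul_eq_mul, mul_right_comm, h]
    have e : ((χφ g : ℂ)⁻¹) ^ b =
        (χφ g : ℂ) * ((χφ g : ℂ)⁻¹) ^ (b - M) * ((χφ g : ℂ)⁻¹) ^ (M + 1) := by
      rw [mul_assoc, ← zpow_add₀ (inv_ne_zero hc), show b - M + (M + 1) = b + 1 by ring,
        zpow_add_one₀ (inv_ne_zero hc)]
      field_simp
    rw [e]
    ring
  · intro a ha
    rw [deltaDist, if_neg (by lia), smul_zero]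

end Rows

/-! ### Poles from quasi-locality, and modes from residues -/

section Poles

theorem toDist_eval₂ (q : Polynomial ℂ) :
    toDist (q.eval₂ (HahnSeries.C : ℂ →+* Laurent₂)
      (HahnSeries.single ((1, -1) : ℤ × ℤ) (1 : ℂ))) = polyRatio q := by
  induction q using Polynomial.induction_on' with
  | add q r hq hr =>
    rw [Polynomial.eval₂_add, toDist_add, hq, hr]
    funext a b
    simp only [polyRatio, Pi.add_apply, Polynomial.coeff_add]
    split_ifs <;> simp
  | monomial n c =>
    rw [Polynomial.eval₂_monomial, HahnSeries.single_pow, HahnSeries.C_mul_eq_smul]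
    funext a b
    simp only [toDist, polyRatio, HahnSeries.coeff_smul, HahnSeries.coeff_single,
      Polynomial.coeff_monomial, Prod.smul_mk, Prod.mk.injEq, one_pow, smul_eq_mul, mul_ite, mul_one,
      mul_zero]
    simp only [nsmul_eq_mul, mul_one, mul_neg]
    split_ifs <;> first | rfl | (exfalso; lia)

theorem exists_ratioProd {ι : Type*} (κ : ι → ℂˣ) {q : Polynomial ℂ}
    (hq : q ∈ Submonoid.closure
      (Set.range fun g => (Polynomial.X - Polynomial.C (κ g : ℂ) : Polynomial ℂ))) :
    ∃ s : Multiset ℂˣ, (∀ c ∈ s, c ∈ Set.range κ) ∧ toDist (ratioProd s) = polyRatio q := by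
  suffices h : ∃ s : Multiset ℂˣ, (∀ c ∈ s, c ∈ Set.range κ) ∧ ratioProd s =
      q.eval₂ (HahnSeries.C : ℂ →+* Laurent₂) (HahnSeries.single ((1, -1) : ℤ × ℤ) (1 : ℂ)) by
    obtain ⟨s, hs, h⟩ := h
    exact ⟨s, hs, by rw [h, toDist_eval₂]⟩
  induction hq using Submonoid.closure_induction with
  | mem q hq =>
    obtain ⟨g, rfl⟩ := hq
    refine ⟨{κ g}, by simp, ?_⟩
    simp [ratioProd, ratioSub]
  | one => exact ⟨0, by simp, by simp [ratioProd]⟩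
  | mul q q' _ _ h h' =>
    obtain ⟨s, hs, h⟩ := h
    obtain ⟨t, ht, h'⟩ := h'
    refine ⟨s + t, fun c hc => (Multiset.mem_add.1 hc).elim (hs c) (ht c), ?_⟩
    rw [Polynomial.eval₂_mul, ← h, ← h', ratioProd, Multiset.map_add, Multiset.prod_add]
    rfl

variable {G V W : Type*} [Group G] [AddCommGroup V] [Module ℂ V] [AddCommGroup W] [Module ℂ W]
variable {p : LaurentSeries ℂ} {𝒱 : NonlocalVertexAlgebra V} {𝒲 : PhiQuasiModule p 𝒱 W}
variable {χφ : G →* ℂˣ} {R : Representation ℂ G V}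

/-- The multiset `s` is chosen before `ℓ` and `w`; this uniformity gives vanishing of operators, and
hence the finiteness claim. -/
theorem exists_poles (hW : IsEquivariant 𝒲 χφ R) (u v : V) :
    ∃ s : Multiset ℂˣ, (∀ c ∈ s, c ∈ Set.range fun g => (χφ g)⁻¹) ∧
      ∀ (ℓ : W →ₗ[ℂ] ℂ) (w : W) (F : Frac₂),
        fracLift iotaSwapHom_injective F = opProd ℓ (𝒲.Y u) (𝒲.Y v) w →
        ∃ a, F = algebraMap Laurent₂ Frac₂ a / algebraMap Laurent₂ Frac₂ (ratioProd s) := by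
  obtain ⟨q, hq, h⟩ := hW.quasi_local u v
  obtain ⟨s, hs, hsq⟩ := exists_ratioProd χφ hq
  refine ⟨s, fun c hc => ?_, fun ℓ w F hF => ?_⟩
  · obtain ⟨g, rfl⟩ := hs c hc
    exact ⟨g⁻¹, by simp⟩
  · refine ⟨ofDist _ (lmap_isLaurent₂ ℓ (h w)), ?_⟩
    apply fracLift_injective iotaSwapHom_injective
    rw [hF]
    refine (fracLift_div _ (ratioProd_ne_zero s) ?_).symm
    apply iterDist_injective
    rw [iterDist_iotaSwapHom, toDist_ofDist, ← hsq, lmap_distMul_prod₁₂]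
    rfl

theorem lmap_distMul_inSnd (ℓ : W →ₗ[ℂ] ℂ) (w : W) (x : V) {T : FDist ℂ} {t : LaurentSeries ℂ}
    {m : ℤ} (hT : T m = t.coeff) (n : ℤ) :
    ℓ (distMul T (inSnd fun n => HVertexOperator.coeff (𝒲.Y x) n w) m n) =
      (t * opSeries 𝒲 ℓ w x).coeff n := by
  rw [distMul_inSnd_apply, coeff_mul_eq_finsum, hT]
  refine (ℓ.toAddMonoidHom.map_finsum ?_).trans (finsum_congr fun b => map_smul ℓ _ _)
  exact (finite_setOf_coeff_ne_zero t ((HahnModule.of ℂ).symm (𝒲.Y x w)) n).subset fun b hb =>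
    ⟨left_ne_zero_of_smul hb, right_ne_zero_of_smul hb⟩

theorem smul_mul_laurentSeries {K : Type*} [CommRing K] (c : K) (x y : LaurentSeries K) :
    c • x * y = c • (x * y) := by
  rw [← HahnSeries.C_mul_eq_smul, mul_assoc, HahnSeries.C_mul_eq_smul]

/-- The Taylor coefficient `(p d/dx)^j a / j!` meets the polar coefficient of `z ^ (-j - 1)`, which
will be the `j`-th mode. -/
theorem coeff_mul_expX (Λ : 𝕂) (a : LaurentSeries ℂ) {N : ℕ} (hΛ : ∀ k, k < -(N : ℤ) → Λ.coeff k = 0) :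
    (Λ * expX p a).coeff (-1) = ∑ j ∈ Finset.range N,
      ((j.factorial : ℂ))⁻¹ • ((pD p)^[j] a * Λ.coeff (-(j : ℤ) - 1)) := by
  rw [mul_comm, coeff_mul_eq_finsum, finsum_eq_sum_of_support_subset _
    (s := (Finset.range N).image fun j : ℕ => (j : ℤ)), Finset.sum_image fun a _ b _ h => by simpa using h]
  · refine Finset.sum_congr rfl fun j _ => ?_
    rw [coeff_expX, smul_mul_laurentSeries, show (-1 : ℤ) - j = -j - 1 by ring]
  · intro k hk
    have h1 : 0 ≤ k := by
      by_contra h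
      exact left_ne_zero_of_mul hk (coeff_expX_of_neg p _ (by lia))
    have h2 : k < N := by
      by_contra h
      exact right_ne_zero_of_mul hk (hΛ _ (by lia))
    simp only [Finset.coe_image, Set.mem_image, Finset.coe_range, Set.mem_Iio]
    exact ⟨k.toNat, by lia, by lia⟩

theorem opSeries_eq_zero_iff (x : V) : (∀ ℓ w, opSeries 𝒲 ℓ w x = 0) ↔ 𝒲.Y x = 0 := by
  refine ⟨fun h => ?_, fun h ℓ w => ?_⟩
  · apply HVertexOperator.coeff_inj
    refine funext fun n => LinearMap.ext fun w => ?_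
    rw [map_zero, Pi.zero_apply, LinearMap.zero_apply, ← Module.forall_dual_apply_eq_zero_iff ℂ]
    intro ℓ
    rw [← coeff_opSeries, h ℓ w]
    rfl
  · ext n
    rw [coeff_opSeries, h, map_zero]
    exact map_zero ℓ

theorem eq_of_apply_eq {G₀ : Set G} (hG₀ : Subgroup.IsComplement G₀ (χφ.ker : Set G)) {g g' : G}
    (hg : g ∈ G₀) (hg' : g' ∈ G₀) (h : χφ g = χφ g') : g = g' := by
  have hk : g⁻¹ * g' ∈ (χφ.ker : Set G) := by
    simp [MonoidHom.mem_ker, h]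
  have h1 : (⟨g, hg⟩, ⟨g⁻¹ * g', hk⟩) =
      ((⟨g', hg'⟩, ⟨1, χφ.ker.one_mem⟩) : G₀ × (χφ.ker : Set G)) := by
    apply hG₀.1
    simp
  exact congrArg Subtype.val (Prod.ext_iff.1 h1).1

theorem exists_mem_apply_eq {G₀ : Set G} (hG₀ : Subgroup.IsComplement G₀ (χφ.ker : Set G)) (g : G) :
    ∃ g' ∈ G₀, χφ g' = χφ g := by
  obtain ⟨⟨⟨g', hg'⟩, ⟨k, hk⟩⟩, h⟩ := hG₀.2 g
  refine ⟨g', hg', ?_⟩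
  have hk : χφ k = 1 := hk
  rw [← h, map_mul, hk, mul_one]

end Poles

end PhiCoord

end

/-! ### Assembly of the commutator formula -/

open PhiCoord in
theorem proposition4p27 {G V W : Type*} [Group G] [AddCommGroup V] [Module ℂ V]
    [AddCommGroup W] [Module ℂ W]
    (p : LaurentSeries ℂ) (hp : p ≠ 0)
    (χ χφ : G →* ℂˣ) (hφ : PhiCompatible p χ χφ)
    (𝒱 : NonlocalVertexAlgebra V) (R : Representation ℂ G V) (hV : IsGModule 𝒱 χ R)
    (𝒲 : PhiQuasiModule p 𝒱 W) (hW : IsEquivariant 𝒲 χφ R)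
    (G₀ : Set G) (hG₀ : Subgroup.IsComplement G₀ (χφ.ker : Set G))
    (u v : V) (r : ℕ) (u' v' : Fin r → V) (f : Fin r → LaurentSeries ℂ)
    (hf : ∀ i, f i ∈ CPhi p) (k : ℕ)
    (hloc : ∀ w : V,
      distMul (toDist (subPow k)) (prod₁₂ (𝒱.Y u) (𝒱.Y v) w) =
        distMul (toDist (subPow k))
          (∑ i, distMul (expandNeg (f i)) (prod₂₁ (𝒱.Y (v' i)) (𝒱.Y (u' i)) w))) :
    {gj : G × ℕ | gj.1 ∈ G₀ ∧
      𝒲.Y (VertexOperator.ncoeff (𝒱.Y (R gj.1 u)) gj.2 v) ≠ 0}.Finite ∧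
    ∀ w : W,
      prod₁₂ (𝒲.Y u) (𝒲.Y v) w -
          ∑ i, distMul (iterDist (fracIota₂₁ (hat p (f i))))
            (prod₂₁ (𝒲.Y (v' i)) (𝒲.Y (u' i)) w) =
        ∑ᶠ (g ∈ G₀) (j : ℕ), ((χ g : ℂ)⁻¹ * ((j.factorial : ℂ))⁻¹) •
          distMul
            ((distPD₂ p)^[j]
              (distMul (inFst p.coeff) (deltaDist ((χφ g : ℂ)⁻¹))))
            (inSnd fun n => HVertexOperator.coeff
              (𝒲.Y (VertexOperator.ncoeff (𝒱.Y (R g u)) j v)) n w) := by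
  classical
  obtain ⟨s, hs, hpoles⟩ := exists_poles hW u v
  -- Every matrix coefficient of `Y_W(Y(R(g)u, z)v, x)` has a pole at `z = 0` of order at most the
  -- multiplicity of `(χφ g)⁻¹` in `s`.
  have hvanish : ∀ (g : G) (n : ℤ), n < -(s.count (χφ g)⁻¹ : ℤ) →
      𝒲.Y (HVertexOperator.coeff (𝒱.Y (R g u)) n v) = 0 := by
    intro g n hn
    rw [← opSeries_eq_zero_iff]
    intro ℓ w
    obtain ⟨F, hF, -⟩ := exists_frac 𝒲 hp u v ℓ w
    obtain ⟨a, ha⟩ := hpoles ℓ w F hF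
    rw [← coeff_iterSeries, ← fracLift_sigma_eq 𝒲 hp hW u v ℓ w g hF, ha]
    exact coeff_fracLift_sigma_eq_zero hp _ a s hn
  have hvanish' : ∀ (g : G) (j : ℕ), s.count (χφ g)⁻¹ ≤ j →
      𝒲.Y (VertexOperator.ncoeff (𝒱.Y (R g u)) j v) = 0 := fun g j hj =>
    -- The `j`-th mode is the coefficient of `z ^ (-j - 1)`.
    hvanish g (-(j : ℤ) - 1) (by lia)
  have hinj : Set.InjOn (fun g => (χφ g)⁻¹) G₀ := fun g hg g' hg' h =>
    eq_of_apply_eq hG₀ hg hg' (inv_injective h)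
  have hGfin : {g | g ∈ G₀ ∧ (χφ g)⁻¹ ∈ s}.Finite :=
    Set.Finite.of_finite_image (f := fun g => (χφ g)⁻¹)
      (s.toFinset.finite_toSet.subset (by
        rintro _ ⟨g, hg, rfl⟩
        simpa using hg.2))
      (hinj.mono fun g hg => hg.1)
  set Gf := hGfin.toFinset with hGf
  have hmem : ∀ g, g ∈ Gf ↔ g ∈ G₀ ∧ (χφ g)⁻¹ ∈ s := fun g => by simp [hGf]
  refine ⟨?_, fun w => ?_⟩
  · refine (hGfin.prod (Set.finite_Iio (Multiset.card s))).subset fun gj hgj => ?_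
    have h1 : gj.2 < s.count (χφ gj.1)⁻¹ := by
      by_contra! h
      exact hgj.2 (hvanish' _ _ h)
    exact ⟨⟨hgj.1, Multiset.count_pos.1 (by lia)⟩, h1.trans_le (Multiset.count_le_card _ _)⟩
  set term : G → ℕ → FDist W := fun g j => ((χ g : ℂ)⁻¹ * ((j.factorial : ℂ))⁻¹) •
    distMul ((distPD₂ p)^[j] (distMul (inFst p.coeff) (deltaDist ((χφ g : ℂ)⁻¹))))
      (inSnd fun n => HVertexOperator.coeff
        (𝒲.Y (VertexOperator.ncoeff (𝒱.Y (R g u)) j v)) n w) with hterm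
  have hterm0 : ∀ g j, s.count (χφ g)⁻¹ ≤ j → term g j = 0 := fun g j hj => by
    funext m n
    simp only [hterm, Pi.smul_apply]
    rw [distMul_inSnd_apply]
    simp only [hvanish' g j hj, map_zero, Pi.zero_apply, LinearMap.zero_apply, smul_zero,
      finsum_zero]
  have hinner : ∀ g, ∑ᶠ j, term g j = ∑ j ∈ Finset.range (s.count (χφ g)⁻¹), term g j := fun g =>
    finsum_eq_sum_of_support_subset _ fun j hj => by
      by_contra h
      exact hj (hterm0 g j (by simpa using h))
  -- Both `finsum`s are replaced by finite sums: only coset representatives whose inverse character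
  -- value is a pole contribute, and for each only `j` below the multiplicity.
  have hsum : ∑ᶠ (g ∈ G₀) (j : ℕ), term g j =
      ∑ g ∈ Gf, ∑ j ∈ Finset.range (s.count (χφ g)⁻¹), term g j := by
    simp only [hinner]
    refine finsum_mem_eq_sum_of_inter_support_eq _ ?_
    ext g
    simp only [Set.mem_inter_iff, Function.mem_support, Finset.mem_coe, hmem]
    refine ⟨fun h => ⟨⟨h.1, ?_⟩, h.2⟩, fun h => ⟨h.1.1, h.2⟩⟩
    by_contra h1
    exact h.2 (by rw [Multiset.count_eq_zero_of_notMem h1]; simp)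
  rw [hsum]
  funext m n
  rw [← sub_eq_zero, ← Module.forall_dual_apply_eq_zero_iff ℂ]
  intro ℓ
  rw [map_sub, sub_eq_zero]
  obtain ⟨F, hF, hF'⟩ := exists_frac 𝒲 hp u v ℓ w
  obtain ⟨a, ha⟩ := hpoles ℓ w F hF
  have hiota := fracLift_iotaHom_eq 𝒲 hp u v r u' v' f hf
    (coeff_eq_sum_skewCoeff 𝒱 u v r u' v' f k hloc) ℓ w hF'
  -- With `M = -1 - m` the residue formula extracts the coefficient of `x₁ ^ m`.
  have hres := coeff_sub_coeff_eq_sum_residue hp s a ha (-1 - m) n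
  rw [show -1 - (-1 - m) = m by ring] at hres
  have hL : ℓ ((prod₁₂ (𝒲.Y u) (𝒲.Y v) w - ∑ i, distMul (iterDist (fracIota₂₁ (hat p (f i))))
      (prod₂₁ (𝒲.Y (v' i)) (𝒲.Y (u' i)) w)) m n) =
      ((fracLift iotaSwapHom_injective F).coeff n).coeff m -
        ((fracLift iotaHom_injective F).coeff m).coeff n := by
    have h1 : ℓ (prod₁₂ (𝒲.Y u) (𝒲.Y v) w m n) =
        ((fracLift iotaSwapHom_injective F).coeff n).coeff m := by
      rw [hF]
      exact (congrFun (congrFun (iterDist_opProd ℓ (𝒲.Y u) (𝒲.Y v) w) n) m).symm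
    have h2 : lmap ℓ (∑ i, distMul (iterDist (fracIota₂₁ (hat p (f i))))
        (prod₂₁ (𝒲.Y (v' i)) (𝒲.Y (u' i)) w)) = iterDist (fracLift iotaHom_injective F) := by
      rw [hiota, iterDist_sum, lmap_sum]
      refine Finset.sum_congr rfl fun i _ => ?_
      rw [lmap_distMul ℓ (isIter_iterDist _) (isIter_prod₂₁ _ _ _), iterDist_mul, iterDist_opProd]
    rw [Pi.sub_apply, Pi.sub_apply, map_sub, h1]
    exact congrArg _ (congrFun (congrFun h2 m) n)
  rw [hL, hres]
  -- Poles correspond bijectively to the elements of `Gf`, since `χφ` is injective on `G₀` and takes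
  -- all its values there.
  have himg : s.toFinset = Gf.image fun g => (χφ g)⁻¹ := by
    ext c
    simp only [Multiset.mem_toFinset, Finset.mem_image, hmem]
    refine ⟨fun hc => ?_, ?_⟩
    · obtain ⟨g, rfl⟩ := hs c hc
      obtain ⟨g', hg', h⟩ := exists_mem_apply_eq hG₀ g
      exact ⟨g', ⟨hg', by rwa [h]⟩, by rw [h]⟩
    · rintro ⟨g, hg, rfl⟩
      exact hg.2
  rw [himg, Finset.sum_image fun g hg g' hg' h => hinj ((hmem g).1 hg).1 ((hmem g').1 hg').1 h]
  simp only [Finset.sum_apply, map_sum]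
  refine Finset.sum_congr rfl fun g _ => ?_
  rw [fracLift_sigma_eq 𝒲 hp hW u v ℓ w g hF, coeff_mul_expX (N := s.count (χφ g)⁻¹) _ _ (by
    intro i hi
    rw [coeff_iterSeries]
    exact (opSeries_eq_zero_iff _).2 (hvanish g i hi) ℓ w), HahnSeries.coeff_sum, Finset.mul_sum]
  refine Finset.sum_congr rfl fun j _ => ?_
  -- The row at `x₁ ^ m` is `χ(g) (χφ g)⁻¹ ^ (M + 1)` times `(p d/dx)^j (p x ^ M)`, the same
  -- function of `x₂` that the residue computation produces.
  have hrow := iterate_distPD₂_row p (distMul_deltaDist_row hφ g (-1 - m)) j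
  rw [show -1 - (-1 - m) = m by ring] at hrow
  rw [hterm]
  simp only [Pi.smul_apply, map_smul]
  rw [lmap_distMul_inSnd ℓ w _ hrow, iterate_pD_smul, coeff_iterSeries,
    smul_mul_laurentSeries, HahnSeries.coeff_smul,
    HahnSeries.coeff_smul, Units.val_inv_eq_inv_val, VertexOperator.ncoeff_apply]
  simp only [smul_eq_mul]
  have hχ : (χ g : ℂ) ≠ 0 := (χ g).ne_zero
  field_simp
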